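/- Let $K\in\mathbb R$ and $a,b,c,\epsilon_+,\epsilon_->0$ (so the contrast $\kappa=\epsilon_+/\epsilon_->0$ is arbitrary), where for $K>0$ we also assume $\sqrt K\,a,\sqrt K\,b<\pi/2$. Put $f(x)=\cos(\sqrt K x)$ if $K>0$, $f(x)=1$ if $K=0$, $f(x)=\cosh(\sqrt{|K|}\,x)$ if $K<0$. Let $J_1=(-b,a)$, $J_2=(0,c)$, $\Omega_0=J_1\times J_2$, $\Omega_+=(0,a)\times J_2$, $\Omega_-=(-b,0)\times J_2$, $\mathcal C=\{0\}\times J_2$, and let $\Omega_0$ carry the metric $g=dx^2+f(x)^2dy^2$ of constant curvature $K$, so that $L^2(\Omega_0,g)=L^2(\Omega_0,f(x)\,dx\,dy)$ and $\Delta_g u=\partial_x^2u+\frac{f'}{f}\partial_xu+\frac1{f^2}\partial_y^2u$. Let $\dot A_K$ be the operator in $L^2(\Omega_0,g)$ whose domain consists of all $\psi=(\psi_+,\psi_-)\in H^2(\Omega_+)\oplus H^2(\Omega_-)$ such that, in the sense of traces, $\psi_\pm=0$ on $\partial\Omega_0$, $\psi_+=\psi_-$ on $\mathcal C$ and $\epsilon_+\partial_x\psi_+=-\epsilon_-\partial_x\psi_-$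 on $\mathcal C$, with $\dot A_K\psi=(-\epsilon_+\Delta_g\psi_+,\ \epsilon_-\Delta_g\psi_-)$. For $n\ge1$ let $A_K^n$ be the operator in $L^2(J_1,f\,dx)$ whose domain consists of all $\psi=(\psi_+,\psi_-)\in H^2((0,a))\oplus H^2((-b,0))$ with $\psi_+(a)=\psi_-(-b)=0$, $\psi_+(0)=\psi_-(0)$, $\epsilon_+\psi_+'(0)=-\epsilon_-\psi_-'(0)$, acting as $\epsilon\bigl(-\psi''-\frac{f'}{f}\psi'+\frac{(n\pi/c)^2}{f^2}\psi\bigr)$ with $\epsilon=\epsilon_+$ on $(0,a)$ and $\epsilon=-\epsilon_-$ on $(-b,0)$. Let $\phi_n(y)=\sqrt{2/c}\,\sin(n\pi y/c)$. Then: 1. $L^2(\Omega_0,g)$ has a (countably infinite) complete orthonormal set consisting of eigenfunctions of $\dot A_K$ with real eigenvalues. 2. $\dot A_K$ is essentially self-adjoint: it is densely defined and symmetric, and its closure $A_K:=\overline{\dot A_K}$ is self-adjoint; $A_K$ is the only self-adjoint extension of $\dot A_K$. 3. Each $A_K^n$, $n\ge1$, is self-adjoint with compact resolvent. 4. $\sigma_{\mathrm{point}}(\dot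 A_K)=\bigcup_{n\ge1}\sigma_{\mathrm{point}}(A_K^n)$ and $\sigma(A_K)=\overline{\sigma_{\mathrm{point}}(\dot A_K)}=\overline{\bigcup_{n\ge1}\sigma(A_K^n)}$. 5. The formula $(P_n\Psi)(x,y)=(\phi_n,\Psi(x,\cdot))_{L^2(J_2)}\,\phi_n(y)$ defines mutually orthogonal orthogonal projections $P_n$, $n\ge1$, in $L^2(\Omega_0,g)$ with $\sum_nP_n\Psi=\Psi$ for every $\Psi$, and $$A_K=\bigoplus_{n=1}^\infty(\mathbb I\otimes A_K^n)P_n ,$$ that is, $\Psi\in\operatorname{dom}A_K$ if and only if for every $n$ one has $P_n\Psi=\psi_n\otimes\phi_n$ with $\psi_n\in\operatorname{dom}A_K^n$ and the series $\sum_n(A_K^n\psi_n)\otimes\phi_n$ converges in $L^2(\Omega_0,g)$, and then $A_K\Psi$ is its sum. Here $(\psi\otimes\phi_n)(x,y)=\psi(x)\phi_n(y)$. -/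

import Mathlib

open MeasureTheory Set Filter Topology
open scoped ContDiff ENNReal

noncomputable section

namespace IndefLap

/-! ### Unbounded operators in a Hilbert space -/

/-- A densely defined symmetric operator is essentially self-adjoint if its closure is
self-adjoint. -/
structure IsEssentiallySelfAdjoint {H : Type*} [NormedAddCommGroup H] [InnerProductSpace ℂ H]
    [CompleteSpace H] (A : H →ₗ.[ℂ] H) : Prop where
  dense : Dense (A.domain : Set H)
  symmetric : A.IsFormalAdjoint A
  closable : A.IsClosable
  selfAdjoint : IsSelfAdjoint A.closure

/-- `R` is the bounded inverse `(A - z)⁻¹`. -/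
structure IsResolventAt {H : Type*} [NormedAddCommGroup H] [InnerProductSpace ℂ H]
    (A : H →ₗ.[ℂ] H) (z : ℂ) (R : H →L[ℂ] H) : Prop where
  right_inv : ∀ y : H, ∃ h : R y ∈ A.domain, A ⟨R y, h⟩ - z • R y = y
  left_inv : ∀ x : A.domain, R (A x - z • (x : H)) = x

/-- The spectrum of an unbounded operator. -/
def opSpectrum {H : Type*} [NormedAddCommGroup H] [InnerProductSpace ℂ H]
    (A : H →ₗ.[ℂ] H) : Set ℂ :=
  {z | ¬ ∃ R : H →L[ℂ] H, IsResolventAt A z R}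

/-- The set of eigenvalues of an unbounded operator. -/
def pointSpectrum {H : Type*} [NormedAddCommGroup H] [InnerProductSpace ℂ H]
    (A : H →ₗ.[ℂ] H) : Set ℂ :=
  {z | ∃ x : A.domain, (x : H) ≠ 0 ∧ A x = z • (x : H)}

/-- The resolvent set is non-empty and all resolvents are compact operators. -/
def HasCompactResolvent {H : Type*} [NormedAddCommGroup H] [InnerProductSpace ℂ H]
    (A : H →ₗ.[ℂ] H) : Prop :=
  (∃ (z : ℂ) (R : H →L[ℂ] H), IsResolventAt A z R) ∧
    ∀ (z : ℂ) (R : H →L[ℂ] H), IsResolventAt A z R → IsCompactOperator R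

/-! ### Weak derivatives, Sobolev spaces and traces -/

/-- `v` is the weak derivative of `u` on the open set `U` in the direction `e`. -/
def HasWeakDeriv {E : Type*} [NormedAddCommGroup E] [NormedSpace ℝ E] [MeasureSpace E]
    (U : Set E) (e : E) (u v : E → ℂ) : Prop :=
  ∀ φ : E → ℝ, ContDiff ℝ ∞ φ → HasCompactSupport φ → tsupport φ ⊆ U →
    ∫ x in U, fderiv ℝ φ x e • u x = - ∫ x in U, φ x • v x

/-- `u ∈ H¹(U)` with weak gradient `(u₁, u₂)`, for `U ⊆ ℝ²` open. -/
structure IsH1 (U : Set (ℝ × ℝ)) (u u₁ u₂ : ℝ × ℝ → ℂ) : Prop where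
  memLp : MemLp u 2 (volume.restrict U)
  memLp₁ : MemLp u₁ 2 (volume.restrict U)
  memLp₂ : MemLp u₂ 2 (volume.restrict U)
  deriv₁ : HasWeakDeriv U (1, 0) u u₁
  deriv₂ : HasWeakDeriv U (0, 1) u u₂

/-- `u ∈ H²(U)` with the displayed weak derivatives of first and second order. -/
structure IsH2 (U : Set (ℝ × ℝ)) (u u₁ u₂ u₁₁ u₁₂ u₂₁ u₂₂ : ℝ × ℝ → ℂ) : Prop where
  base : IsH1 U u u₁ u₂
  fst : IsH1 U u₁ u₁₁ u₁₂
  snd : IsH1 U u₂ u₂₁ u₂₂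

/-- The function `u ∈ H¹(U)` with weak gradient `(u₁, u₂)` has trace `h` on the side
`{γ t | t ∈ I}` of the rectangle `U`: the trace operator is the continuous extension of the
restriction of functions smooth up to the boundary, so its graph is the closure of the graph of
the restriction map in `H¹(U) × L²(I)`. -/
def HasTrace (U : Set (ℝ × ℝ)) (I : Set ℝ) (γ : ℝ → ℝ × ℝ) (u u₁ u₂ : ℝ × ℝ → ℂ)
    (h : ℝ → ℂ) : Prop :=
  MemLp h 2 (volume.restrict I) ∧
  ∃ w : ℕ → ℝ × ℝ → ℂ, (∀ k, ContDiff ℝ ∞ (w k)) ∧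
    Tendsto (fun k => eLpNorm (fun p => u p - w k p) 2 (volume.restrict U)) atTop (𝓝 0) ∧
    Tendsto (fun k => eLpNorm (fun p => u₁ p - fderiv ℝ (w k) p (1, 0)) 2 (volume.restrict U))
      atTop (𝓝 0) ∧
    Tendsto (fun k => eLpNorm (fun p => u₂ p - fderiv ℝ (w k) p (0, 1)) 2 (volume.restrict U))
      atTop (𝓝 0) ∧
    Tendsto (fun k => eLpNorm (fun t => h t - w k (γ t)) 2 (volume.restrict I)) atTop (𝓝 0)

/-- `u ∈ H²(U)` with weak derivatives `u'`, `u''`, for `U ⊆ ℝ` open. -/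
structure IsH2Line (U : Set ℝ) (u u' u'' : ℝ → ℂ) : Prop where
  memLp : MemLp u 2 (volume.restrict U)
  memLp' : MemLp u' 2 (volume.restrict U)
  memLp'' : MemLp u'' 2 (volume.restrict U)
  deriv' : HasWeakDeriv U 1 u u'
  deriv'' : HasWeakDeriv U 1 u' u''

/-- The continuous representative of `u` on the closure of `U ⊆ ℝ` takes the value `z` at the
point `x₀` of that closure. -/
def HasValueAt (U : Set ℝ) (x₀ : ℝ) (u : ℝ → ℂ) (z : ℂ) : Prop :=
  ∃ v : ℝ → ℂ, ContinuousOn v (closure U) ∧ u =ᵐ[volume.restrict U] v ∧ v x₀ = z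

/-! Linearity of these notions. -/

section Linear

variable {E : Type*} [NormedAddCommGroup E] [NormedSpace ℝ E] [MeasureSpace E]

theorem HasWeakDeriv.smul {U : Set E} {e : E} {u v : E → ℂ} (c : ℂ)
    (h : HasWeakDeriv U e u v) : HasWeakDeriv U e (c • u) (c • v) := by
  intro φ h1 h2 h3
  simp only [Pi.smul_apply, smul_comm _ c]
  rw [integral_smul, integral_smul, h φ h1 h2 h3, smul_neg]

theorem HasWeakDeriv.zero {U : Set E} {e : E} : HasWeakDeriv U e 0 0 := by
  intro φ h1 h2 h3
  simp

variable [BorelSpace E] [FiniteDimensional ℝ E] [IsLocallyFiniteMeasure (volume : Measure E)]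

theorem integrable_test_smul {U : Set E} {u : E → ℂ} (hu : MemLp u 2 (volume.restrict U))
    {φ : E → ℝ} (hφ : Continuous φ) (hc : HasCompactSupport φ) :
    Integrable (fun x => φ x • u x) (volume.restrict U) := by
  have h1 : MemLp φ 2 (volume.restrict U) := hφ.memLp_of_hasCompactSupport hc
  exact memLp_one_iff_integrable.1 (hu.smul (p := 2) (q := 2) (r := 1) h1)

theorem integrable_dtest_smul {U : Set E} {u : E → ℂ} (hu : MemLp u 2 (volume.restrict U))
    {φ : E → ℝ} (hφ : ContDiff ℝ ∞ φ) (hc : HasCompactSupport φ) (e : E) :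
    Integrable (fun x => fderiv ℝ φ x e • u x) (volume.restrict U) := by
  refine integrable_test_smul hu (φ := fun x => fderiv ℝ φ x e) ?_ ?_
  · exact (hφ.continuous_fderiv (by simp)).clm_apply continuous_const
  · exact hc.fderiv_apply ℝ e

theorem HasWeakDeriv.add {U : Set E} {e : E} {u v u' v' : E → ℂ}
    (mu : MemLp u 2 (volume.restrict U)) (mv : MemLp v 2 (volume.restrict U))
    (mu' : MemLp u' 2 (volume.restrict U)) (mv' : MemLp v' 2 (volume.restrict U))
    (h : HasWeakDeriv U e u v) (h' : HasWeakDeriv U e u' v') :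
    HasWeakDeriv U e (u + u') (v + v') := by
  intro φ h1 h2 h3
  simp only [Pi.add_apply, smul_add]
  rw [integral_add (integrable_dtest_smul mu h1 h2 e) (integrable_dtest_smul mu' h1 h2 e),
    integral_add (integrable_test_smul mv h1.continuous h2)
      (integrable_test_smul mv' h1.continuous h2), h φ h1 h2 h3, h' φ h1 h2 h3]
  ring

/-- Weak derivatives are unique: the weak derivative of an almost everywhere vanishing function
vanishes almost everywhere. -/
theorem HasWeakDeriv.ae_eq_zero {U : Set E} (hU : IsOpen U) {e : E} {u v : E → ℂ}
    (mv : MemLp v 2 (volume.restrict U)) (h : HasWeakDeriv U e u v)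
    (hu : u =ᵐ[volume.restrict U] 0) : v =ᵐ[volume.restrict U] 0 := by
  have hl : LocallyIntegrableOn v U volume :=
    locallyIntegrableOn_of_locallyIntegrable_restrict (mv.locallyIntegrable (by norm_num))
  have := hU.ae_eq_zero_of_integral_contDiff_smul_eq_zero hl (fun g g1 g2 g3 => by
    have e1 := h g g1 g2 g3
    have e2 : ∫ x in U, fderiv ℝ g x e • u x = 0 := by
      rw [integral_congr_ae (g := fun _ => (0 : ℂ))]
      · simp
      · filter_upwards [hu] with x hx
        simp [hx]
    rw [e2, zero_eq_neg] at e1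
    rw [← e1, setIntegral_eq_integral_of_forall_compl_eq_zero]
    intro x hx
    rw [image_eq_zero_of_notMem_tsupport (fun h' => hx (g3 h')), zero_smul])
  exact (ae_restrict_iff' hU.measurableSet).2 this

end Linear

theorem IsH1.add {U : Set (ℝ × ℝ)} {u u₁ u₂ v v₁ v₂ : ℝ × ℝ → ℂ}
    (h : IsH1 U u u₁ u₂) (k : IsH1 U v v₁ v₂) : IsH1 U (u + v) (u₁ + v₁) (u₂ + v₂) :=
  ⟨h.memLp.add k.memLp, h.memLp₁.add k.memLp₁, h.memLp₂.add k.memLp₂,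
    h.deriv₁.add h.memLp h.memLp₁ k.memLp k.memLp₁ k.deriv₁,
    h.deriv₂.add h.memLp h.memLp₂ k.memLp k.memLp₂ k.deriv₂⟩

theorem IsH1.smul {U : Set (ℝ × ℝ)} {u u₁ u₂ : ℝ × ℝ → ℂ} (z : ℂ)
    (h : IsH1 U u u₁ u₂) : IsH1 U (z • u) (z • u₁) (z • u₂) :=
  ⟨h.memLp.const_smul z, h.memLp₁.const_smul z, h.memLp₂.const_smul z,
    h.deriv₁.smul z, h.deriv₂.smul z⟩

theorem IsH2.add {U : Set (ℝ × ℝ)} {u u₁ u₂ u₁₁ u₁₂ u₂₁ u₂₂ v v₁ v₂ v₁₁ v₁₂ v₂₁ v₂₂ : ℝ × ℝ → ℂ}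
    (h : IsH2 U u u₁ u₂ u₁₁ u₁₂ u₂₁ u₂₂) (k : IsH2 U v v₁ v₂ v₁₁ v₁₂ v₂₁ v₂₂) :
    IsH2 U (u + v) (u₁ + v₁) (u₂ + v₂) (u₁₁ + v₁₁) (u₁₂ + v₁₂) (u₂₁ + v₂₁) (u₂₂ + v₂₂) :=
  ⟨h.base.add k.base, h.fst.add k.fst, h.snd.add k.snd⟩

theorem IsH2.smul {U : Set (ℝ × ℝ)} {u u₁ u₂ u₁₁ u₁₂ u₂₁ u₂₂ : ℝ × ℝ → ℂ} (z : ℂ)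
    (h : IsH2 U u u₁ u₂ u₁₁ u₁₂ u₂₁ u₂₂) :
    IsH2 U (z • u) (z • u₁) (z • u₂) (z • u₁₁) (z • u₁₂) (z • u₂₁) (z • u₂₂) :=
  ⟨h.base.smul z, h.fst.smul z, h.snd.smul z⟩

theorem isH1_zero {U : Set (ℝ × ℝ)} : IsH1 U 0 0 0 :=
  ⟨MemLp.zero, MemLp.zero, MemLp.zero, HasWeakDeriv.zero, HasWeakDeriv.zero⟩

theorem isH2_zero {U : Set (ℝ × ℝ)} : IsH2 U 0 0 0 0 0 0 0 :=
  ⟨isH1_zero, isH1_zero, isH1_zero⟩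

theorem tendsto_eLpNorm_sub_add {α : Type*} [MeasurableSpace α] {μ : Measure α}
    {u v : α → ℂ} {f g : ℕ → α → ℂ} (hu : AEStronglyMeasurable u μ)
    (hv : AEStronglyMeasurable v μ) (hf : ∀ k, AEStronglyMeasurable (f k) μ)
    (hg : ∀ k, AEStronglyMeasurable (g k) μ)
    (h : Tendsto (fun k => eLpNorm (fun p => u p - f k p) 2 μ) atTop (𝓝 0))
    (h' : Tendsto (fun k => eLpNorm (fun p => v p - g k p) 2 μ) atTop (𝓝 0)) :
    Tendsto (fun k => eLpNorm (fun p => (u + v) p - (f k p + g k p)) 2 μ) atTop (𝓝 0) := by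
  refine tendsto_of_tendsto_of_tendsto_of_le_of_le tendsto_const_nhds
    (by simpa using h.add h') (fun _ => zero_le) (fun k => ?_)
  refine le_trans (le_of_eq ?_)
    (eLpNorm_add_le (hu.sub (hf k)) (hv.sub (hg k)) (by norm_num : (1 : ℝ≥0∞) ≤ 2))
  congr 1
  funext p
  simp only [Pi.add_apply]
  ring

theorem tendsto_eLpNorm_sub_smul {α : Type*} [MeasurableSpace α] {μ : Measure α}
    {u : α → ℂ} {f : ℕ → α → ℂ} (z : ℂ)
    (h : Tendsto (fun k => eLpNorm (fun p => u p - f k p) 2 μ) atTop (𝓝 0)) :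
    Tendsto (fun k => eLpNorm (fun p => (z • u) p - z • f k p) 2 μ) atTop (𝓝 0) := by
  have : (fun k => eLpNorm (fun p => (z • u) p - z • f k p) 2 μ)
      = fun k => ‖z‖ₑ * eLpNorm (fun p => u p - f k p) 2 μ := by
    funext k
    rw [← eLpNorm_const_smul]
    congr 1
    funext p
    simp [mul_sub]
  rw [this]
  simpa using ENNReal.Tendsto.const_mul h (Or.inr (by simp))

theorem HasTrace.add {U : Set (ℝ × ℝ)} {I : Set ℝ} {γ : ℝ → ℝ × ℝ} (hγ : Continuous γ)
    {u u₁ u₂ v v₁ v₂ : ℝ × ℝ → ℂ} {h k : ℝ → ℂ} (hu : IsH1 U u u₁ u₂) (hv : IsH1 U v v₁ v₂)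
    (H : HasTrace U I γ u u₁ u₂ h) (K : HasTrace U I γ v v₁ v₂ k) :
    HasTrace U I γ (u + v) (u₁ + v₁) (u₂ + v₂) (h + k) := by
  obtain ⟨mh, w, sw, h0, h1, h2, h3⟩ := H
  obtain ⟨mk, w', sw', k0, k1, k2, k3⟩ := K
  have dw : ∀ n p, DifferentiableAt ℝ (w n) p := fun n p =>
    (sw n).differentiable (by simp) p
  have dw' : ∀ n p, DifferentiableAt ℝ (w' n) p := fun n p =>
    (sw' n).differentiable (by simp) p
  have cd : ∀ (f : ℝ × ℝ → ℂ) (_ : ContDiff ℝ ∞ f) (e : ℝ × ℝ),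
      Continuous fun p => fderiv ℝ f p e := fun f hf e =>
    (hf.continuous_fderiv (by simp)).clm_apply continuous_const
  refine ⟨mh.add mk, fun n p => w n p + w' n p, fun n => (sw n).add (sw' n), ?_, ?_, ?_, ?_⟩
  · exact tendsto_eLpNorm_sub_add hu.memLp.1 hv.memLp.1
      (fun n => (sw n).continuous.aestronglyMeasurable)
      (fun n => (sw' n).continuous.aestronglyMeasurable) h0 k0
  · have e : ∀ n p, fderiv ℝ (fun p => w n p + w' n p) p (1, 0)
        = fderiv ℝ (w n) p (1, 0) + fderiv ℝ (w' n) p (1, 0) := fun n p => by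
      rw [fderiv_fun_add (dw n p) (dw' n p)]; rfl
    simp only [e]
    exact tendsto_eLpNorm_sub_add hu.memLp₁.1 hv.memLp₁.1
      (fun n => (cd _ (sw n) _).aestronglyMeasurable)
      (fun n => (cd _ (sw' n) _).aestronglyMeasurable) h1 k1
  · have e : ∀ n p, fderiv ℝ (fun p => w n p + w' n p) p (0, 1)
        = fderiv ℝ (w n) p (0, 1) + fderiv ℝ (w' n) p (0, 1) := fun n p => by
      rw [fderiv_fun_add (dw n p) (dw' n p)]; rfl
    simp only [e]
    exact tendsto_eLpNorm_sub_add hu.memLp₂.1 hv.memLp₂.1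
      (fun n => (cd _ (sw n) _).aestronglyMeasurable)
      (fun n => (cd _ (sw' n) _).aestronglyMeasurable) h2 k2
  · exact tendsto_eLpNorm_sub_add mh.1 mk.1
      (fun n => ((sw n).continuous.comp hγ).aestronglyMeasurable)
      (fun n => ((sw' n).continuous.comp hγ).aestronglyMeasurable) h3 k3

theorem HasTrace.smul {U : Set (ℝ × ℝ)} {I : Set ℝ} {γ : ℝ → ℝ × ℝ}
    {u u₁ u₂ : ℝ × ℝ → ℂ} {h : ℝ → ℂ} (z : ℂ)
    (H : HasTrace U I γ u u₁ u₂ h) :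
    HasTrace U I γ (z • u) (z • u₁) (z • u₂) (z • h) := by
  obtain ⟨mh, w, sw, h0, h1, h2, h3⟩ := H
  have dw : ∀ n p, DifferentiableAt ℝ (w n) p := fun n p =>
    (sw n).differentiable (by simp) p
  have e : ∀ n p q, fderiv ℝ (fun p => z • w n p) p q = z • fderiv ℝ (w n) p q := fun n p q => by
    rw [fderiv_fun_const_smul (dw n p)]; rfl
  refine ⟨mh.const_smul z, fun n p => z • w n p, fun n => (sw n).const_smul z, ?_, ?_, ?_, ?_⟩
  · exact tendsto_eLpNorm_sub_smul z h0
  · simp only [e]; exact tendsto_eLpNorm_sub_smul z h1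
  · simp only [e]; exact tendsto_eLpNorm_sub_smul z h2
  · exact tendsto_eLpNorm_sub_smul z h3

theorem hasTrace_zero {U : Set (ℝ × ℝ)} {I : Set ℝ} {γ : ℝ → ℝ × ℝ} :
    HasTrace U I γ 0 0 0 0 :=
  ⟨MemLp.zero, fun _ _ => 0, fun _ => contDiff_const, by simp, by simp, by simp, by simp⟩

theorem IsH2Line.add {U : Set ℝ} {u u' u'' v v' v'' : ℝ → ℂ}
    (h : IsH2Line U u u' u'') (k : IsH2Line U v v' v'') :
    IsH2Line U (u + v) (u' + v') (u'' + v'') :=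
  ⟨h.memLp.add k.memLp, h.memLp'.add k.memLp', h.memLp''.add k.memLp'',
    h.deriv'.add h.memLp h.memLp' k.memLp k.memLp' k.deriv',
    h.deriv''.add h.memLp' h.memLp'' k.memLp' k.memLp'' k.deriv''⟩

theorem IsH2Line.smul {U : Set ℝ} {u u' u'' : ℝ → ℂ} (z : ℂ)
    (h : IsH2Line U u u' u'') : IsH2Line U (z • u) (z • u') (z • u'') :=
  ⟨h.memLp.const_smul z, h.memLp'.const_smul z, h.memLp''.const_smul z,
    h.deriv'.smul z, h.deriv''.smul z⟩

theorem HasValueAt.add {U : Set ℝ} {x₀ : ℝ} {u v : ℝ → ℂ} {z w : ℂ}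
    (h : HasValueAt U x₀ u z) (k : HasValueAt U x₀ v w) : HasValueAt U x₀ (u + v) (z + w) := by
  obtain ⟨f, hf, hu, hz⟩ := h
  obtain ⟨g, hg, hv, hw⟩ := k
  exact ⟨f + g, hf.add hg, hu.add hv, by simp [hz, hw]⟩

theorem HasValueAt.smul {U : Set ℝ} {x₀ : ℝ} {u : ℝ → ℂ} {w : ℂ} (z : ℂ)
    (h : HasValueAt U x₀ u w) : HasValueAt U x₀ (z • u) (z • w) := by
  obtain ⟨f, hf, hu, hz⟩ := h
  exact ⟨z • f, hf.const_smul z, hu.const_smul z, by simp [hz]⟩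

theorem hasValueAt_zero {U : Set ℝ} {x₀ : ℝ} : HasValueAt U x₀ 0 0 :=
  ⟨0, continuousOn_const, Filter.EventuallyEq.rfl, rfl⟩

/-! ### The geometry -/

/-- The Jacobian `f` of the Fermi coordinates around a geodesic on a surface of constant curvature
`K`; the metric is `dx² + f(x)² dy²`. It solves `f'' + K f = 0`, `f(0) = 1`, `f'(0) = 0`. -/
def jac (K x : ℝ) : ℝ :=
  if 0 < K then Real.cos (√K * x) else if K = 0 then 1 else Real.cosh (√(-K) * x)

/-- The measure `f(x) dx` on `J₁ = (-b, a)`. -/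
def lineMeasure (K a b : ℝ) : Measure ℝ :=
  (volume.restrict (Ioo (-b) a)).withDensity fun x => ENNReal.ofReal (jac K x)

/-- The Riemannian measure `f(x) dx dy` on `Ω₀ = (-b, a) × (0, c)`. -/
def rectMeasure (K a b c : ℝ) : Measure (ℝ × ℝ) :=
  (lineMeasure K a b).prod (volume.restrict (Ioo 0 c))

/-- `L²(J₁, f dx)`. -/
abbrev L2Line (K a b : ℝ) : Type := Lp ℂ 2 (lineMeasure K a b)

/-- `L²(Ω₀, g)`. -/
abbrev L2Rect (K a b c : ℝ) : Type := Lp ℂ 2 (rectMeasure K a b c)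

/-- The coefficient `ε`, equal to `ε₊` for `x > 0` and to `-ε₋` for `x ≤ 0`. -/
def coef (εp εm x : ℝ) : ℝ := if 0 < x then εp else -εm

/-! The measures have the same null sets as Lebesgue measure on the two sides of the interface. -/

theorem jac_pos {K a b x : ℝ}
    (hK : 0 < K → √K * a < Real.pi / 2 ∧ √K * b < Real.pi / 2) (hx : x ∈ Ioo (-b) a) :
    0 < jac K x := by
  unfold jac
  split_ifs with h h'
  · obtain ⟨h1, h2⟩ := hK h
    have hs : 0 < √K := Real.sqrt_pos.2 h
    refine Real.cos_pos_of_mem_Ioo ⟨?_, ?_⟩ <;> nlinarith [hx.1, hx.2]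
  · exact one_pos
  · exact Real.cosh_pos _

theorem measurable_jac (K : ℝ) : Measurable (jac K) := by
  unfold jac
  split_ifs <;> fun_prop

theorem volume_ac_lineMeasure {K a b : ℝ}
    (hK : 0 < K → √K * a < Real.pi / 2 ∧ √K * b < Real.pi / 2) :
    volume.restrict (Ioo (-b) a) ≪ lineMeasure K a b := by
  refine withDensity_absolutelyContinuous' (measurable_jac K).ennreal_ofReal.aemeasurable ?_
  filter_upwards [ae_restrict_mem measurableSet_Ioo] with x hx
  simpa using jac_pos hK hx

theorem restrict_split {a b : ℝ} (ha : 0 < a) (hb : 0 < b) :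
    (volume.restrict (Ioo (-b) a) : Measure ℝ) = volume.restrict (Ioo 0 a ∪ Ioo (-b) 0) := by
  refine Measure.restrict_congr_set ?_
  filter_upwards [compl_mem_ae_iff.2 (measure_singleton (0 : ℝ))] with x hx
  have hx : x ≠ 0 := hx
  refine propext ⟨fun h => ?_, fun h => ?_⟩
  · rcases lt_or_gt_of_ne hx with h0 | h0
    · exact Or.inr ⟨h.1, h0⟩
    · exact Or.inl ⟨h0, h.2⟩
  · rcases h with h | h
    · exact ⟨by linarith [h.1], h.2⟩
    · exact ⟨h.1, by linarith [h.2]⟩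

theorem ae_lineMeasure_iff {K a b : ℝ} (ha : 0 < a) (hb : 0 < b)
    (hK : 0 < K → √K * a < Real.pi / 2 ∧ √K * b < Real.pi / 2) {p : ℝ → Prop} :
    (∀ᵐ x ∂(lineMeasure K a b), p x) ↔
      (∀ᵐ x ∂(volume.restrict (Ioo 0 a)), p x) ∧ ∀ᵐ x ∂(volume.restrict (Ioo (-b) 0)), p x := by
  rw [← ae_restrict_union_iff, ← restrict_split ha hb]
  exact ⟨fun h => (volume_ac_lineMeasure hK).ae_le h,
    fun h => (withDensity_absolutelyContinuous _ _).ae_le h⟩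

theorem ae_rectMeasure_iff {K a b c : ℝ} (ha : 0 < a) (hb : 0 < b)
    (hK : 0 < K → √K * a < Real.pi / 2 ∧ √K * b < Real.pi / 2) {p : ℝ × ℝ → Prop} :
    (∀ᵐ x ∂(rectMeasure K a b c), p x) ↔
      (∀ᵐ x ∂(volume.restrict (Ioo 0 a ×ˢ Ioo 0 c)), p x) ∧
        ∀ᵐ x ∂(volume.restrict (Ioo (-b) 0 ×ˢ Ioo 0 c)), p x := by
  rw [← ae_restrict_union_iff, ← union_prod, Measure.volume_eq_prod, ← Measure.prod_restrict,
    ← restrict_split ha hb]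
  exact ⟨fun h => ((volume_ac_lineMeasure hK).prod Measure.AbsolutelyContinuous.rfl).ae_le h,
    fun h => ((withDensity_absolutelyContinuous _ _).prod
      Measure.AbsolutelyContinuous.rfl).ae_le h⟩

/-! ### The operator on the rectangle -/

/-- The pair of restrictions of `u` to `Ω₊ = (0, a) × (0, c)` and `Ω₋ = (-b, 0) × (0, c)` is in
`H²(Ω₊) ⊕ H²(Ω₋)`, the other functions being the derivatives taken separately on `Ω₊` and `Ω₋`;
`u` satisfies the Dirichlet condition on `∂Ω₀`, is continuous across the interface `x = 0`, and
`ε₊ ∂ₓu₊ = -ε₋ ∂ₓu₋` there. -/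
structure DotDomain (a b c εp εm : ℝ) (u u₁ u₂ u₁₁ u₁₂ u₂₁ u₂₂ : ℝ × ℝ → ℂ) : Prop where
  plus : IsH2 (Ioo 0 a ×ˢ Ioo 0 c) u u₁ u₂ u₁₁ u₁₂ u₂₁ u₂₂
  minus : IsH2 (Ioo (-b) 0 ×ˢ Ioo 0 c) u u₁ u₂ u₁₁ u₁₂ u₂₁ u₂₂
  right : HasTrace (Ioo 0 a ×ˢ Ioo 0 c) (Ioo 0 c) (fun y => (a, y)) u u₁ u₂ 0
  left : HasTrace (Ioo (-b) 0 ×ˢ Ioo 0 c) (Ioo 0 c) (fun y => (-b, y)) u u₁ u₂ 0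
  bottom_plus : HasTrace (Ioo 0 a ×ˢ Ioo 0 c) (Ioo 0 a) (fun x => (x, 0)) u u₁ u₂ 0
  top_plus : HasTrace (Ioo 0 a ×ˢ Ioo 0 c) (Ioo 0 a) (fun x => (x, c)) u u₁ u₂ 0
  bottom_minus : HasTrace (Ioo (-b) 0 ×ˢ Ioo 0 c) (Ioo (-b) 0) (fun x => (x, 0)) u u₁ u₂ 0
  top_minus : HasTrace (Ioo (-b) 0 ×ˢ Ioo 0 c) (Ioo (-b) 0) (fun x => (x, c)) u u₁ u₂ 0
  continuity : ∃ h : ℝ → ℂ,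
    HasTrace (Ioo 0 a ×ˢ Ioo 0 c) (Ioo 0 c) (fun y => (0, y)) u u₁ u₂ h ∧
    HasTrace (Ioo (-b) 0 ×ˢ Ioo 0 c) (Ioo 0 c) (fun y => (0, y)) u u₁ u₂ h
  flux : ∃ h k : ℝ → ℂ,
    HasTrace (Ioo 0 a ×ˢ Ioo 0 c) (Ioo 0 c) (fun y => (0, y)) u₁ u₁₁ u₁₂ h ∧
    HasTrace (Ioo (-b) 0 ×ˢ Ioo 0 c) (Ioo 0 c) (fun y => (0, y)) u₁ u₁₁ u₁₂ k ∧
    ∀ᵐ y ∂(volume.restrict (Ioo 0 c)), (εp : ℂ) * h y = -((εm : ℂ) * k y)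

/-- The Laplace–Beltrami expression `f⁻¹ ∂₁(f ∂₁u) + f⁻¹ ∂₂(f⁻¹ ∂₂u)` for the metric
`dx² + f(x)² dy²`, in terms of the derivatives of `u`. -/
def laplaceBeltrami (K : ℝ) (u₁ u₁₁ u₂₂ : ℝ × ℝ → ℂ) (p : ℝ × ℝ) : ℂ :=
  u₁₁ p + ((deriv (jac K) p.1 / jac K p.1 : ℝ) : ℂ) * u₁ p
    + ((1 / jac K p.1 ^ 2 : ℝ) : ℂ) * u₂₂ p

/-- The graph of `Ȧ_K`. -/
def dotGraph (K a b c εp εm : ℝ) : Submodule ℂ (L2Rect K a b c × L2Rect K a b c) where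
  carrier := {q | ∃ u u₁ u₂ u₁₁ u₁₂ u₂₁ u₂₂ : ℝ × ℝ → ℂ,
    DotDomain a b c εp εm u u₁ u₂ u₁₁ u₁₂ u₂₁ u₂₂ ∧
    q.1 =ᵐ[rectMeasure K a b c] u ∧
    q.2 =ᵐ[rectMeasure K a b c]
      fun p => -((coef εp εm p.1 : ℂ) * laplaceBeltrami K u₁ u₁₁ u₂₂ p)}
  zero_mem' := by
    refine ⟨0, 0, 0, 0, 0, 0, 0, ⟨isH2_zero, isH2_zero, hasTrace_zero, hasTrace_zero,
      hasTrace_zero, hasTrace_zero, hasTrace_zero, hasTrace_zero,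
      ⟨0, hasTrace_zero, hasTrace_zero⟩, ⟨0, 0, hasTrace_zero, hasTrace_zero, ?_⟩⟩, ?_, ?_⟩
    · simp
    · exact Lp.coeFn_zero _ _ _
    · refine (Lp.coeFn_zero _ _ _).trans (Eventually.of_forall fun p => ?_)
      simp [laplaceBeltrami]
  add_mem' := by
    rintro ⟨Ψ, Φ⟩ ⟨Ψ', Φ'⟩ ⟨u, u₁, u₂, u₁₁, u₁₂, u₂₁, u₂₂, D, hΨ, hΦ⟩
      ⟨v, v₁, v₂, v₁₁, v₁₂, v₂₁, v₂₂, D', hΨ', hΦ'⟩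
    have cx : ∀ x : ℝ, Continuous fun y : ℝ => (x, y) := fun x => by fun_prop
    have cy : ∀ y : ℝ, Continuous fun x : ℝ => (x, y) := fun y => by fun_prop
    obtain ⟨h, h1, h2⟩ := D.continuity
    obtain ⟨h', h1', h2'⟩ := D'.continuity
    obtain ⟨r, s, r1, s1, rs⟩ := D.flux
    obtain ⟨r', s', r1', s1', rs'⟩ := D'.flux
    have P := D.plus.base
    have M := D.minus.base
    have P' := D'.plus.base
    have M' := D'.minus.base
    refine ⟨u + v, u₁ + v₁, u₂ + v₂, u₁₁ + v₁₁, u₁₂ + v₁₂, u₂₁ + v₂₁, u₂₂ + v₂₂,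
      ⟨D.plus.add D'.plus, D.minus.add D'.minus,
        by simpa using D.right.add (cx _) P P' D'.right,
        by simpa using D.left.add (cx _) M M' D'.left,
        by simpa using D.bottom_plus.add (cy _) P P' D'.bottom_plus,
        by simpa using D.top_plus.add (cy _) P P' D'.top_plus,
        by simpa using D.bottom_minus.add (cy _) M M' D'.bottom_minus,
        by simpa using D.top_minus.add (cy _) M M' D'.top_minus,
        ⟨h + h', h1.add (cx _) P P' h1', h2.add (cx _) M M' h2'⟩,
        ⟨r + r', s + s', r1.add (cx _) D.plus.fst D'.plus.fst r1',
          s1.add (cx _) D.minus.fst D'.minus.fst s1', ?_⟩⟩, ?_, ?_⟩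
    · filter_upwards [rs, rs'] with y e e'
      simp only [Pi.add_apply, mul_add, e, e']
      ring
    · exact (Lp.coeFn_add _ _).trans (hΨ.add hΨ')
    · refine (Lp.coeFn_add _ _).trans ?_
      filter_upwards [hΦ, hΦ'] with p e e'
      simp only [Pi.add_apply, laplaceBeltrami] at *
      rw [e, e']
      ring
  smul_mem' := by
    rintro z ⟨Ψ, Φ⟩ ⟨u, u₁, u₂, u₁₁, u₁₂, u₂₁, u₂₂, D, hΨ, hΦ⟩
    obtain ⟨h, h1, h2⟩ := D.continuity
    obtain ⟨r, s, r1, s1, rs⟩ := D.flux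
    refine ⟨z • u, z • u₁, z • u₂, z • u₁₁, z • u₁₂, z • u₂₁, z • u₂₂,
      ⟨D.plus.smul z, D.minus.smul z,
        by simpa using D.right.smul z, by simpa using D.left.smul z,
        by simpa using D.bottom_plus.smul z, by simpa using D.top_plus.smul z,
        by simpa using D.bottom_minus.smul z, by simpa using D.top_minus.smul z,
        ⟨z • h, h1.smul z, h2.smul z⟩, ⟨z • r, z • s, r1.smul z, s1.smul z, ?_⟩⟩, ?_, ?_⟩
    · filter_upwards [rs] with y e
      simp only [Pi.smul_apply, smul_eq_mul]
      linear_combination z * e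
    · exact (Lp.coeFn_smul _ _).trans (hΨ.const_smul z)
    · refine (Lp.coeFn_smul _ _).trans ?_
      filter_upwards [hΦ] with p e
      simp only [Pi.smul_apply, smul_eq_mul, laplaceBeltrami] at *
      rw [e]
      ring

/-- The operator `Ȧ_K` in `L²(Ω₀, g)`. -/
def dotA (K a b c εp εm : ℝ) : L2Rect K a b c →ₗ.[ℂ] L2Rect K a b c :=
  (dotGraph K a b c εp εm).toLinearPMap

/-- The graph of `Ȧ_K` is `dotGraph`. -/
theorem dotA_graph {K a b c εp εm : ℝ} (ha : 0 < a) (hb : 0 < b)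
    (hK : 0 < K → √K * a < Real.pi / 2 ∧ √K * b < Real.pi / 2) :
    (dotA K a b c εp εm).graph = dotGraph K a b c εp εm := by
  refine Submodule.toLinearPMap_graph_eq _ ?_
  rintro ⟨Ψ, Φ⟩ ⟨u, u₁, u₂, u₁₁, u₁₂, u₂₁, u₂₂, D, hΨ, hΦ⟩ h0
  have h0 : Ψ = 0 := h0
  subst h0
  have hu : u =ᵐ[rectMeasure K a b c] 0 := hΨ.symm.trans (Lp.coeFn_zero _ _ _)
  obtain ⟨hp, hm⟩ := (ae_rectMeasure_iff ha hb hK).1 hu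
  have key : ∀ U : Set (ℝ × ℝ), IsOpen U → IsH2 U u u₁ u₂ u₁₁ u₁₂ u₂₁ u₂₂ →
      (∀ᵐ x ∂(volume.restrict U), u x = (0 : ℝ × ℝ → ℂ) x) →
      ∀ᵐ x ∂(volume.restrict U),
        -((coef εp εm x.1 : ℂ) * laplaceBeltrami K u₁ u₁₁ u₂₂ x) = 0 := by
    intro U hU h2 h
    have e1 := h2.base.deriv₁.ae_eq_zero hU h2.base.memLp₁ h
    have e2 := h2.base.deriv₂.ae_eq_zero hU h2.base.memLp₂ h
    have e11 := h2.fst.deriv₁.ae_eq_zero hU h2.fst.memLp₁ e1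
    have e22 := h2.snd.deriv₂.ae_eq_zero hU h2.snd.memLp₂ e2
    filter_upwards [e1, e11, e22] with x x1 x11 x22
    simp [laplaceBeltrami, x1, x11, x22]
  have hfin := (ae_rectMeasure_iff ha hb hK (c := c)).2
    ⟨key _ (isOpen_Ioo.prod isOpen_Ioo) D.plus hp, key _ (isOpen_Ioo.prod isOpen_Ioo) D.minus hm⟩
  exact Lp.ext (hΦ.trans (EventuallyEq.trans hfin (Lp.coeFn_zero _ _ _).symm))

/-! ### The transversal operators -/

/-- The one-dimensional domain: `H²(0, a) ⊕ H²(-b, 0)`, with the Dirichlet and interface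
conditions. -/
structure LineDomain (a b εp εm : ℝ) (u u' u'' : ℝ → ℂ) : Prop where
  plus : IsH2Line (Ioo 0 a) u u' u''
  minus : IsH2Line (Ioo (-b) 0) u u' u''
  right : HasValueAt (Ioo 0 a) a u 0
  left : HasValueAt (Ioo (-b) 0) (-b) u 0
  continuity : ∃ z : ℂ, HasValueAt (Ioo 0 a) 0 u z ∧ HasValueAt (Ioo (-b) 0) 0 u z
  flux : ∃ z w : ℂ, HasValueAt (Ioo 0 a) 0 u' z ∧ HasValueAt (Ioo (-b) 0) 0 u' w ∧
    (εp : ℂ) * z = -((εm : ℂ) * w)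

/-- The differential expression `-u'' - (f'/f) u' + (nπ/c)² f⁻² u`. -/
def lineExpr (K c : ℝ) (n : ℕ) (u u' u'' : ℝ → ℂ) (x : ℝ) : ℂ :=
  -u'' x - ((deriv (jac K) x / jac K x : ℝ) : ℂ) * u' x
    + (((n * Real.pi / c) ^ 2 / jac K x ^ 2 : ℝ) : ℂ) * u x

/-- The graph of `A_K^n`. -/
def lineGraph (K a b c εp εm : ℝ) (n : ℕ) : Submodule ℂ (L2Line K a b × L2Line K a b) where
  carrier := {q | ∃ u u' u'' : ℝ → ℂ, LineDomain a b εp εm u u' u'' ∧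
    q.1 =ᵐ[lineMeasure K a b] u ∧
    q.2 =ᵐ[lineMeasure K a b] fun x => (coef εp εm x : ℂ) * lineExpr K c n u u' u'' x}
  zero_mem' := by
    have h0 : ∀ U : Set ℝ, IsH2Line U 0 0 0 := fun U =>
      ⟨MemLp.zero, MemLp.zero, MemLp.zero, HasWeakDeriv.zero, HasWeakDeriv.zero⟩
    refine ⟨0, 0, 0, ⟨h0 _, h0 _, hasValueAt_zero, hasValueAt_zero,
      ⟨0, hasValueAt_zero, hasValueAt_zero⟩,
      ⟨0, 0, hasValueAt_zero, hasValueAt_zero, by simp⟩⟩, Lp.coeFn_zero _ _ _, ?_⟩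
    refine (Lp.coeFn_zero _ _ _).trans (Eventually.of_forall fun p => ?_)
    simp [lineExpr]
  add_mem' := by
    rintro ⟨Ψ, Φ⟩ ⟨Ψ', Φ'⟩ ⟨u, u', u'', D, hΨ, hΦ⟩ ⟨v, v', v'', D', hΨ', hΦ'⟩
    obtain ⟨z, z1, z2⟩ := D.continuity
    obtain ⟨y, y1, y2⟩ := D'.continuity
    obtain ⟨r, s, r1, s1, rs⟩ := D.flux
    obtain ⟨r', s', r1', s1', rs'⟩ := D'.flux
    refine ⟨u + v, u' + v', u'' + v'', ⟨D.plus.add D'.plus, D.minus.add D'.minus,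
      by simpa using D.right.add D'.right, by simpa using D.left.add D'.left,
      ⟨z + y, z1.add y1, z2.add y2⟩, ⟨r + r', s + s', r1.add r1', s1.add s1', ?_⟩⟩, ?_, ?_⟩
    · linear_combination rs + rs'
    · exact (Lp.coeFn_add _ _).trans (hΨ.add hΨ')
    · refine (Lp.coeFn_add _ _).trans ?_
      filter_upwards [hΦ, hΦ'] with p e e'
      simp only [Pi.add_apply, lineExpr] at *
      rw [e, e']
      ring
  smul_mem' := by
    rintro t ⟨Ψ, Φ⟩ ⟨u, u', u'', D, hΨ, hΦ⟩
    obtain ⟨z, z1, z2⟩ := D.continuity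
    obtain ⟨r, s, r1, s1, rs⟩ := D.flux
    refine ⟨t • u, t • u', t • u'', ⟨D.plus.smul t, D.minus.smul t,
      by simpa using D.right.smul t, by simpa using D.left.smul t,
      ⟨t • z, z1.smul t, z2.smul t⟩, ⟨t • r, t • s, r1.smul t, s1.smul t, ?_⟩⟩, ?_, ?_⟩
    · simp only [smul_eq_mul]
      linear_combination t * rs
    · exact (Lp.coeFn_smul _ _).trans (hΨ.const_smul t)
    · refine (Lp.coeFn_smul _ _).trans ?_
      filter_upwards [hΦ] with p e
      simp only [Pi.smul_apply, smul_eq_mul, lineExpr] at *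
      rw [e]
      ring

/-- The transversal operator `A_K^n` in `L²(J₁, f dx)`. -/
def lineA (K a b c εp εm : ℝ) (n : ℕ) : L2Line K a b →ₗ.[ℂ] L2Line K a b :=
  (lineGraph K a b c εp εm n).toLinearPMap

/-- The graph of `A_K^n` is `lineGraph`. -/
theorem lineA_graph {K a b c εp εm : ℝ} (n : ℕ) (ha : 0 < a) (hb : 0 < b)
    (hK : 0 < K → √K * a < Real.pi / 2 ∧ √K * b < Real.pi / 2) :
    (lineA K a b c εp εm n).graph = lineGraph K a b c εp εm n := by
  refine Submodule.toLinearPMap_graph_eq _ ?_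
  rintro ⟨Ψ, Φ⟩ ⟨u, u', u'', D, hΨ, hΦ⟩ h0
  have h0 : Ψ = 0 := h0
  subst h0
  have hu : u =ᵐ[lineMeasure K a b] 0 := hΨ.symm.trans (Lp.coeFn_zero _ _ _)
  obtain ⟨hp, hm⟩ := (ae_lineMeasure_iff ha hb hK).1 hu
  have key : ∀ U : Set ℝ, IsOpen U → IsH2Line U u u' u'' →
      (∀ᵐ x ∂(volume.restrict U), u x = (0 : ℝ → ℂ) x) →
      ∀ᵐ x ∂(volume.restrict U), (coef εp εm x : ℂ) * lineExpr K c n u u' u'' x = 0 := by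
    intro U hU h2 h
    have e1 := h2.deriv'.ae_eq_zero hU h2.memLp' h
    have e2 := h2.deriv''.ae_eq_zero hU h2.memLp'' e1
    filter_upwards [h, e1, e2] with x x0 x1 x2
    simp [lineExpr, x0, x1, x2]
  have hfin := (ae_lineMeasure_iff ha hb hK).2
    ⟨key _ isOpen_Ioo D.plus hp, key _ isOpen_Ioo D.minus hm⟩
  exact Lp.ext (hΦ.trans (EventuallyEq.trans hfin (Lp.coeFn_zero _ _ _).symm))

/-! ### The direct sum over the sine modes -/

/-- `φ_n(y) = √(2/c) sin(nπy/c)`. -/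
def sineMode (c : ℝ) (n : ℕ) (y : ℝ) : ℝ := √(2 / c) * Real.sin (n * Real.pi / c * y)

/-- `P` is the operator `P_n` given by `(P_n Ψ)(x, y) = (φ_n, Ψ(x, ·))_{L²(0, c)} φ_n(y)`. -/
def IsModeProjection (K a b c : ℝ) (n : ℕ) (P : L2Rect K a b c →L[ℂ] L2Rect K a b c) : Prop :=
  ∀ Ψ : L2Rect K a b c, P Ψ =ᵐ[rectMeasure K a b c]
    fun p => (∫ y in Ioo 0 c, (sineMode c n y : ℂ) * Ψ (p.1, y)) * (sineMode c n p.2 : ℂ)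

/-- The graph of the operator `I ⊗ A_K^n` on the functions `ψ(x) φ_n(y)`, which maps
`ψ(x) φ_n(y)` with `ψ` in the domain of `A_K^n` to `(A_K^n ψ)(x) φ_n(y)`. -/
def fiberGraph (K a b c εp εm : ℝ) (n : ℕ) : Set (L2Rect K a b c × L2Rect K a b c) :=
  {q | ∃ ψ : (lineA K a b c εp εm n).domain,
    q.1 =ᵐ[rectMeasure K a b c] (fun p => (ψ : L2Line K a b) p.1 * (sineMode c n p.2 : ℂ)) ∧
    q.2 =ᵐ[rectMeasure K a b c]
      (fun p => (lineA K a b c εp εm n ψ) p.1 * (sineMode c n p.2 : ℂ))}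

/-- The graph of `⊕_{n ≥ 1} (I ⊗ A_K^n) P_n`: its domain consists of the `Ψ` for which every
`P_n Ψ` is in the domain of `I ⊗ A_K^n` and the (orthogonal) series `∑ (I ⊗ A_K^n) P_n Ψ`
converges in `L²(Ω₀, g)`, and its value at `Ψ` is the sum of that series. -/
def directSumGraph (K a b c εp εm : ℝ) (P : ℕ+ → L2Rect K a b c →L[ℂ] L2Rect K a b c) :
    Set (L2Rect K a b c × L2Rect K a b c) :=
  {q | ∃ s : ℕ+ → L2Rect K a b c,
    (∀ n : ℕ+, (P n q.1, s n) ∈ fiberGraph K a b c εp εm n) ∧ HasSum s q.2}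

end IndefLap

end

open IndefLap

noncomputable section

namespace IndefLap

/-! ### Operators that are diagonal in a Hilbert basis -/

section Diagonal

variable {H : Type*} [NormedAddCommGroup H] [InnerProductSpace ℂ H] {ι : Type*}

/-! The proof is separation of variables, with one abstract principle replacing all semibounded form
methods, which are not at hand because `ε` changes sign. Suppose a Hilbert basis of eigenpairs with
real eigenvalues lies in the graph of an operator, and the operator is contained in the maximal
diagonal operator `diagGraph` of that basis. Then its closure is this diagonal operator, which is
self-adjoint, and density of the domain, symmetry, uniqueness of the self-adjoint extension, point
spectrum and spectrum can all be read off from the eigenvalues.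

The basis comes from the transversal operators. The flux condition says exactly that `ε u'`, with
the signed coefficient `ε`, is continuous across the interface, so integration by parts on all of
`(-b, a)` has no interface term and each `lineA` is symmetric. Integrating the equation twice gives
a compact injective `T` with `A T = 1 + S`, `S` compact (`exists_parametrix`). The obvious solution
formula would break down for those contrasts with `∫ 1/(ε f) = 0`; a weight `1 + s (x + b)` repairs
it at the cost of a rank one error, and a suitable `s` exists because `x / ε` is positive away from
the interface. A symmetric operator in a separable space has only countably many eigenvalues, so
some real `μ` is not one of them, and the Fredholm alternative turns the parametrix into a compact
resolvent at `μ`. The spectral theorem for compact symmetric operators then diagonalizes `lineA`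
(`exists_diagonalization_of_parametrix`).

On the rectangle, the products of these eigenfunctions with the sine modes form a Hilbert basis, by
completeness of the sines (`ae_eq_zero_of_integral_sineMode_eq_zero`), and they lie in the domain of
`dotA` (`modeOp_mem_dotGraph`). That `dotA` is contained in the diagonal operator needs Green's
formula only between an arbitrary element of the domain and a separated function
(`inner_modeOp_dot`). No regularity theory on the rectangle enters, and symmetry of `dotA` is a
consequence rather than an ingredient. -/

/-- The graph of the maximal operator acting on the Hilbert basis `e` by `e i ↦ l i • e i`. -/
def diagGraph (e : HilbertBasis ι ℂ H) (l : ι → ℝ) : Submodule ℂ (H × H) where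
  carrier := {q | ∀ i, inner ℂ (e i) q.2 = l i * inner ℂ (e i) q.1}
  zero_mem' := by simp
  add_mem' := by
    intro p q hp hq i
    simp only [Prod.fst_add, Prod.snd_add, inner_add_right, hp i, hq i, mul_add]
  smul_mem' := by
    intro z p hp i
    simp only [Prod.smul_fst, Prod.smul_snd, inner_smul_right, hp i]
    ring

theorem mem_diagGraph {e : HilbertBasis ι ℂ H} {l : ι → ℝ} {q : H × H} :
    q ∈ diagGraph e l ↔ ∀ i, inner ℂ (e i) q.2 = l i * inner ℂ (e i) q.1 := Iff.rfl

theorem HilbertBasis.ext_inner (e : HilbertBasis ι ℂ H) {x y : H}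
    (h : ∀ i, inner ℂ (e i) x = inner ℂ (e i) y) : x = y := by
  refine e.repr.injective (lp.ext (funext fun i => ?_))
  rw [e.repr_apply_apply, e.repr_apply_apply, h i]

theorem HilbertBasis.inner_self (e : HilbertBasis ι ℂ H) (i : ι) :
    inner ℂ (e i) (e i) = 1 := by
  rw [inner_self_eq_norm_sq_to_K, e.orthonormal.1 i]; simp

theorem HilbertBasis.ne_zero (e : HilbertBasis ι ℂ H) (i : ι) : e i ≠ 0 := by
  intro h
  have := HilbertBasis.inner_self e i
  simp [h] at this

theorem HilbertBasis.hasSum_sq_norm_inner (e : HilbertBasis ι ℂ H) (x : H) :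
    HasSum (fun i => ‖inner ℂ (e i) x‖ ^ 2) (‖x‖ ^ 2) := by
  have := lp.hasSum_norm (p := 2) (by norm_num) (e.repr x)
  simpa [e.repr_apply_apply] using this

theorem self_mem_diagGraph (e : HilbertBasis ι ℂ H) (l : ι → ℝ) (i : ι) :
    (e i, (l i : ℂ) • e i) ∈ diagGraph e l := by
  classical
  intro j
  simp only [inner_smul_right, orthonormal_iff_ite.1 e.orthonormal j i]
  split_ifs with h
  · rw [h]
  · simp

theorem isClosed_diagGraph (e : HilbertBasis ι ℂ H) (l : ι → ℝ) :
    IsClosed (diagGraph e l : Set (H × H)) := by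
  have : (diagGraph e l : Set (H × H)) =
      ⋂ i, {q | inner ℂ (e i) q.2 = l i * inner ℂ (e i) q.1} := by
    ext q; simp [mem_diagGraph]
  rw [this]
  exact isClosed_iInter fun i => isClosed_eq (by fun_prop) (by fun_prop)

/-- An operator defined at least on the basis vectors, and acting diagonally, has the maximal
diagonal operator as its closure. -/
theorem topologicalClosure_graph_eq_diagGraph {e : HilbertBasis ι ℂ H} {l : ι → ℝ}
    {G : Submodule ℂ (H × H)} (h1 : ∀ i, (e i, (l i : ℂ) • e i) ∈ G) (h2 : G ≤ diagGraph e l) :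
    G.topologicalClosure = diagGraph e l := by
  refine le_antisymm (G.topologicalClosure_minimal h2 (isClosed_diagGraph e l)) ?_
  rintro ⟨x, y⟩ hq
  have hx := e.hasSum_repr x
  have hy := e.hasSum_repr y
  -- Both components are expanded at once. The diagonal relation makes every term of the paired
  -- series a multiple of an eigenpair, so its partial sums lie in `G`.
  have hs := hx.prodMk hy
  refine mem_closure_of_tendsto hs (Eventually.of_forall fun s => ?_)
  refine G.sum_mem fun i _ => ?_
  have : (e.repr x i • e i, e.repr y i • e i) = e.repr x i • (e i, (l i : ℂ) • e i) := by
    rw [e.repr_apply_apply, e.repr_apply_apply, hq i, Prod.smul_mk, smul_smul, mul_comm]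
  rw [this]
  exact G.smul_mem _ (h1 i)

/-- By Parseval both sides are sums over the basis, and these agree term by term because the
multipliers `l i` are real. -/
theorem inner_eq_of_mem_diagGraph {e : HilbertBasis ι ℂ H} {l : ι → ℝ} {p q : H × H}
    (hp : p ∈ diagGraph e l) (hq : q ∈ diagGraph e l) :
    inner ℂ p.2 q.1 = inner ℂ p.1 q.2 := by
  rw [← e.tsum_inner_mul_inner, ← e.tsum_inner_mul_inner]
  congr 1
  funext i
  rw [hq i, ← inner_conj_symm, hp i, ← inner_conj_symm p.1]
  simp
  ring

/-! ### Operators between the eigenpairs and the maximal diagonal operator -/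

variable {D : H →ₗ.[ℂ] H} {e : HilbertBasis ι ℂ H} {l : ι → ℝ}

theorem dense_domain_of_basis_mem (h1 : ∀ i, (e i, (l i : ℂ) • e i) ∈ D.graph) :
    Dense (D.domain : Set H) := by
  have h := e.dense_span
  rw [← Submodule.dense_iff_topologicalClosure_eq_top] at h
  refine h.mono ?_
  rw [SetLike.coe_subset_coe, Submodule.span_le]
  rintro _ ⟨i, rfl⟩
  exact LinearPMap.mem_domain_of_mem_graph (h1 i)

theorem isClosable_of_le_diagGraph (h2 : D.graph ≤ diagGraph e l) : D.IsClosable := by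
  refine ⟨D.graph.topologicalClosure.toLinearPMap, ?_⟩
  rw [Submodule.toLinearPMap_graph_eq]
  rintro ⟨x, y⟩ hq h0
  have hq : (x, y) ∈ diagGraph e l :=
    D.graph.topologicalClosure_minimal h2 (isClosed_diagGraph e l) hq
  have h0 : x = 0 := h0
  subst h0
  refine HilbertBasis.ext_inner e fun i => ?_
  simpa using hq i

theorem closure_graph_eq_diagGraph (h1 : ∀ i, (e i, (l i : ℂ) • e i) ∈ D.graph)
    (h2 : D.graph ≤ diagGraph e l) : D.closure.graph = diagGraph e l := by
  rw [← (isClosable_of_le_diagGraph h2).graph_closure_eq_closure_graph,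
    topologicalClosure_graph_eq_diagGraph h1 h2]

theorem isFormalAdjoint_of_le_diagGraph (h2 : D.graph ≤ diagGraph e l) : D.IsFormalAdjoint D :=
  fun x y => inner_eq_of_mem_diagGraph (h2 (D.mem_graph x)) (h2 (D.mem_graph y))

/-- Testing the adjoint relation on the eigenpairs alone already forces the diagonal relation, so
the adjoint is no larger than the operator; symmetry gives the other inclusion. -/
theorem isSelfAdjoint_of_graph_eq_diagGraph [CompleteSpace H] (h : D.graph = diagGraph e l) :
    IsSelfAdjoint D := by
  have h1 : ∀ i, (e i, (l i : ℂ) • e i) ∈ D.graph := fun i => h ▸ self_mem_diagGraph e l i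
  rw [LinearPMap.isSelfAdjoint_def]
  refine LinearPMap.eq_of_eq_graph ?_
  rw [LinearPMap.adjoint_graph_eq_graph_adjoint (dense_domain_of_basis_mem h1), h]
  ext q
  rw [Submodule.mem_adjoint_iff]
  refine ⟨fun hq i => ?_, fun hq a b hab => ?_⟩
  · have := hq _ _ (self_mem_diagGraph e l i)
    rw [inner_smul_left, Complex.conj_ofReal, sub_eq_zero] at this
    exact this.symm
  · rw [sub_eq_zero]
    exact inner_eq_of_mem_diagGraph hab hq

theorem isEssentiallySelfAdjoint_of_diagonal [CompleteSpace H]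
    (h1 : ∀ i, (e i, (l i : ℂ) • e i) ∈ D.graph) (h2 : D.graph ≤ diagGraph e l) :
    IsEssentiallySelfAdjoint D :=
  ⟨dense_domain_of_basis_mem h1, isFormalAdjoint_of_le_diagGraph h2,
    isClosable_of_le_diagGraph h2,
    isSelfAdjoint_of_graph_eq_diagGraph (closure_graph_eq_diagGraph h1 h2)⟩

/-- The extension `B` contains the eigenpairs and equals its adjoint, so testing against them places
it inside the diagonal operator. Being closed, it also contains the closure. -/
theorem eq_closure_of_isSelfAdjoint_of_le [CompleteSpace H]
    (h1 : ∀ i, (e i, (l i : ℂ) • e i) ∈ D.graph) (h2 : D.graph ≤ diagGraph e l)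
    {B : H →ₗ.[ℂ] H} (hB : IsSelfAdjoint B) (hDB : D ≤ B) : B = D.closure := by
  have hB' := hB.dense_domain
  refine LinearPMap.eq_of_eq_graph (le_antisymm ?_ ?_)
  · rw [closure_graph_eq_diagGraph h1 h2]
    intro q hq i
    rw [← LinearPMap.isSelfAdjoint_def.1 hB, LinearPMap.adjoint_graph_eq_graph_adjoint hB',
      Submodule.mem_adjoint_iff] at hq
    have := hq _ _ (LinearPMap.le_graph_of_le hDB (h1 i))
    rw [inner_smul_left, Complex.conj_ofReal, sub_eq_zero] at this
    exact this.symm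
  · rw [← (isClosable_of_le_diagGraph h2).graph_closure_eq_closure_graph]
    exact D.graph.topologicalClosure_minimal (LinearPMap.le_graph_of_le hDB) hB.isClosed

/-- An eigenvector has some non-zero coefficient, and at that index the diagonal relation identifies
the eigenvalue. No closedness is needed, so this applies to `dotA` itself. -/
theorem pointSpectrum_eq_range_of_diagonal
    (h1 : ∀ i, (e i, (l i : ℂ) • e i) ∈ D.graph) (h2 : D.graph ≤ diagGraph e l) :
    pointSpectrum D = range fun i => (l i : ℂ) := by
  ext z
  constructor
  · rintro ⟨x, hx0, hx⟩
    by_contra hz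
    refine hx0 (HilbertBasis.ext_inner e fun i => ?_)
    have := h2 (D.mem_graph x) i
    simp only [hx, inner_smul_right] at this
    have h3 : (z - l i) * inner ℂ (e i) (x : H) = 0 := by linear_combination this
    rcases mul_eq_zero.1 h3 with h4 | h4
    · exact absurd ⟨i, (sub_eq_zero.1 h4).symm⟩ hz
    · simpa using h4
  · rintro ⟨i, rfl⟩
    obtain ⟨x, hx, hy⟩ := (LinearPMap.mem_graph_iff D).1 (h1 i)
    refine ⟨x, ?_, ?_⟩
    · rw [hx]; exact HilbertBasis.ne_zero e i
    · rw [hy, hx]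

/-- The resolvent of a diagonal operator. -/
theorem exists_isResolventAt_of_diagonal (h : D.graph = diagGraph e l) {z : ℂ} {δ : ℝ}
    (hδ : 0 < δ) (hz : ∀ i, δ ≤ ‖(l i : ℂ) - z‖) : ∃ R : H →L[ℂ] H, IsResolventAt D z R := by
  have hne : ∀ i, (l i : ℂ) - z ≠ 0 := fun i h0 => by
    have := hz i; rw [h0, norm_zero] at this; linarith
  have hb : ∀ i, ‖((l i : ℂ) - z)⁻¹‖ ≤ δ⁻¹ := fun i => by
    rw [norm_inv]; exact inv_anti₀ hδ (hz i)
  have hmem : ∀ y : H, Memℓp (fun i => ((l i : ℂ) - z)⁻¹ * e.repr y i) 2 := fun y => by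
    refine memℓp_gen ?_
    refine Summable.of_nonneg_of_le (fun i => by positivity) (fun i => ?_)
      ((HilbertBasis.hasSum_sq_norm_inner e y).summable.mul_left (δ⁻¹ ^ 2))
    rw [e.repr_apply_apply, norm_mul, ENNReal.toReal_ofNat, Real.rpow_two, mul_pow]
    gcongr
    exact hb i
  let R₀ : H →ₗ[ℂ] H :=
    { toFun := fun y => e.repr.symm ⟨_, hmem y⟩
      map_add' := fun x y => by
        rw [← map_add]; congr 1; ext i; simp [mul_add]; rfl
      map_smul' := fun c y => by
        rw [← map_smul]; congr 1; ext i; simp; ring }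
  have hR : ∀ y i, inner ℂ (e i) (R₀ y) = ((l i : ℂ) - z)⁻¹ * inner ℂ (e i) y := fun y i => by
    rw [← e.repr_apply_apply, ← e.repr_apply_apply]
    simp [R₀]
  have hbound : ∀ y, ‖R₀ y‖ ≤ δ⁻¹ * ‖y‖ := fun y => by
    have e1 := HilbertBasis.hasSum_sq_norm_inner e (R₀ y)
    have e2 := (HilbertBasis.hasSum_sq_norm_inner e y).mul_left (δ⁻¹ ^ 2)
    have e3 := hasSum_le (fun i => ?_) e1 e2
    · rw [← mul_pow] at e3
      exact (sq_le_sq₀ (norm_nonneg _) (by positivity)).1 e3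
    · rw [hR, norm_mul, mul_pow]
      gcongr
      exact hb i
  refine ⟨R₀.mkContinuous δ⁻¹ hbound, fun y => ?_, fun x => ?_⟩
  · have : (R₀ y, y + z • R₀ y) ∈ D.graph := by
      rw [h]
      intro i
      simp only [inner_add_right, inner_smul_right, hR]
      field_simp [hne i]
      ring
    obtain ⟨x, hx, hy⟩ := (LinearPMap.mem_graph_iff D).1 this
    have hx : (x : H) = R₀ y := hx
    refine ⟨?_, ?_⟩
    · show R₀ y ∈ _
      rw [← hx]; exact x.2
    · have e2 : (⟨R₀ y, hx ▸ x.2⟩ : D.domain) = x := Subtype.ext hx.symm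
      show D ⟨R₀ y, _⟩ - z • R₀ y = y
      rw [e2, hy]; simp
  · refine HilbertBasis.ext_inner e fun i => ?_
    show inner ℂ (e i) (R₀ _) = _
    have h3 := (h ▸ D.mem_graph x : ((x : H), D x) ∈ diagGraph e l) i
    simp only at h3
    rw [hR, inner_sub_right, inner_smul_right, h3]
    field_simp [hne i]

/-- On a basis vector a resolvent acts as division by `l i - z`, so its boundedness keeps the `l i`
away from `z`; conversely a positive distance makes these quotients bounded. -/
theorem opSpectrum_eq_closure_range_of_diagonal (h : D.graph = diagGraph e l) :
    opSpectrum D = closure (range fun i => (l i : ℂ)) := by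
  ext z
  rw [← not_iff_not]
  constructor
  · intro hz hzc
    obtain ⟨R, hR⟩ := not_not.1 hz
    -- The `+ 1` gives a strict contradiction with `|l i - z| ‖R (e i)‖ = 1` and a positive radius
    -- without first showing `R ≠ 0`.
    have hR0 : 0 < ‖R‖ + 1 := by positivity
    obtain ⟨_, ⟨i, rfl⟩, hi⟩ := Metric.mem_closure_iff.1 hzc _ (inv_pos.2 hR0)
    obtain ⟨x, hx, hy⟩ := (LinearPMap.mem_graph_iff D).1 (h ▸ self_mem_diagGraph e l i)
    have h3 := hR.left_inv x
    simp only [hx, hy, ← sub_smul, map_smul] at h3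
    have h4 : ‖e i‖ = 1 := e.orthonormal.1 i
    have h5 : ‖(l i : ℂ) - z‖ * ‖R (e i)‖ = 1 := by rw [← norm_smul, h3, h4]
    have h6 : ‖R (e i)‖ ≤ ‖R‖ := by simpa [h4] using R.le_opNorm (e i)
    rw [dist_comm, dist_eq_norm] at hi
    have h7 : ‖(l i : ℂ) - z‖ * (‖R‖ + 1) < 1 := by
      rwa [← lt_inv_mul_iff₀' hR0, mul_one] 
    nlinarith [norm_nonneg ((l i : ℂ) - z)]
  · intro hz
    rw [Metric.mem_closure_iff] at hz
    push Not at hz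
    obtain ⟨δ, hδ, hz⟩ := hz
    refine not_not.2 (exists_isResolventAt_of_diagonal h hδ fun i => ?_)
    have := hz _ ⟨i, rfl⟩
    rwa [dist_comm, dist_eq_norm] at this

end Diagonal

/-! ### Symmetric operators with a compact parametrix -/

section Parametrix

universe u

variable {H : Type u} [NormedAddCommGroup H] [InnerProductSpace ℂ H]

/-- Orthonormal vectors have mutual distance `√2 > 1`, so the balls of radius `1 / 2` around them
are disjoint non-empty open sets. -/
theorem Orthonormal.countable_of_separable [TopologicalSpace.SeparableSpace H] {ι : Type*}
    {v : ι → H} (hv : Orthonormal ℂ v) : Countable ι := by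
  have hd : Pairwise fun i j =>
      Disjoint (Metric.ball (v i) (1 / 2)) (Metric.ball (v j) (1 / 2)) := by
    intro i j hij
    refine Metric.ball_disjoint_ball ?_
    have h2 : ‖v i - v j‖ ^ 2 = 2 := by
      rw [norm_sub_sq (𝕜 := ℂ), hv.1 i, hv.1 j, hv.2 hij]; norm_num
    rw [dist_eq_norm]
    nlinarith [norm_nonneg (v i - v j)]
  have := hd.countable_of_isOpen_disjoint (fun i => Metric.isOpen_ball)
    (fun i => ⟨v i, Metric.mem_ball_self (by norm_num)⟩)
  exact this

variable {A : H →ₗ.[ℂ] H}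

theorem conj_eq_of_mem_pointSpectrum (hA : A.IsFormalAdjoint A) {z : ℂ} {x : A.domain}
    (hx : (x : H) ≠ 0) (h : A x = z • (x : H)) : (starRingEnd ℂ) z = z := by
  have := hA x x
  rw [h, inner_smul_left, inner_smul_right] at this
  exact mul_right_cancel₀ (inner_self_ne_zero.2 hx) this

/-- Eigenvectors of a symmetric operator for different eigenvalues are orthogonal, so choosing a
normalized one for each eigenvalue gives an orthonormal family indexed by the point spectrum. -/
theorem countable_pointSpectrum [TopologicalSpace.SeparableSpace H] (hA : A.IsFormalAdjoint A) :
    (pointSpectrum A).Countable := by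
  choose x hx0 hx using fun z : pointSpectrum A => z.2
  have hn : ∀ z, ‖(x z : H)‖ ≠ 0 := fun z => norm_ne_zero_iff.2 (hx0 z)
  have ho : Orthonormal ℂ fun z : pointSpectrum A => ((‖(x z : H)‖ : ℂ)⁻¹) • (x z : H) := by
    refine ⟨fun z => ?_, fun z w hzw => ?_⟩
    · rw [norm_smul]; simp [hn z]
    · have h1 := hA (x z) (x w)
      rw [hx z, hx w, inner_smul_left, inner_smul_right,
        conj_eq_of_mem_pointSpectrum hA (hx0 z) (hx z)] at h1
      have h2 : ((z : ℂ) - w) * inner ℂ (x z : H) (x w : H) = 0 := by linear_combination h1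
      rcases mul_eq_zero.1 h2 with h3 | h3
      · exact absurd (Subtype.ext (sub_eq_zero.1 h3)) hzw
      · simp [inner_smul_left, inner_smul_right, h3]
  exact Set.countable_coe_iff.1 (Orthonormal.countable_of_separable ho)

/-- This supplies a real spectral parameter at which `A - μ` is injective; no lower bound on `A` is
available to provide one. -/
theorem exists_real_notMem_pointSpectrum [TopologicalSpace.SeparableSpace H]
    (hA : A.IsFormalAdjoint A) : ∃ μ : ℝ, (μ : ℂ) ∉ pointSpectrum A := by
  by_contra! h
  have h1 : (Set.univ : Set ℝ).Countable := by
    refine ((countable_pointSpectrum hA).preimage Complex.ofReal_injective).mono fun x _ => h x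
  exact Cardinal.not_countable_real h1

/-- A symmetric operator with an injective compact right parametrix has a compact resolvent at
some real point. -/
theorem exists_compact_resolvent_of_parametrix [CompleteSpace H]
    [TopologicalSpace.SeparableSpace H] (hA : A.IsFormalAdjoint A) {T S : H →L[ℂ] H}
    (hT : IsCompactOperator T) (hS : IsCompactOperator S) (hTi : Function.Injective T)
    (h : ∀ g, (T g, g + S g) ∈ A.graph) :
    ∃ (μ : ℝ) (R : H →L[ℂ] H), IsCompactOperator R ∧ IsResolventAt A μ R := by
  obtain ⟨μ, hμ⟩ := exists_real_notMem_pointSpectrum hA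
  have hker : ∀ x y, (x, y) ∈ A.graph → y = (μ : ℂ) • x → x = 0 := by
    intro x y hxy hy
    by_contra hx
    obtain ⟨x', rfl, rfl⟩ := (LinearPMap.mem_graph_iff A).1 hxy
    exact hμ ⟨x', hx, hy⟩
  -- With this `Q` one has `(A - μ) T = 1 - Q`, so the Fredholm alternative for `Q` at `1` decides
  -- whether `A - μ` is onto.
  let Q : H →L[ℂ] H := (μ : ℂ) • T - S
  have hQ : IsCompactOperator Q := (hT.smul (μ : ℂ)).sub hS
  have hres : (1 : ℂ) ∈ resolventSet ℂ Q := by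
    refine (hQ.hasEigenvalue_or_mem_resolventSet one_ne_zero).resolve_left fun h1 => ?_
    obtain ⟨g, hg⟩ := h1.exists_hasEigenvector
    have hg1 : Q g = g := by simpa using hg.apply_eq_smul
    have hg2 : g + S g = (μ : ℂ) • T g := by
      have : (μ : ℂ) • T g - S g = g := hg1
      linear_combination (norm := module) -this
    have := hker _ _ (h g) hg2
    -- A fixed vector `g` of `Q` satisfies `(A - μ) T g = 0`, hence `T g = 0`; injectivity of `T`
    -- excludes this.
    exact hg.2 (hTi (by rw [this, map_zero]))
  rw [spectrum.mem_resolventSet_iff] at hres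
  obtain ⟨u, hu⟩ := hres
  have hu1 : ∀ y, (u⁻¹ : (H →L[ℂ] H)ˣ).1 y + S ((u⁻¹ : (H →L[ℂ] H)ˣ).1 y)
      - (μ : ℂ) • T ((u⁻¹ : (H →L[ℂ] H)ˣ).1 y) = y := fun y => by
    have e1 : u.1 ((u⁻¹ : (H →L[ℂ] H)ˣ).1 y) = y := by
      rw [← mul_apply_eq_comp, Units.mul_inv]; rfl
    rw [hu] at e1
    conv_rhs => rw [← e1]
    simp [Q]
    abel
  refine ⟨μ, T ∘L (u⁻¹ : (H →L[ℂ] H)ˣ).1, hT.comp_clm _, ?_⟩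
  have hright : ∀ y : H, ∃ h : (T ∘L (u⁻¹ : (H →L[ℂ] H)ˣ).1) y ∈ A.domain,
      A ⟨(T ∘L (u⁻¹ : (H →L[ℂ] H)ˣ).1) y, h⟩
        - (μ : ℂ) • (T ∘L (u⁻¹ : (H →L[ℂ] H)ˣ).1) y = y := fun y => by
    obtain ⟨x, hx, hy⟩ := (LinearPMap.mem_graph_iff A).1 (h ((u⁻¹ : (H →L[ℂ] H)ˣ).1 y))
    have hx : (x : H) = (T ∘L (u⁻¹ : (H →L[ℂ] H)ˣ).1) y := hx
    refine ⟨hx ▸ x.2, ?_⟩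
    have e2 : (⟨_, hx ▸ x.2⟩ : A.domain) = x := Subtype.ext hx.symm
    rw [e2, hy]
    exact hu1 y
  refine ⟨hright, fun x => ?_⟩
  -- A right inverse of the injective operator `A - μ` is also a left inverse.
  obtain ⟨hm, he⟩ := hright (A x - (μ : ℂ) • (x : H))
  refine sub_eq_zero.1 (hker _ _ (A.mem_graph (⟨_, hm⟩ - x)) ?_)
  rw [A.map_sub, smul_sub]
  linear_combination (norm := module) he

/-- The first resolvent identity `R' = R + (w - z) R R'` exhibits `R'` as a sum of compact
operators. -/
theorem isCompactOperator_of_isResolventAt {z w : ℂ} {R R' : H →L[ℂ] H}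
    (hR : IsResolventAt A z R) (hR' : IsResolventAt A w R') (hc : IsCompactOperator R) :
    IsCompactOperator R' := by
  have : R' = R + (w - z) • (R ∘L R') := by
    ext y
    obtain ⟨hm, he⟩ := hR'.right_inv y
    have h1 := hR.left_inv ⟨R' y, hm⟩
    have h2 : A ⟨R' y, hm⟩ = y + w • R' y := by
      linear_combination (norm := module) he
    rw [h2] at h1
    simp only [map_sub, map_add, map_smul] at h1
    simp only [add_apply, smul_apply, ContinuousLinearMap.comp_apply]
    linear_combination (norm := module) -h1
  rw [this]
  exact hc.add ((hc.comp_clm R').smul (w - z))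

/-- A compact symmetric operator has a Hilbert basis of eigenvectors. -/
theorem exists_hilbertBasis_eigenvectors [CompleteSpace H] {R : H →L[ℂ] H}
    (hR : IsCompactOperator R) (hs : (R : H →ₗ[ℂ] H).IsSymmetric) :
    ∃ (ι : Type u) (e : HilbertBasis ι ℂ H) (ν : ι → ℂ), ∀ i, R (e i) = ν i • e i := by
  have hcl : ∀ μ : ℂ, CompleteSpace (Module.End.eigenspace (R : H →ₗ[ℂ] H) μ) := fun μ => by
    refine IsClosed.completeSpace_coe (hs := ?_)
    have : (Module.End.eigenspace (R : H →ₗ[ℂ] H) μ : Set H) = {x | R x = μ • x} := by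
      ext x; simp
    rw [this]
    exact isClosed_eq R.continuous (continuous_const_smul μ)
  choose w b hb using fun μ : ℂ =>
    exists_hilbertBasis ℂ (Module.End.eigenspace (R : H →ₗ[ℂ] H) μ)
  -- The bases of all eigenspaces are collected over every complex `μ`; those that are not
  -- eigenvalues contribute an empty index set.
  let v : (Σ μ : ℂ, w μ) → H := fun i =>
    ((b i.1 i.2 : Module.End.eigenspace (R : H →ₗ[ℂ] H) i.1) : H)
  have hv : Orthonormal ℂ v :=
    hs.orthogonalFamily_eigenspaces.orthonormal_sigma_orthonormal fun μ => (b μ).orthonormal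
  -- A vector orthogonal to the collected bases is orthogonal to every eigenspace, by expansion in
  -- its basis, and the spectral theorem leaves only zero.
  have hv' : (Submodule.span ℂ (range v))ᗮ = ⊥ := by
    rw [eq_bot_iff, ← ContinuousLinearMap.orthogonalComplement_iSup_eigenspaces_eq_bot hR hs]
    intro x hx
    rw [← Submodule.iInf_orthogonal, Submodule.mem_iInf]
    intro μ
    rw [Submodule.mem_orthogonal]
    intro y hy
    have h1 := (b μ).hasSum_repr ⟨y, hy⟩
    have h2 := (((innerSL ℂ x).comp
      (Module.End.eigenspace (R : H →ₗ[ℂ] H) μ).subtypeL).hasSum h1)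
    have h3 : inner ℂ x y = 0 := by
      refine (h2.unique ?_)
      convert hasSum_zero with i
      simp only [ContinuousLinearMap.comp_apply, map_smul]
      have := Submodule.inner_left_of_mem_orthogonal
        (Submodule.subset_span (R := ℂ) (mem_range_self (f := v) ⟨μ, i⟩)) hx
      rw [smul_eq_zero]; right
      exact this
    exact inner_eq_zero_symm.1 h3
  refine ⟨_, HilbertBasis.mkOfOrthogonalEqBot hv hv', fun i => i.1, fun i => ?_⟩
  rw [HilbertBasis.coe_mkOfOrthogonalEqBot]
  exact Module.End.mem_eigenspace_iff.1 (b i.1 i.2).2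

/-- The compact resolvent `R` at a real point `μ` is symmetric because `A` is. An eigenvector of `R`
with eigenvalue `ν` is one of `A` with eigenvalue `μ + 1 / ν`. Here `ν ≠ 0` since `R` is injective,
and symmetry of `A` makes `μ + 1 / ν` real. -/
theorem exists_diagonalization_of_parametrix [CompleteSpace H]
    [TopologicalSpace.SeparableSpace H] (hA : A.IsFormalAdjoint A) {T S : H →L[ℂ] H}
    (hT : IsCompactOperator T) (hS : IsCompactOperator S) (hTi : Function.Injective T)
    (h : ∀ g, (T g, g + S g) ∈ A.graph) :
    HasCompactResolvent A ∧ ∃ (ι : Type u) (e : HilbertBasis ι ℂ H) (l : ι → ℝ),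
      A.graph = diagGraph e l := by
  obtain ⟨μ, R, hRc, hR⟩ := exists_compact_resolvent_of_parametrix hA hT hS hTi h
  refine ⟨⟨⟨μ, R, hR⟩, fun z R' hR' => isCompactOperator_of_isResolventAt hR hR' hRc⟩, ?_⟩
  have hRg : ∀ y, (R y, y + (μ : ℂ) • R y) ∈ A.graph := fun y => by
    obtain ⟨hm, he⟩ := hR.right_inv y
    rw [LinearPMap.mem_graph_iff]
    exact ⟨⟨_, hm⟩, rfl, by linear_combination (norm := module) he⟩
  have hsymm : ∀ p q, p ∈ A.graph → q ∈ A.graph → inner ℂ p.2 q.1 = inner ℂ p.1 q.2 := by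
    intro p q hp hq
    obtain ⟨x, hx, hx'⟩ := (LinearPMap.mem_graph_iff A).1 hp
    obtain ⟨y, hy, hy'⟩ := (LinearPMap.mem_graph_iff A).1 hq
    rw [← hx, ← hx', ← hy, ← hy']
    exact hA x y
  have hs : (R : H →ₗ[ℂ] H).IsSymmetric := fun x y => by
    have := hsymm _ _ (hRg x) (hRg y)
    simp only [inner_add_left, inner_add_right, inner_smul_left, inner_smul_right,
      Complex.conj_ofReal] at this
    exact (add_right_cancel this).symm
  obtain ⟨ι, e, ν, hν⟩ := exists_hilbertBasis_eigenvectors hRc hs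
  have hν0 : ∀ i, ν i ≠ 0 := fun i h0 => by
    have h1 := hν i
    rw [h0, zero_smul] at h1
    have h2 := hRg (e i)
    rw [h1, smul_zero, add_zero] at h2
    exact HilbertBasis.ne_zero e i (A.graph_fst_eq_zero_snd h2 rfl)
  have hmem : ∀ i, (e i, ((μ : ℂ) + (ν i)⁻¹) • e i) ∈ A.graph := fun i => by
    have := A.graph.smul_mem (ν i)⁻¹ (hRg (e i))
    rw [hν, Prod.smul_mk, smul_smul, inv_mul_cancel₀ (hν0 i), one_smul] at this
    convert this using 2
    rw [smul_add, smul_smul, smul_smul, add_smul, add_comm]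
    congr 2
    field_simp [hν0 i]
  have hreal : ∀ i, ((((μ : ℂ) + (ν i)⁻¹).re : ℝ) : ℂ) = (μ : ℂ) + (ν i)⁻¹ := fun i => by
    obtain ⟨x, hx, hx'⟩ := (LinearPMap.mem_graph_iff A).1 (hmem i)
    refine Complex.conj_eq_iff_re.1 (conj_eq_of_mem_pointSpectrum hA (x := x) ?_ ?_)
    · rw [hx]; exact HilbertBasis.ne_zero e i
    · rw [hx', hx]
  refine ⟨ι, e, fun i => ((μ : ℂ) + (ν i)⁻¹).re, le_antisymm ?_ ?_⟩
  · intro q hq i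
    have := hsymm _ _ (hmem i) hq
    rw [hreal]
    rw [← hreal, inner_smul_left, Complex.conj_ofReal, hreal] at this
    exact this.symm
  · intro q hq
    -- For the maximal diagonal operator not to exceed `A`, its elements must lie in the range of
    -- `R`. Comparing coefficients shows that `R` maps `q.2 - μ q.1` to `q.1`.
    have h1 := hRg (q.2 - (μ : ℂ) • q.1)
    have h2 : R (q.2 - (μ : ℂ) • q.1) = q.1 := by
      refine HilbertBasis.ext_inner e fun i => ?_
      have h3 := hs (e i) (q.2 - (μ : ℂ) • q.1)
      have h4 := hq i
      rw [hreal] at h4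
      have h5 : (starRingEnd ℂ) (ν i) = ν i := by
        have := congrArg (starRingEnd ℂ) (hreal i)
        rw [Complex.conj_ofReal, hreal] at this
        simp only [map_add, Complex.conj_ofReal, map_inv₀, add_right_inj] at this
        exact (inv_injective this).symm
      simp only [ContinuousLinearMap.coe_coe] at h3
      rw [← h3, hν, inner_smul_left, h5, inner_sub_right, inner_smul_right, h4]
      field_simp [hν0 i]
      ring
    rw [h2] at h1
    simpa using h1

end Parametrix

/-! ### Primitives of integrable functions on an interval -/

/-- `u` is absolutely continuous on `[α, β]` with derivative `v`. -/
structure IsPrimitive (α β : ℝ) (u v : ℝ → ℂ) : Prop where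
  intervalIntegrable : IntervalIntegrable v volume α β
  eq_add_integral : ∀ x ∈ Icc α β, u x = u α + ∫ t in α..x, v t

section Primitive

variable {α β : ℝ} {u v g h : ℝ → ℂ}

theorem intervalIntegrable_of_memLp {p : ℝ≥0∞} (hp : 1 ≤ p) (hab : α ≤ β)
    (hv : MemLp v p (volume.restrict (Ioo α β))) : IntervalIntegrable v volume α β := by
  rw [intervalIntegrable_iff_integrableOn_Ioo_of_le hab]
  exact hv.integrable hp

theorem setIntegral_Ioo_eq_intervalIntegral {F : Type*} [NormedAddCommGroup F] [NormedSpace ℝ F]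
    (hab : α ≤ β) (w : ℝ → F) : ∫ t in Ioo α β, w t = ∫ t in α..β, w t := by
  rw [intervalIntegral.integral_of_le hab, integral_Ioc_eq_integral_Ioo]

theorem absolutelyContinuousOnInterval_congr {f f' : ℝ → ℂ}
    (hf : AbsolutelyContinuousOnInterval f α β) (heq : ∀ x ∈ uIcc α β, f x = f' x) :
    AbsolutelyContinuousOnInterval f' α β := by
  rw [absolutelyContinuousOnInterval_iff] at hf ⊢
  intro ε hε
  obtain ⟨δ, hδ, H⟩ := hf ε hε
  refine ⟨δ, hδ, fun E hE hlen => ?_⟩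
  convert H E hE hlen using 1
  refine Finset.sum_congr rfl fun i hi => ?_
  rw [heq _ (hE.1 i hi).1, heq _ (hE.1 i hi).2]

/-- The complex case follows from the real one through real and imaginary parts. -/
theorem absolutelyContinuousOnInterval_integral
    (hv : IntervalIntegrable v volume α β) :
    AbsolutelyContinuousOnInterval (fun x => ∫ t in α..x, v t) α β := by
  have hc : ∀ z : ℂ, AbsolutelyContinuousOnInterval (fun _ => z) α β := fun z =>
    (LipschitzWith.const z).lipschitzOnWith.absolutelyContinuousOnInterval
  have hre : IntervalIntegrable (fun t => (v t).re) volume α β := ⟨hv.1.re, hv.2.re⟩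
  have him : IntervalIntegrable (fun t => (v t).im) volume α β := ⟨hv.1.im, hv.2.im⟩
  have h1 := (hre.absolutelyContinuousOnInterval_intervalIntegral left_mem_uIcc).fun_smul (hc 1)
  have h2 := (him.absolutelyContinuousOnInterval_intervalIntegral left_mem_uIcc).fun_smul
    (hc Complex.I)
  refine absolutelyContinuousOnInterval_congr (h1.fun_add h2) fun x hx => ?_
  have hs : uIcc α x ⊆ uIcc α β := uIcc_subset_uIcc left_mem_uIcc hx
  have e1 : ∫ t in α..x, v t = ∫ t in α..x, (((v t).re : ℂ) + (v t).im * Complex.I) := by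
    simp [Complex.re_add_im]
  rw [e1, intervalIntegral.integral_add, intervalIntegral.integral_mul_const,
    intervalIntegral.integral_ofReal, intervalIntegral.integral_ofReal]
  · simp
  · exact ⟨(hre.mono_set hs).1.ofReal, (hre.mono_set hs).2.ofReal⟩
  · exact IntervalIntegrable.mul_const
      ⟨(him.mono_set hs).1.ofReal, (him.mono_set hs).2.ofReal⟩ _

theorem IsPrimitive.continuousOn (hab : α ≤ β) (hu : IsPrimitive α β u v) :
    ContinuousOn u (Icc α β) := by
  have : ContinuousOn (fun x => u α + ∫ t in α..x, v t) (Icc α β) := by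
    have h1 := (absolutelyContinuousOnInterval_integral hu.1).continuousOn
    rw [uIcc_of_le hab] at h1
    exact continuousOn_const.add h1
  exact this.congr hu.2

theorem IsPrimitive.mono {α' β' : ℝ} (hu : IsPrimitive α β u v) (h1 : α ≤ α') (h2 : α' ≤ β')
    (h3 : β' ≤ β) : IsPrimitive α' β' u v := by
  have hab : α ≤ β := h1.trans (h2.trans h3)
  have hi : ∀ x ∈ Icc α β, ∀ y ∈ Icc α β, IntervalIntegrable v volume x y := fun x hx y hy => by
    refine hu.1.mono_set ?_
    rw [uIcc_of_le hab]
    exact ordConnected_Icc.uIcc_subset hx hy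
  have hm : ∀ x, x ∈ Icc α' β' → x ∈ Icc α β := fun x hx => ⟨h1.trans hx.1, hx.2.trans h3⟩
  have hα' := hm _ (left_mem_Icc.2 h2)
  refine ⟨hi _ hα' _ (hm _ (right_mem_Icc.2 h2)), fun x hx => ?_⟩
  rw [hu.2 x (hm x hx), hu.2 α' hα', add_assoc,
    intervalIntegral.integral_add_adjacent_intervals (hi _ (left_mem_Icc.2 hab) _ hα')
      (hi _ hα' _ (hm x hx))]

/-- Integration by parts for absolutely continuous functions. -/
theorem IsPrimitive.integral_mul_add_mul (hab : α ≤ β) (hu : IsPrimitive α β u v)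
    (hg : IsPrimitive α β g h) :
    ∫ t in α..β, (u t * h t + v t * g t) = u β * g β - u α * g α := by
  have hc : ∀ z : ℂ, AbsolutelyContinuousOnInterval (fun _ => z) α β := fun z =>
    (LipschitzWith.const z).lipschitzOnWith.absolutelyContinuousOnInterval
  have hI := uIcc_of_le hab
  have au := absolutelyContinuousOnInterval_congr
    ((hc (u α)).fun_add (absolutelyContinuousOnInterval_integral hu.1))
    (fun x hx => (hu.2 x (hI ▸ hx)).symm)
  have ag := absolutelyContinuousOnInterval_congr
    ((hc (g α)).fun_add (absolutelyContinuousOnInterval_integral hg.1))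
    (fun x hx => (hg.2 x (hI ▸ hx)).symm)
  have cu := au.continuousOn
  have cg := ag.continuousOn
  have hint : IntervalIntegrable (fun t => u t * h t + v t * g t) volume α β :=
    (hg.1.continuousOn_mul cu).add (hu.1.mul_continuousOn cg)
  -- The product minus the integral of its expected derivative is absolutely continuous with
  -- derivative zero almost everywhere, hence constant. The endpoints are discarded because the
  -- formulas for `u` and `g` hold only inside the interval.
  have aF := (au.fun_smul ag).fun_sub (absolutelyContinuousOnInterval_integral hint)
  obtain ⟨C, hC⟩ := aF.const_of_ae_hasDerivAt_zero (by
    have hae : ∀ᵐ x : ℝ, x ≠ α ∧ x ≠ β := by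
      filter_upwards [compl_mem_ae_iff.2 (measure_singleton α),
        compl_mem_ae_iff.2 (measure_singleton β)] with x h1 h2 using ⟨h1, h2⟩
    filter_upwards [hae, hu.1.ae_hasDerivAt_integral, hg.1.ae_hasDerivAt_integral,
      hint.ae_hasDerivAt_integral] with x hx h1 h2 h3 hxm
    have hxI : x ∈ Ioo α β := by
      rw [hI] at hxm
      exact ⟨lt_of_le_of_ne hxm.1 hx.1.symm, lt_of_le_of_ne hxm.2 hx.2⟩
    have d1 : HasDerivAt u (v x) x := by
      refine ((h1 hxm α left_mem_uIcc).const_add (u α)).congr_of_eventuallyEq ?_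
      filter_upwards [isOpen_Ioo.mem_nhds hxI] with y hy using hu.2 y (Ioo_subset_Icc_self hy)
    have d2 : HasDerivAt g (h x) x := by
      refine ((h2 hxm α left_mem_uIcc).const_add (g α)).congr_of_eventuallyEq ?_
      filter_upwards [isOpen_Ioo.mem_nhds hxI] with y hy using hg.2 y (Ioo_subset_Icc_self hy)
    have d3 := (d1.mul d2).sub (h3 hxm α left_mem_uIcc)
    have e0 : v x * g x + u x * h x - (u x * h x + v x * g x) = 0 := by ring
    rw [e0] at d3
    exact d3)
  have e1 := hC α left_mem_uIcc
  have e2 := hC β right_mem_uIcc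
  simp only [intervalIntegral.integral_same, sub_zero, smul_eq_mul] at e1 e2
  linear_combination e1 - e2

theorem IsPrimitive.mul (hab : α ≤ β) (hu : IsPrimitive α β u v) (hg : IsPrimitive α β g h) :
    IsPrimitive α β (fun t => u t * g t) (fun t => u t * h t + v t * g t) := by
  have cu := hu.continuousOn hab
  have cg := hg.continuousOn hab
  rw [← uIcc_of_le hab] at cu cg
  refine ⟨(hg.1.continuousOn_mul cu).add (hu.1.mul_continuousOn cg), fun x hx => ?_⟩
  rw [(hu.mono le_rfl hx.1 hx.2).integral_mul_add_mul hx.1 (hg.mono le_rfl hx.1 hx.2)]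
  ring

theorem IsPrimitive.const_mul (z : ℂ) (hu : IsPrimitive α β u v) :
    IsPrimitive α β (fun t => z * u t) (fun t => z * v t) := by
  refine ⟨hu.1.const_mul z, fun x hx => ?_⟩
  rw [intervalIntegral.integral_const_mul, hu.2 x hx]
  ring

theorem IsPrimitive.star (hu : IsPrimitive α β u v) :
    IsPrimitive α β (fun t => starRingEnd ℂ (u t)) (fun t => starRingEnd ℂ (v t)) := by
  refine ⟨?_, fun x hx => ?_⟩
  · have := hu.1
    rw [intervalIntegrable_iff] at this ⊢
    exact (ContinuousLinearMap.integrable_comp (Complex.conjCLE : ℂ →L[ℝ] ℂ) this)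
  · rw [hu.2 x hx, map_add, intervalIntegral, intervalIntegral]
    simp only [map_sub, integral_conj]

theorem isPrimitive_of_hasDerivAt (hd : ∀ x, HasDerivAt u (v x) x)
    (hc : Continuous v) : IsPrimitive α β u v := by
  refine ⟨hc.intervalIntegrable _ _, fun x hx => ?_⟩
  rw [intervalIntegral.integral_eq_sub_of_hasDerivAt (fun t _ => hd t)
    (hc.intervalIntegrable _ _)]
  ring

theorem isPrimitive_integral (hv : IntervalIntegrable v volume α β) :
    IsPrimitive α β (fun x => ∫ t in α..x, v t) v :=
  ⟨hv, fun x _ => by simp⟩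

theorem IsPrimitive.congr_right {v' : ℝ → ℂ} (hab : α ≤ β) (hu : IsPrimitive α β u v)
    (hv : v =ᵐ[volume.restrict (Ioo α β)] v') : IsPrimitive α β u v' := by
  have hi := hu.1
  rw [intervalIntegrable_iff_integrableOn_Ioo_of_le hab] at hi
  refine ⟨(intervalIntegrable_iff_integrableOn_Ioo_of_le hab).2 (hi.congr_fun_ae hv),
    fun x hx => ?_⟩
  rw [hu.2 x hx, ← setIntegral_Ioo_eq_intervalIntegral hx.1,
    ← setIntegral_Ioo_eq_intervalIntegral hx.1]
  congr 1
  exact integral_congr_ae (ae_restrict_of_ae_restrict_of_subset (Ioo_subset_Ioo_right hx.2) hv)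

/-- Gluing at an interior point. -/
theorem IsPrimitive.glue {γ : ℝ} (h1 : α ≤ γ) (hu : IsPrimitive α γ u v)
    (hu' : IsPrimitive γ β u v) : IsPrimitive α β u v := by
  refine ⟨hu.1.trans hu'.1, fun x hx => ?_⟩
  rcases le_total x γ with hxγ | hxγ
  · exact hu.2 x ⟨hx.1, hxγ⟩
  · rw [hu'.2 x ⟨hxγ, hx.2⟩, hu.2 γ ⟨h1, le_rfl⟩, add_assoc,
      intervalIntegral.integral_add_adjacent_intervals hu.1 (hu'.mono le_rfl hxγ hx.2).1]

/-! Weak derivatives on an interval. -/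

theorem fderiv_apply_one (φ : ℝ → ℝ) (x : ℝ) : fderiv ℝ φ x 1 = deriv φ x := by
  simp

theorem eq_zero_of_tsupport_subset_Ioo {φ : ℝ → ℝ} (hs : tsupport φ ⊆ Ioo α β) :
    φ α = 0 ∧ φ β = 0 :=
  ⟨image_eq_zero_of_notMem_tsupport fun h' => (hs h').1.false,
    image_eq_zero_of_notMem_tsupport fun h' => (hs h').2.false⟩

theorem isPrimitive_ofReal_test {φ : ℝ → ℝ} (hφ : ContDiff ℝ ∞ φ) :
    IsPrimitive α β (fun x => (φ x : ℂ)) (fun x => ((deriv φ x : ℝ) : ℂ)) :=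
  isPrimitive_of_hasDerivAt
    (fun x => ((hφ.differentiable (by simp) x).hasDerivAt).ofReal_comp)
    (Complex.continuous_ofReal.comp (hφ.continuous_deriv (by simp)))

theorem IsPrimitive.hasWeakDeriv (hab : α ≤ β) (hu : IsPrimitive α β u v) :
    HasWeakDeriv (Ioo α β) 1 u v := by
  intro φ h1 h2 h3
  obtain ⟨hα, hβ⟩ := eq_zero_of_tsupport_subset_Ioo h3
  have hp := isPrimitive_ofReal_test (α := α) (β := β) h1
  have key := hp.integral_mul_add_mul hab hu
  have cu := hu.continuousOn hab
  have cφ := hp.continuousOn hab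
  rw [← uIcc_of_le hab] at cu cφ
  rw [intervalIntegral.integral_add (hu.1.continuousOn_mul cφ) (hp.1.mul_continuousOn cu)] at key
  rw [setIntegral_Ioo_eq_intervalIntegral hab, setIntegral_Ioo_eq_intervalIntegral hab]
  simp only [hα, hβ, Complex.ofReal_zero, zero_mul, sub_zero] at key
  simp only [fderiv_apply_one, Complex.real_smul]
  linear_combination key

theorem exists_Icc_of_isCompact_subset_Ioo {k : Set ℝ} (hab : α < β) (hk : IsCompact k)
    (hs : k ⊆ Ioo α β) : ∃ m M, α < m ∧ m ≤ M ∧ M < β ∧ k ⊆ Icc m M := by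
  rcases k.eq_empty_or_nonempty with rfl | hne
  · exact ⟨(α + β) / 2, (α + β) / 2, by linarith, le_rfl, by linarith, empty_subset _⟩
  · obtain ⟨m, hm, hm'⟩ := hk.exists_isLeast hne
    obtain ⟨M, hM, hM'⟩ := hk.exists_isGreatest hne
    exact ⟨m, M, (hs hm).1, hm' hM, (hs hM).2, fun x hx => ⟨hm' hx, hM' hx⟩⟩

/-- A test function with vanishing mean is the derivative of a test function. -/
theorem exists_test_antideriv (hab : α < β) {χ : ℝ → ℝ} (hχ : ContDiff ℝ ∞ χ)
    (hc : HasCompactSupport χ) (hs : tsupport χ ⊆ Ioo α β) (h0 : ∫ t in Ioo α β, χ t = 0) :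
    ∃ φ : ℝ → ℝ, ContDiff ℝ ∞ φ ∧ HasCompactSupport φ ∧ tsupport φ ⊆ Ioo α β ∧
      ∀ x, deriv φ x = χ x := by
  obtain ⟨m, M, h1, h2, h3, hk⟩ := exists_Icc_of_isCompact_subset_Ioo hab hc hs
  have hz : ∀ x, x ∉ Icc m M → χ x = 0 := fun x hx =>
    image_eq_zero_of_notMem_tsupport fun h' => hx (hk h')
  let φ : ℝ → ℝ := fun x => ∫ t in α..x, χ t
  have hd : ∀ x, HasDerivAt φ (χ x) x := fun x =>
    intervalIntegral.integral_hasDerivAt_right (hχ.continuous.intervalIntegrable _ _)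
      (hχ.continuous.stronglyMeasurableAtFilter _ _) hχ.continuous.continuousAt
  have hder : deriv φ = χ := funext fun x => (hd x).deriv
  have hsm : ContDiff ℝ ∞ φ := by
    rw [contDiff_infty_iff_deriv]
    exact ⟨fun x => (hd x).differentiableAt, hder ▸ hχ⟩
  have hi : ∀ x y, IntervalIntegrable χ volume x y := fun x y =>
    hχ.continuous.intervalIntegrable _ _
  have hzero : ∀ x, x ∉ Icc m M → φ x = 0 := by
    intro x hx
    rw [mem_Icc, not_and_or, not_le, not_le] at hx
    rcases hx with hx | hx
    · refine (intervalIntegral.integral_congr (g := fun _ => 0) fun t ht => hz t fun h' => ?_).trans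
        (by simp)
      have := ht.2
      have : t < m := lt_of_le_of_lt this (max_lt h1 hx)
      exact absurd h'.1 (not_le.2 this)
    -- To the right of the support the antiderivative equals the total integral; this is the only
    -- use of the vanishing mean.
    · have e1 : ∫ t in α..β, χ t = 0 := by
        rw [← setIntegral_Ioo_eq_intervalIntegral hab.le, h0]
      have e2 : ∫ t in x..β, χ t = 0 := by
        refine (intervalIntegral.integral_congr (g := fun _ => 0) fun t ht =>
          hz t fun h' => ?_).trans (by simp)
        have := ht.1
        have : M < t := lt_of_lt_of_le (lt_min hx h3) this
        exact absurd h'.2 (not_le.2 this)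
      have e3 := intervalIntegral.integral_add_adjacent_intervals (hi α x) (hi x β)
      show ∫ t in α..x, χ t = 0
      linarith
  have hts : tsupport φ ⊆ Icc m M :=
    closure_minimal (fun x hx => by_contra fun h' => hx (hzero x h')) isClosed_Icc
  exact ⟨φ, hsm, isCompact_Icc.of_isClosed_subset (isClosed_tsupport _) hts,
    hts.trans fun x hx => ⟨h1.trans_le hx.1, hx.2.trans_lt h3⟩, fun x => (hd x).deriv⟩

theorem exists_test_integral_eq_one (hab : α < β) : ∃ ψ : ℝ → ℝ, ContDiff ℝ ∞ ψ ∧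
    HasCompactSupport ψ ∧ tsupport ψ ⊆ Ioo α β ∧ ∫ t in Ioo α β, ψ t = 1 := by
  -- The outer radius `(β - α) / 4` is below half the length, so the closed support stays inside the
  -- open interval.
  let f : ContDiffBump ((α + β) / 2) := ⟨(β - α) / 8, (β - α) / 4, by linarith, by linarith⟩
  have hs : tsupport (f.normed volume) ⊆ Ioo α β := by
    rw [f.tsupport_normed_eq]
    intro x hx
    rw [Metric.mem_closedBall, Real.dist_eq, abs_le] at hx
    obtain ⟨h1, h2⟩ := hx
    simp only [f] at h1 h2
    constructor <;> linarith
  refine ⟨f.normed volume, f.contDiff_normed, f.hasCompactSupport_normed, hs, ?_⟩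
  rw [setIntegral_eq_integral_of_forall_compl_eq_zero, f.integral_normed]
  exact fun x hx => image_eq_zero_of_notMem_tsupport fun h' => hx (hs h')

theorem integrable_test_smul_of_integrable {U : Set ℝ} {w : ℝ → ℂ} (hw : IntegrableOn w U)
    {φ : ℝ → ℝ}
    (hφ : Continuous φ) (hc : HasCompactSupport φ) : IntegrableOn (fun x => φ x • w x) U := by
  obtain ⟨C, hC⟩ := hφ.bounded_above_of_compact_support hc
  exact hw.bdd_smul C hφ.aestronglyMeasurable (Eventually.of_forall hC)

/-- The lemma of du Bois-Reymond. -/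
theorem ae_eq_const_of_hasWeakDeriv_zero (hab : α < β) (iu : IntegrableOn u (Ioo α β))
    (hu : HasWeakDeriv (Ioo α β) 1 u 0) :
    ∃ C : ℂ, u =ᵐ[volume.restrict (Ioo α β)] fun _ => C := by
  obtain ⟨ψ₀, s0, c0, t0, i0⟩ := exists_test_integral_eq_one hab
  -- The constant is read off by testing with the fixed function `ψ₀` of integral one.
  let C : ℂ := ∫ t in Ioo α β, ψ₀ t • u t
  refine ⟨C, ?_⟩
  have iC : IntegrableOn (fun _ => C) (Ioo α β) := by simp
  have hl : LocallyIntegrableOn (fun t => u t - C) (Ioo α β) volume :=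
    (iu.sub iC).locallyIntegrableOn
  have := isOpen_Ioo.ae_eq_zero_of_integral_contDiff_smul_eq_zero hl (fun ψ s1 c1 t1 => by
    let s : ℝ := ∫ t in Ioo α β, ψ t
    have iψ : IntegrableOn ψ (Ioo α β) :=
      (s1.continuous.integrable_of_hasCompactSupport c1).integrableOn
    have iψ₀ : IntegrableOn ψ₀ (Ioo α β) :=
      (s0.continuous.integrable_of_hasCompactSupport c0).integrableOn
    -- Subtracting `s ψ₀`, where `s` is the mean of `ψ`, leaves mean zero, so the difference is the
    -- derivative of a test function, on which `u` vanishes by hypothesis.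
    have hsm : ContDiff ℝ ∞ fun t => ψ t - s * ψ₀ t := s1.sub (contDiff_const.mul s0)
    have hcs : HasCompactSupport fun t => ψ t - s * ψ₀ t := c1.sub c0.mul_left
    have hts : tsupport (fun t => ψ t - s * ψ₀ t) ⊆ Ioo α β :=
      (tsupport_sub _ _).trans (union_subset t1 ((tsupport_mul_subset_right).trans t0))
    obtain ⟨φ, p1, p2, p3, p4⟩ := exists_test_antideriv hab hsm hcs hts (by
      rw [integral_sub iψ (iψ₀.const_mul s), integral_const_mul, i0, mul_one, sub_self])
    have e1 := hu φ p1 p2 p3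
    simp only [fderiv_apply_one, p4, Pi.zero_apply, smul_zero, integral_zero, neg_zero,
      sub_smul, mul_smul] at e1
    have j1 := integrable_test_smul_of_integrable iu s1.continuous c1
    have j0 := integrable_test_smul_of_integrable iu s0.continuous c0
    have j2 : IntegrableOn (fun t => s • ψ₀ t • u t) (Ioo α β) := j0.smul s
    rw [integral_sub j1 j2, integral_smul] at e1
    rw [← setIntegral_eq_integral_of_forall_compl_eq_zero (s := Ioo α β)]
    · simp only [smul_sub]
      rw [integral_sub j1 (iψ.smul_const C), integral_smul_const]
      exact e1
    · intro x hx
      rw [image_eq_zero_of_notMem_tsupport fun h' => hx (t1 h'), zero_smul])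
  filter_upwards [(ae_restrict_iff' measurableSet_Ioo).2 this] with x hx
  exact sub_eq_zero.1 hx

/-- The difference of `u` and the primitive of `v` has zero weak derivative and is therefore
constant. From here on weak derivatives in one variable are handled through representatives with
genuine endpoint values. -/
theorem exists_isPrimitive_of_hasWeakDeriv (hab : α < β) (iu : IntegrableOn u (Ioo α β))
    (iv : IntegrableOn v (Ioo α β)) (hu : HasWeakDeriv (Ioo α β) 1 u v) :
    ∃ U : ℝ → ℂ, IsPrimitive α β U v ∧ u =ᵐ[volume.restrict (Ioo α β)] U := by
  have hv := (intervalIntegrable_iff_integrableOn_Ioo_of_le hab.le).2 iv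
  have hV := isPrimitive_integral hv
  have iV : IntegrableOn (fun x => ∫ t in α..x, v t) (Ioo α β) :=
    ((hV.continuousOn hab.le).integrableOn_Icc).mono_set Ioo_subset_Icc_self
  obtain ⟨C, hC⟩ := ae_eq_const_of_hasWeakDeriv_zero (u := fun x => u x - ∫ t in α..x, v t) hab
    (iu.sub iV) (fun φ h1 h2 h3 => by
      have e1 := hu φ h1 h2 h3
      have e2 := hV.hasWeakDeriv hab.le φ h1 h2 h3
      have hcd : Continuous fun x => fderiv ℝ φ x 1 :=
        (h1.continuous_fderiv (by simp)).clm_apply continuous_const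
      have hcs : HasCompactSupport fun x => fderiv ℝ φ x 1 := h2.fderiv_apply ℝ 1
      simp only [smul_sub, Pi.zero_apply, smul_zero, integral_zero, neg_zero]
      rw [integral_sub (integrable_test_smul_of_integrable iu hcd hcs)
        (integrable_test_smul_of_integrable iV hcd hcs), e1, e2, sub_self])
  refine ⟨fun x => C + ∫ t in α..x, v t, ⟨hv, fun x _ => by simp⟩, ?_⟩
  filter_upwards [hC] with x hx
  linear_combination hx

/-! Approximation by smooth functions. -/

/-- An absolutely continuous function with square integrable derivative is the limit of smooth
functions, uniformly and with convergence of the derivatives in `L²`. -/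
theorem IsPrimitive.exists_contDiff_approx (hu : IsPrimitive α β u v)
    (mv : MemLp v 2 (volume.restrict (Ioo α β))) :
    ∃ w : ℕ → ℝ → ℂ, (∀ k, ContDiff ℝ ∞ (w k)) ∧
      Tendsto (fun k => eLpNorm (fun x => u x - w k x) 2 (volume.restrict (Ioo α β)))
        atTop (𝓝 0) ∧
      Tendsto (fun k => eLpNorm (fun x => v x - deriv (w k) x) 2 (volume.restrict (Ioo α β)))
        atTop (𝓝 0) ∧
      ∀ x ∈ Icc α β, Tendsto (fun k => w k x) atTop (𝓝 (u x)) := by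
  set μ : Measure ℝ := volume.restrict (Ioo α β) with hμ
  have hpos : ∀ k : ℕ, (0 : ℝ) < 1 / ((k : ℝ) + 1) := fun k => by positivity
  -- The derivative is approximated first, in `L²`, and the approximants of `u` are obtained by
  -- integration from the exact value at `α`.
  choose q _ q2 q3 using fun k : ℕ => mv.exist_eLpNorm_sub_le (by norm_num) (by norm_num) (hpos k)
  have hq : Tendsto (fun k => eLpNorm (v - q k) 2 μ) atTop (𝓝 0) := by
    refine tendsto_of_tendsto_of_tendsto_of_le_of_le tendsto_const_nhds ?_ (fun _ => zero_le) q3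
    simpa using ENNReal.tendsto_ofReal tendsto_one_div_add_atTop_nhds_zero_nat
  have hV : μ univ ≠ ⊤ := by simp [hμ]
  -- By Cauchy–Schwarz this bounds the `L¹` norm of the error in the derivative, hence the uniform
  -- error of the primitives.
  let B : ℕ → ℝ≥0∞ := fun k => eLpNorm (v - q k) 2 μ * μ univ ^ (1 / 2 : ℝ)
  have hB : Tendsto B atTop (𝓝 0) := by
    simpa using ENNReal.Tendsto.mul_const hq (Or.inr (by simp [hV]))
  let w : ℕ → ℝ → ℂ := fun k x => u α + ∫ t in α..x, q k t
  have hd : ∀ k x, HasDerivAt (w k) (q k x) x := fun k x =>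
    (intervalIntegral.integral_hasDerivAt_right ((q2 k).continuous.intervalIntegrable _ _)
      ((q2 k).continuous.stronglyMeasurableAtFilter _ _)
      (q2 k).continuous.continuousAt).const_add _
  have hder : ∀ k, deriv (w k) = q k := fun k => funext fun x => (hd k x).deriv
  have hbound : ∀ k, ∀ x ∈ Icc α β, ‖u x - w k x‖ₑ ≤ B k := fun k x hx => by
    have hsub : Ioc α x ⊆ Ioc α β := Ioc_subset_Ioc_right hx.2
    have e1 : u x - w k x = ∫ t in Ioc α x, (v - q k) t := by
      simp only [w]
      rw [hu.2 x hx, add_sub_add_left_eq_sub, ← intervalIntegral.integral_sub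
        (hu.mono le_rfl hx.1 hx.2).1 ((q2 k).continuous.intervalIntegrable _ _),
        intervalIntegral.integral_of_le hx.1]
      rfl
    have hm : AEStronglyMeasurable (v - q k) μ :=
      mv.1.sub (q2 k).continuous.aestronglyMeasurable
    rw [e1]
    calc ‖∫ t in Ioc α x, (v - q k) t‖ₑ ≤ ∫⁻ t in Ioc α x, ‖(v - q k) t‖ₑ :=
          enorm_integral_le_lintegral_enorm _
      _ ≤ ∫⁻ t in Ioc α β, ‖(v - q k) t‖ₑ := lintegral_mono_set hsub
      _ = eLpNorm (v - q k) 1 μ := by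
          rw [eLpNorm_one_eq_lintegral_enorm, hμ, restrict_Ioo_eq_restrict_Ioc]
      _ ≤ B k := by
          refine (eLpNorm_le_eLpNorm_mul_rpow_measure_univ (p := 1) (q := 2) (by norm_num) hm).trans
            (le_of_eq ?_)
          simp only [B]
          congr 2
          norm_num
  refine ⟨w, fun k => ?_, ?_, ?_, fun x hx => ?_⟩
  · rw [contDiff_infty_iff_deriv]
    exact ⟨fun x => (hd k x).differentiableAt, hder k ▸ q2 k⟩
  · have h2 : Tendsto (fun k => μ univ ^ (1 / 2 : ℝ) * B k) atTop (𝓝 0) := by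
      simpa using ENNReal.Tendsto.const_mul hB (Or.inr (by simp [hV]))
    refine tendsto_of_tendsto_of_tendsto_of_le_of_le tendsto_const_nhds h2 (fun _ => zero_le)
      fun k => ?_
    have hae : ∀ᵐ x ∂μ, ‖u x - w k x‖ₑ ≤ B k := by
      filter_upwards [ae_restrict_mem measurableSet_Ioo] with x hx
      exact hbound k x (Ioo_subset_Icc_self hx)
    refine (eLpNorm_le_of_ae_enorm_bound hae).trans (le_of_eq ?_)
    simp [mul_comm]
  · simp only [hder]
    exact hq
  · rw [tendsto_iff_edist_tendsto_0]
    refine tendsto_of_tendsto_of_tendsto_of_le_of_le tendsto_const_nhds hB (fun _ => zero_le)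
      fun k => ?_
    rw [edist_comm, edist_eq_enorm_sub]
    exact hbound k x hx

end Primitive

/-! ### The Jacobian and the weighted measure -/

theorem contDiff_jac (K : ℝ) : ContDiff ℝ ∞ (jac K) := by
  unfold jac
  split_ifs
  · exact Real.contDiff_cos.comp (contDiff_const.mul contDiff_id)
  · exact contDiff_const
  · exact Real.contDiff_cosh.comp (contDiff_const.mul contDiff_id)

theorem continuous_jac (K : ℝ) : Continuous (jac K) := (contDiff_jac K).continuous

theorem continuous_deriv_jac (K : ℝ) : Continuous (deriv (jac K)) :=
  (contDiff_jac K).continuous_deriv (by simp)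

theorem hasDerivAt_jac (K x : ℝ) : HasDerivAt (jac K) (deriv (jac K) x) x :=
  ((contDiff_jac K).differentiable (by simp) x).hasDerivAt

theorem jac_pos_of_mem_Icc {K a b x : ℝ}
    (hK : 0 < K → √K * a < Real.pi / 2 ∧ √K * b < Real.pi / 2) (hx : x ∈ Icc (-b) a) :
    0 < jac K x := by
  unfold jac
  split_ifs with h h'
  · obtain ⟨h1, h2⟩ := hK h
    have hs : 0 < √K := Real.sqrt_pos.2 h
    refine Real.cos_pos_of_mem_Ioo ⟨?_, ?_⟩ <;> nlinarith [hx.1, hx.2]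
  · exact one_pos
  · exact Real.cosh_pos _

/-- The standing assumptions on the geometry of the base interval. -/
structure IsAdmissible (K a b : ℝ) : Prop where
  a_pos : 0 < a
  b_pos : 0 < b
  curv : 0 < K → √K * a < Real.pi / 2 ∧ √K * b < Real.pi / 2

section

variable {K a b : ℝ}

theorem IsAdmissible.lt (h : IsAdmissible K a b) : -b < a := by linarith [h.a_pos, h.b_pos]

theorem IsAdmissible.jac_pos (h : IsAdmissible K a b) {x : ℝ} (hx : x ∈ Icc (-b) a) :
    0 < jac K x := jac_pos_of_mem_Icc h.curv hx

theorem IsAdmissible.exists_bounds (h : IsAdmissible K a b) :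
    ∃ m M : ℝ, 0 < m ∧ 0 < M ∧ ∀ x ∈ Icc (-b) a, m ≤ jac K x ∧ jac K x ≤ M := by
  have hne : (Icc (-b) a).Nonempty := ⟨a, h.lt.le, le_rfl⟩
  obtain ⟨x, hx, hm⟩ := isCompact_Icc.exists_isMinOn hne (continuous_jac K).continuousOn
  obtain ⟨y, hy, hM⟩ := isCompact_Icc.exists_isMaxOn hne (continuous_jac K).continuousOn
  exact ⟨_, _, h.jac_pos hx, h.jac_pos hy, fun z hz => ⟨hm hz, hM hz⟩⟩

theorem lineMeasure_le {M : ℝ} (hM : ∀ x ∈ Icc (-b) a, jac K x ≤ M) :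
    lineMeasure K a b ≤ ENNReal.ofReal M • volume.restrict (Ioo (-b) a) := by
  rw [← withDensity_const]
  refine withDensity_mono ?_
  filter_upwards [ae_restrict_mem measurableSet_Ioo] with x hx
  exact ENNReal.ofReal_le_ofReal (hM x (Ioo_subset_Icc_self hx))

theorem restrict_le_smul_lineMeasure {m : ℝ} (hm0 : 0 < m) (hm : ∀ x ∈ Icc (-b) a, m ≤ jac K x) :
    volume.restrict (Ioo (-b) a) ≤ ENNReal.ofReal m⁻¹ • lineMeasure K a b := by
  have h1 : ENNReal.ofReal m • volume.restrict (Ioo (-b) a) ≤ lineMeasure K a b := by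
    rw [← withDensity_const]
    refine withDensity_mono ?_
    filter_upwards [ae_restrict_mem measurableSet_Ioo] with x hx
    exact ENNReal.ofReal_le_ofReal (hm x (Ioo_subset_Icc_self hx))
  calc volume.restrict (Ioo (-b) a)
      = ENNReal.ofReal m⁻¹ • (ENNReal.ofReal m • volume.restrict (Ioo (-b) a)) := by
        rw [smul_smul, ← ENNReal.ofReal_mul (by positivity), inv_mul_cancel₀ hm0.ne']; simp
    _ ≤ _ := by gcongr

/-- On the closed interval `f` lies between two positive constants, so the weighted and unweighted
spaces have the same elements. -/
theorem IsAdmissible.memLp_line_iff (h : IsAdmissible K a b) {p : ℝ≥0∞} {g : ℝ → ℂ} :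
    MemLp g p (lineMeasure K a b) ↔ MemLp g p (volume.restrict (Ioo (-b) a)) := by
  obtain ⟨m, M, hm, hM, hb⟩ := h.exists_bounds
  exact ⟨fun hg => hg.of_measure_le_smul ENNReal.ofReal_ne_top
      (restrict_le_smul_lineMeasure hm fun x hx => (hb x hx).1),
    fun hg => hg.of_measure_le_smul ENNReal.ofReal_ne_top (lineMeasure_le fun x hx => (hb x hx).2)⟩

instance isFiniteMeasure_lineMeasure (K a b : ℝ) : IsFiniteMeasure (lineMeasure K a b) := by
  have : ∃ M, ∀ x ∈ Icc (-b) a, jac K x ≤ M := by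
    obtain ⟨M, hM⟩ := isCompact_Icc.exists_bound_of_continuousOn (s := Icc (-b) a)
      (continuous_jac K).continuousOn
    exact ⟨M, fun x hx => (le_abs_self _).trans (hM x hx)⟩
  obtain ⟨M, hM⟩ := this
  refine ⟨lt_of_le_of_lt (lineMeasure_le hM univ) ?_⟩
  simp [ENNReal.mul_lt_top_iff]

instance separableSpace_L2Line (K a b : ℝ) : TopologicalSpace.SeparableSpace (L2Line K a b) := by
  have : Fact ((2 : ℝ≥0∞) ≠ ⊤) := ⟨by norm_num⟩
  have := MeasureTheory.Lp.SecondCountableTopology (E := ℂ) (p := 2) (μ := lineMeasure K a b)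
  infer_instance

theorem ae_lineMeasure_of_ae {p : ℝ → Prop} (h : ∀ᵐ x ∂volume.restrict (Ioo (-b) a), p x) :
    ∀ᵐ x ∂lineMeasure K a b, p x :=
  (withDensity_absolutelyContinuous _ _).ae_le h

theorem IsAdmissible.ae_of_ae_lineMeasure (h : IsAdmissible K a b) {p : ℝ → Prop}
    (hp : ∀ᵐ x ∂lineMeasure K a b, p x) : ∀ᵐ x ∂volume.restrict (Ioo (-b) a), p x :=
  (volume_ac_lineMeasure h.curv).ae_le hp

theorem ae_mem_lineMeasure : ∀ᵐ x ∂lineMeasure K a b, x ∈ Ioo (-b) a :=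
  ae_lineMeasure_of_ae (ae_restrict_mem measurableSet_Ioo)

theorem IsAdmissible.integral_lineMeasure (h : IsAdmissible K a b) (g : ℝ → ℂ) :
    ∫ x, g x ∂lineMeasure K a b = ∫ x in Ioo (-b) a, (jac K x : ℂ) * g x := by
  rw [lineMeasure, integral_withDensity_eq_integral_toReal_smul
    (measurable_jac K).ennreal_ofReal (by simp)]
  refine setIntegral_congr_fun measurableSet_Ioo fun x hx => ?_
  simp only [ENNReal.toReal_ofReal (h.jac_pos (Ioo_subset_Icc_self hx)).le, Complex.real_smul]

/-- This translates `volterra`, written with half-lines and the weighted measure, into ordinary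
primitives containing the factor `f`. -/
theorem IsAdmissible.setIntegral_Iic_lineMeasure (h : IsAdmissible K a b) (g : ℝ → ℂ) {x : ℝ}
    (hx : x ∈ Icc (-b) a) :
    ∫ t in Iic x, g t ∂lineMeasure K a b = ∫ t in (-b)..x, (jac K t : ℂ) * g t := by
  rw [lineMeasure, setIntegral_withDensity_eq_setIntegral_toReal_smul
    (measurable_jac K).ennreal_ofReal (by simp) _ measurableSet_Iic,
    Measure.restrict_restrict measurableSet_Iic, ← setIntegral_Ioo_eq_intervalIntegral hx.1]
  have e1 : (Iic x ∩ Ioo (-b) a : Set ℝ) =ᵐ[volume] Ioo (-b) x := by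
    filter_upwards [compl_mem_ae_iff.2 (measure_singleton x)] with t ht
    have ht : t ≠ x := ht
    refine propext ⟨fun h' => ⟨h'.2.1, lt_of_le_of_ne h'.1 ht⟩,
      fun h' => ⟨h'.2.le, h'.1, h'.2.trans_le hx.2⟩⟩
  rw [setIntegral_congr_set e1]
  refine setIntegral_congr_fun measurableSet_Ioo fun t ht => ?_
  simp only [ENNReal.toReal_ofReal (h.jac_pos ⟨ht.1.le, ht.2.le.trans hx.2⟩).le,
    Complex.real_smul]

/-! ### Multiplication and Volterra operators on the weighted space -/

theorem memLp_bdd_mul {X : Type*} [MeasurableSpace X] {μ : Measure X} {p : ℝ≥0∞} {q g : X → ℂ}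
    (hg : MemLp g p μ) (hq : AEStronglyMeasurable q μ) {C : ℝ} (hC : ∀ᵐ x ∂μ, ‖q x‖ ≤ C) :
    MemLp (fun x => q x * g x) p μ := by
  refine hg.of_le_mul (c := C) (hq.mul hg.1) ?_
  filter_upwards [hC] with x hx
  rw [norm_mul]
  gcongr

/-- Multiplication by a bounded function on `L²`. -/
def mulOp {X : Type*} [MeasurableSpace X] {μ : Measure X} (q : X → ℂ)
    (hq : AEStronglyMeasurable q μ) (C : ℝ) (hC : ∀ᵐ x ∂μ, ‖q x‖ ≤ C) : Lp ℂ 2 μ →L[ℂ] Lp ℂ 2 μ :=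
  LinearMap.mkContinuous
    { toFun := fun g => (memLp_bdd_mul (Lp.memLp g) hq hC).toLp (fun x => q x * g x)
      map_add' := fun g g' => by
        rw [← MemLp.toLp_add]
        refine MemLp.toLp_congr _ _ ?_
        filter_upwards [Lp.coeFn_add g g'] with x hx
        simp only [hx, Pi.add_apply, mul_add]
      map_smul' := fun c g => by
        rw [RingHom.id_apply, ← MemLp.toLp_const_smul]
        refine MemLp.toLp_congr _ _ ?_
        filter_upwards [Lp.coeFn_smul c g] with x hx
        simp [hx, mul_left_comm] } C
    fun g => by
      refine Lp.norm_le_mul_norm_of_ae_le_mul ?_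
      filter_upwards [hC, MemLp.coeFn_toLp (memLp_bdd_mul (Lp.memLp g) hq hC)] with x h1 h2
      simp only [LinearMap.coe_mk, AddHom.coe_mk]
      rw [h2, norm_mul]
      gcongr

theorem mulOp_coeFn {X : Type*} [MeasurableSpace X] {μ : Measure X} {q : X → ℂ}
    {hq : AEStronglyMeasurable q μ} {C : ℝ} {hC : ∀ᵐ x ∂μ, ‖q x‖ ≤ C} (g : Lp ℂ 2 μ) :
    mulOp q hq C hC g =ᵐ[μ] fun x => q x * g x :=
  MemLp.coeFn_toLp (memLp_bdd_mul (Lp.memLp g) hq hC)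

/-- Cauchy–Schwarz against the indicator of `s`. -/
theorem norm_setIntegral_le_norm {X : Type*} [MeasurableSpace X] {μ : Measure X}
    [IsFiniteMeasure μ] {s : Set X} (hs : MeasurableSet s) (g : Lp ℂ 2 μ) :
    ‖∫ t in s, g t ∂μ‖ ≤ √(μ.real s) * ‖g‖ := by
  rw [← L2.inner_indicatorConstLp_one hs (measure_ne_top μ s) g]
  refine (norm_inner_le_norm _ _).trans (le_of_eq ?_)
  rw [norm_indicatorConstLp (by norm_num) (by norm_num)]
  simp [Real.sqrt_eq_rpow]

theorem norm_primitive_sub_le {μ : Measure ℝ} [IsFiniteMeasure μ] (g : Lp ℂ 2 μ) {x y : ℝ}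
    (hxy : x ≤ y) :
    ‖(∫ t in Iic y, g t ∂μ) - ∫ t in Iic x, g t ∂μ‖ ≤ √(μ.real (Ioc x y)) * ‖g‖ := by
  have hi : Integrable g μ := (Lp.memLp g).integrable (by norm_num)
  have : (∫ t in Iic y, g t ∂μ) - ∫ t in Iic x, g t ∂μ = ∫ t in Ioc x y, g t ∂μ := by
    rw [← Iic_union_Ioc_eq_Iic hxy, setIntegral_union (Iic_disjoint_Ioc le_rfl) measurableSet_Ioc
      hi.integrableOn hi.integrableOn, add_sub_cancel_left]
  rw [this]
  exact norm_setIntegral_le_norm measurableSet_Ioc g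

theorem exists_lineMeasure_real_Ioc_le (K a b : ℝ) :
    ∃ M : ℝ, 0 < M ∧ ∀ x y, x ≤ y → (lineMeasure K a b).real (Ioc x y) ≤ M * (y - x) := by
  obtain ⟨M, hM⟩ := isCompact_Icc.exists_bound_of_continuousOn (s := Icc (-b) a)
      (continuous_jac K).continuousOn
  refine ⟨max M 1, by positivity, fun x y hxy => ?_⟩
  have h1 := lineMeasure_le (K := K) (a := a) (b := b) (M := max M 1)
    (fun x hx => ((le_abs_self _).trans (hM x hx)).trans (le_max_left _ _)) (Ioc x y)
  have h2 : (ENNReal.ofReal (max M 1) • volume.restrict (Ioo (-b) a)) (Ioc x y)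
      ≤ ENNReal.ofReal (max M 1 * (y - x)) := by
    rw [Measure.smul_apply, smul_eq_mul, ENNReal.ofReal_mul (by positivity)]
    gcongr
    exact (Measure.restrict_apply_le _ _).trans (by simp)
  exact ENNReal.toReal_le_of_le_ofReal (mul_nonneg (by positivity) (by linarith)) (h1.trans h2)

/-- The weighted measure of `(x, y]` is at most `M (y - x)`, so the primitive is Hölder continuous
of exponent `1 / 2`. -/
theorem continuous_primitive_lineMeasure (g : L2Line K a b) :
    Continuous fun x => ∫ t in Iic x, g t ∂lineMeasure K a b := by
  obtain ⟨M, hM, hb⟩ := exists_lineMeasure_real_Ioc_le K a b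
  have key : ∀ x y, ‖(∫ t in Iic y, g t ∂lineMeasure K a b) - ∫ t in Iic x, g t ∂lineMeasure K a b‖
      ≤ √(M * |y - x|) * ‖g‖ := by
    intro x y
    rcases le_total x y with hxy | hxy
    · refine (norm_primitive_sub_le g hxy).trans ?_
      gcongr
      rw [abs_of_nonneg (by linarith)]
      exact hb x y hxy
    · rw [norm_sub_rev]
      refine (norm_primitive_sub_le g hxy).trans ?_
      gcongr
      rw [abs_sub_comm, abs_of_nonneg (by linarith)]
      exact hb y x hxy
  refine continuous_iff_continuousAt.2 fun x => ?_
  rw [ContinuousAt, tendsto_iff_norm_sub_tendsto_zero]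
  refine squeeze_zero (fun _ => norm_nonneg _) (fun y => key x y) ?_
  have : Continuous fun y : ℝ => √(M * |y - x|) * ‖g‖ := by fun_prop
  simpa using this.tendsto x

theorem memLp_primitive_lineMeasure (g : L2Line K a b) :
    MemLp (fun x => ∫ t in Iic x, g t ∂lineMeasure K a b) 2 (lineMeasure K a b) := by
  refine MemLp.of_bound (continuous_primitive_lineMeasure g).aestronglyMeasurable
    (√((lineMeasure K a b).real univ) * ‖g‖) (Eventually.of_forall fun x => ?_)
  refine (norm_setIntegral_le_norm measurableSet_Iic g).trans ?_
  gcongr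
  · exact measure_ne_top _ _
  · exact subset_univ _

/-- The Volterra operator `g ↦ ∫_{t ≤ x} g` on `L²(J₁, f dx)`. -/
def volterra (K a b : ℝ) : L2Line K a b →L[ℂ] L2Line K a b :=
  LinearMap.mkContinuous
    { toFun := fun g => (memLp_primitive_lineMeasure g).toLp _
      map_add' := fun g g' => by
        rw [← MemLp.toLp_add]
        refine MemLp.toLp_congr _ _ (Eventually.of_forall fun x => ?_)
        have hi := (Lp.memLp g).integrable (by norm_num)
        have hi' := (Lp.memLp g').integrable (by norm_num)
        simp only [Pi.add_apply]
        rw [← integral_add hi.integrableOn hi'.integrableOn]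
        exact integral_congr_ae (ae_restrict_of_ae (Lp.coeFn_add g g'))
      map_smul' := fun c g => by
        rw [RingHom.id_apply, ← MemLp.toLp_const_smul]
        refine MemLp.toLp_congr _ _ (Eventually.of_forall fun x => ?_)
        simp only [Pi.smul_apply]
        rw [← integral_smul]
        exact integral_congr_ae (ae_restrict_of_ae (Lp.coeFn_smul c g)) }
    ((measureUnivNNReal (lineMeasure K a b) : ℝ) ^ (2 : ℝ≥0∞).toReal⁻¹
      * √((lineMeasure K a b).real univ))
    fun g => by
      rw [mul_assoc]
      refine Lp.norm_le_of_ae_bound (by positivity) ?_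
      filter_upwards [MemLp.coeFn_toLp (memLp_primitive_lineMeasure g)] with x hx
      simp only [LinearMap.coe_mk, AddHom.coe_mk]
      rw [hx]
      refine (norm_setIntegral_le_norm measurableSet_Iic g).trans ?_
      gcongr
      · exact measure_ne_top _ _
      · exact subset_univ _

theorem volterra_coeFn (g : L2Line K a b) :
    volterra K a b g =ᵐ[lineMeasure K a b] fun x => ∫ t in Iic x, g t ∂lineMeasure K a b :=
  MemLp.coeFn_toLp (memLp_primitive_lineMeasure g)

/-- The operator factors through the locally compact space `ℂ`. -/
theorem isCompactOperator_smulRight {H : Type*} [NormedAddCommGroup H] [NormedSpace ℂ H]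
    (f : H →L[ℂ] ℂ) (w : H) : IsCompactOperator (f.smulRight w) := by
  have h1 : IsCompactOperator f := isCompactOperator_of_locallyCompactSpace_dom f
  exact h1.continuous_comp (g := fun c : ℂ => c • w) (by fun_prop)

/-- The index is `⌈(x - x₀) / δ⌉₊ - 1`; cells open on the left and closed on the right match the
ceiling function. -/
theorem exists_unique_mem_Ioc_partition {x₀ δ x : ℝ} (hδ : 0 < δ) {N : ℕ} (h0 : x₀ < x)
    (h1 : x ≤ x₀ + N * δ) : ∃ i < N, x ∈ Ioc (x₀ + i * δ) (x₀ + (i + 1) * δ) ∧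
      ∀ j : ℕ, x ∈ Ioc (x₀ + j * δ) (x₀ + (j + 1) * δ) → j = i := by
  have hpos : 0 < ⌈(x - x₀) / δ⌉₊ := Nat.ceil_pos.2 (div_pos (by linarith) hδ)
  obtain ⟨i, hi⟩ : ∃ i, ⌈(x - x₀) / δ⌉₊ = i + 1 := ⟨_, (Nat.succ_pred_eq_of_pos hpos).symm⟩
  have key : ∀ j : ℕ, x ∈ Ioc (x₀ + j * δ) (x₀ + (j + 1) * δ) ↔ ⌈(x - x₀) / δ⌉₊ = j + 1 := by
    intro j
    rw [Nat.ceil_eq_iff (by simp), lt_div_iff₀ hδ, div_le_iff₀ hδ]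
    simp only [mem_Ioc, Nat.add_sub_cancel, Nat.cast_add, Nat.cast_one]
    constructor <;> rintro ⟨p, q⟩ <;> constructor <;> linarith
  refine ⟨i, ?_, (key i).2 hi, fun j hj => ?_⟩
  · have : ⌈(x - x₀) / δ⌉₊ ≤ N := by
      rw [Nat.ceil_le, div_le_iff₀ hδ]; linarith
    omega
  · have := (key j).1 hj
    omega

/-- The primitive is frozen at the left endpoint of each cell of a uniform partition. This gives
finite rank operators whose pointwise error is at most `√(M δ) ‖g‖`, so they converge in operator
norm. -/
theorem isCompactOperator_volterra (hab : -b < a) : IsCompactOperator (volterra K a b) := by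
  obtain ⟨M, hM, hb⟩ := exists_lineMeasure_real_Ioc_le K a b
  set μ := lineMeasure K a b with hμ
  -- There are `N + 1` cells, so the width is defined for `N = 0` as well.
  let δ : ℕ → ℝ := fun N => (a + b) / (N + 1)
  have hδ : ∀ N, 0 < δ N := fun N => div_pos (by linarith) (by positivity)
  let c : ℕ → ℕ → ℝ := fun N i => -b + i * δ N
  let F : ℕ → L2Line K a b →L[ℂ] L2Line K a b := fun N => ∑ i ∈ Finset.range (N + 1),
    (innerSL ℂ (indicatorConstLp 2 (measurableSet_Iic (a := c N i)) (measure_ne_top μ _)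
      (1 : ℂ))).smulRight
      (indicatorConstLp 2 (measurableSet_Ioc (a := -b + i * δ N) (b := -b + (i + 1) * δ N))
        (measure_ne_top μ _) (1 : ℂ))
  refine isCompactOperator_of_tendsto (F := F) (l := atTop) ?_ (Eventually.of_forall fun N => ?_)
  · let B : ℕ → ℝ := fun N => (measureUnivNNReal μ : ℝ) ^ (2 : ℝ≥0∞).toReal⁻¹ * √(M * δ N)
    have hB : Tendsto B atTop (𝓝 0) := by
      have h1 : Tendsto (fun N => M * δ N) atTop (𝓝 0) := by
        have := (tendsto_one_div_add_atTop_nhds_zero_nat (𝕜 := ℝ)).const_mul (M * (a + b))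
        simp only [mul_zero] at this
        refine this.congr fun N => ?_
        simp only [δ]; ring
      have h2 := (Real.continuous_sqrt.tendsto 0).comp h1
      simpa [B] using h2.const_mul ((measureUnivNNReal μ : ℝ) ^ (2 : ℝ≥0∞).toReal⁻¹)
    rw [tendsto_iff_norm_sub_tendsto_zero]
    refine squeeze_zero (fun _ => norm_nonneg _) (fun N => ?_) hB
    refine ContinuousLinearMap.opNorm_le_bound _ (by positivity) fun g => ?_
    rw [mul_assoc]
    refine Lp.norm_le_of_ae_bound (by positivity) ?_
    have hF : F N g = ∑ i ∈ Finset.range (N + 1), (∫ t in Iic (c N i), g t ∂μ) •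
        indicatorConstLp 2 (measurableSet_Ioc (a := -b + i * δ N) (b := -b + (i + 1) * δ N))
        (measure_ne_top μ _) (1 : ℂ) := by
      simp only [F, sum_apply, ContinuousLinearMap.smulRight_apply,
        innerSL_apply_apply, L2.inner_indicatorConstLp_one]
    have hae : ∀ᵐ x ∂μ, ∀ i : ℕ, (indicatorConstLp 2
        (measurableSet_Ioc (a := -b + i * δ N) (b := -b + (i + 1) * δ N))
        (measure_ne_top μ _) (1 : ℂ)) x
        = (Ioc (-b + i * δ N) (-b + (i + 1) * δ N)).indicator (fun _ => (1 : ℂ)) x :=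
      ae_all_iff.2 fun i => indicatorConstLp_coeFn
    have hsm : ∀ᵐ x ∂μ, ∀ i : ℕ, ((∫ t in Iic (c N i), g t ∂μ) • (indicatorConstLp 2
        (measurableSet_Ioc (a := -b + i * δ N) (b := -b + (i + 1) * δ N))
        (measure_ne_top μ _) (1 : ℂ)) : L2Line K a b) x
        = (∫ t in Iic (c N i), g t ∂μ) • (indicatorConstLp 2
        (measurableSet_Ioc (a := -b + i * δ N) (b := -b + (i + 1) * δ N))
        (measure_ne_top μ _) (1 : ℂ)) x :=
      ae_all_iff.2 fun i => Lp.coeFn_smul _ _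
    filter_upwards [Lp.coeFn_sub (F N g) (volterra K a b g), volterra_coeFn g,
      Lp.coeFn_finsetSum (Finset.range (N + 1)) (fun i : ℕ => (∫ t in Iic (c N i), g t ∂μ) •
        indicatorConstLp 2 (measurableSet_Ioc (a := -b + i * δ N) (b := -b + (i + 1) * δ N))
        (measure_ne_top μ _) (1 : ℂ)), hae, hsm, ae_mem_lineMeasure (K := K) (a := a) (b := b)]
      with x e1 e2 e3 e4 e5 hx
    have hN : a = -b + ((N + 1 : ℕ) : ℝ) * δ N := by
      simp only [δ]; push_cast; field_simp; ring
    obtain ⟨i, hi, hxi, huniq⟩ := exists_unique_mem_Ioc_partition (hδ N) hx.1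
      (hx.2.le.trans hN.le)
    rw [sub_apply, e1, Pi.sub_apply, e2, hF, e3, Finset.sum_apply,
      Finset.sum_eq_single i]
    · rw [e5, e4, indicator_of_mem hxi, norm_sub_rev, smul_eq_mul, mul_one]
      refine (norm_primitive_sub_le g hxi.1.le).trans ?_
      gcongr
      refine (hb _ _ hxi.1.le).trans ?_
      gcongr
      linarith [hxi.2]
    · intro j _ hj
      rw [e5, e4, indicator_of_notMem (fun h' => hj (huniq j h')), smul_zero]
    · intro h'
      exact absurd (Finset.mem_range.2 hi) h'
  · refine Finset.sum_induction _ (fun f : L2Line K a b →L[ℂ] L2Line K a b => IsCompactOperator f)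
      (fun f g hf hg => hf.add hg) isCompactOperator_zero fun i _ => ?_
    exact isCompactOperator_smulRight _ _

end


/-! ### The transversal operators: boundary values and symmetry -/

theorem isPrimitive_of_hasDerivAt_Icc {α β : ℝ} {u v : ℝ → ℂ} (hab : α ≤ β)
    (hd : ∀ x ∈ Icc α β, HasDerivAt u (v x) x) (hc : ContinuousOn v (Icc α β)) :
    IsPrimitive α β u v := by
  rw [← uIcc_of_le hab] at hc
  refine ⟨hc.intervalIntegrable, fun x hx => ?_⟩
  have hs : uIcc α x ⊆ Icc α β := by
    rw [uIcc_of_le hx.1]; exact Icc_subset_Icc_right hx.2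
  rw [intervalIntegral.integral_eq_sub_of_hasDerivAt (fun t ht => hd t (hs ht))
    (hc.mono (uIcc_of_le hab ▸ hs)).intervalIntegrable]
  ring

theorem IsPrimitive.congr_left {α β : ℝ} {u u' v : ℝ → ℂ} (hab : α ≤ β) (hu : IsPrimitive α β u v)
    (h : ∀ x ∈ Icc α β, u x = u' x) : IsPrimitive α β u' v :=
  ⟨hu.1, fun x hx => by rw [← h x hx, ← h α (left_mem_Icc.2 hab), hu.2 x hx]⟩

theorem isPrimitive_jac (K α β : ℝ) :
    IsPrimitive α β (fun x => (jac K x : ℂ)) (fun x => (deriv (jac K) x : ℝ)) :=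
  isPrimitive_ofReal_test (contDiff_jac K)

theorem IsAdmissible.isPrimitive_inv_jac {K a b : ℝ} (ad : IsAdmissible K a b) :
    IsPrimitive (-b) a (fun x => ((jac K x)⁻¹ : ℂ))
      (fun x => -(deriv (jac K) x : ℝ) / (jac K x : ℂ) ^ 2) := by
  have hne : ∀ x ∈ Icc (-b) a, (jac K x : ℂ) ≠ 0 := fun x hx =>
    Complex.ofReal_ne_zero.2 (ad.jac_pos hx).ne'
  refine isPrimitive_of_hasDerivAt_Icc ad.lt.le
    (fun x hx => ((hasDerivAt_jac K x).ofReal_comp).inv (hne x hx)) ?_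
  refine ContinuousOn.div ?_ ?_ fun x hx => pow_ne_zero 2 (hne x hx)
  · exact (Complex.continuous_ofReal.comp (continuous_deriv_jac K)).neg.continuousOn
  · exact ((Complex.continuous_ofReal.comp (continuous_jac K)).pow 2).continuousOn

theorem hasValueAt_of_continuousOn {α β x₀ : ℝ} {u U : ℝ → ℂ} (hab : α < β)
    (hU : ContinuousOn U (Icc α β)) (h : u =ᵐ[volume.restrict (Ioo α β)] U) :
    HasValueAt (Ioo α β) x₀ u (U x₀) :=
  ⟨U, by rwa [closure_Ioo hab.ne], h, rfl⟩

/-- Continuous functions that agree almost everywhere on the open interval agree on the closed one,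
so the boundary value does not depend on the representative. -/
theorem HasValueAt.eq_of_continuousOn {α β x₀ : ℝ} {u U : ℝ → ℂ} {z : ℂ} (hab : α < β)
    (hz : HasValueAt (Ioo α β) x₀ u z) (hx : x₀ ∈ Icc α β)
    (hU : ContinuousOn U (Icc α β)) (h : u =ᵐ[volume.restrict (Ioo α β)] U) : U x₀ = z := by
  obtain ⟨v, hv, h1, rfl⟩ := hz
  rw [closure_Ioo hab.ne] at hv
  have h2 : U =ᵐ[volume.restrict (Icc α β)] v := by
    rw [← restrict_Ioo_eq_restrict_Icc]
    exact h.symm.trans h1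
  exact Measure.eqOn_Icc_of_ae_eq volume hab.ne h2 hU hv hx

theorem ae_restrict_Ioo_of_sides {a b : ℝ} (ha : 0 < a) (hb : 0 < b) {p : ℝ → Prop}
    (hp : ∀ᵐ x ∂volume.restrict (Ioo 0 a), p x) (hm : ∀ᵐ x ∂volume.restrict (Ioo (-b) 0), p x) :
    ∀ᵐ x ∂volume.restrict (Ioo (-b) a), p x := by
  rw [restrict_split ha hb, ae_restrict_union_iff]
  exact ⟨hp, hm⟩

section

variable {K a b c εp εm : ℝ} {u u' u'' : ℝ → ℂ}

theorem coef_of_pos {x : ℝ} (hx : 0 < x) : coef εp εm x = εp := if_pos hx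

theorem coef_of_nonpos {x : ℝ} (hx : x ≤ 0) : coef εp εm x = -εm := if_neg (not_lt.2 hx)

theorem coef_ne_zero (hεp : 0 < εp) (hεm : 0 < εm) (x : ℝ) : coef εp εm x ≠ 0 := by
  unfold coef; split_ifs
  · exact hεp.ne'
  · exact (neg_lt_zero.2 hεm).ne

theorem measurable_coef : Measurable (coef εp εm) :=
  Measurable.ite measurableSet_Ioi measurable_const measurable_const

/-- Continuous representatives `U` of `u` and `W` of the flux `ε u'`, for `u` in the domain of the
transversal operators. -/
structure LineRep (a b εp εm : ℝ) (u u' u'' U W : ℝ → ℂ) : Prop where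
  primU : IsPrimitive (-b) a U u'
  primW : IsPrimitive (-b) a W (fun x => coef εp εm x * u'' x)
  aeU : u =ᵐ[volume.restrict (Ioo (-b) a)] U
  aeW : (fun x => coef εp εm x * u' x) =ᵐ[volume.restrict (Ioo (-b) a)] W
  left : U (-b) = 0
  right : U a = 0

/-- Absolute continuity glues as soon as the values match at `0`; the derivative may jump there, as
`u'` does. -/
theorem isPrimitive_ite {a b : ℝ} (ha : 0 < a) (hb : 0 < b) {U V v : ℝ → ℂ}
    (hU : IsPrimitive 0 a U v) (hV : IsPrimitive (-b) 0 V v) (h0 : U 0 = V 0) :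
    IsPrimitive (-b) a (fun x => if 0 < x then U x else V x) v := by
  have hb' : -b ≤ 0 := by linarith
  refine IsPrimitive.glue hb' ?_ ?_
  · refine hV.congr_left hb' fun x hx => ?_
    rw [if_neg (not_lt.2 hx.2)]
  · refine hU.congr_left ha.le fun x hx => ?_
    split_ifs with h
    · rfl
    · rw [le_antisymm (not_lt.1 h) hx.1, h0]

/-- Continuous representatives of `u` and `u'` on the two sides of the interface, for `u` in the
domain of the transversal operators. -/
structure LineSides (a b εp εm : ℝ) (u u' u'' Up Vp Um Vm : ℝ → ℂ) : Prop where
  primUp : IsPrimitive 0 a Up u'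
  primVp : IsPrimitive 0 a Vp u''
  primUm : IsPrimitive (-b) 0 Um u'
  primVm : IsPrimitive (-b) 0 Vm u''
  aeUp : u =ᵐ[volume.restrict (Ioo 0 a)] Up
  aeVp : u' =ᵐ[volume.restrict (Ioo 0 a)] Vp
  aeUm : u =ᵐ[volume.restrict (Ioo (-b) 0)] Um
  aeVm : u' =ᵐ[volume.restrict (Ioo (-b) 0)] Vm
  right : Up a = 0
  left : Um (-b) = 0
  continuity : Up 0 = Um 0
  flux : (εp : ℂ) * Vp 0 = -((εm : ℂ) * Vm 0)

theorem LineDomain.exists_lineSides (ha : 0 < a) (hb : 0 < b)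
    (D : LineDomain a b εp εm u u' u'') :
    ∃ Up Vp Um Vm, LineSides a b εp εm u u' u'' Up Vp Um Vm := by
  have hb' : -b < 0 := by linarith
  have h12 : (1 : ℝ≥0∞) ≤ 2 := by norm_num
  obtain ⟨Up, pUp, aUp⟩ := exists_isPrimitive_of_hasWeakDeriv ha (D.plus.memLp.integrable h12)
    (D.plus.memLp'.integrable h12) D.plus.deriv'
  obtain ⟨Um, pUm, aUm⟩ := exists_isPrimitive_of_hasWeakDeriv hb' (D.minus.memLp.integrable h12)
    (D.minus.memLp'.integrable h12) D.minus.deriv'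
  obtain ⟨Vp, pVp, aVp⟩ := exists_isPrimitive_of_hasWeakDeriv ha (D.plus.memLp'.integrable h12)
    (D.plus.memLp''.integrable h12) D.plus.deriv''
  obtain ⟨Vm, pVm, aVm⟩ := exists_isPrimitive_of_hasWeakDeriv hb' (D.minus.memLp'.integrable h12)
    (D.minus.memLp''.integrable h12) D.minus.deriv''
  have cUp := pUp.continuousOn ha.le
  have cUm := pUm.continuousOn hb'.le
  have cVp := pVp.continuousOn ha.le
  have cVm := pVm.continuousOn hb'.le
  obtain ⟨z, z1, z2⟩ := D.continuity
  obtain ⟨r, s, r1, s1, rs⟩ := D.flux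
  have e0p := z1.eq_of_continuousOn ha ⟨le_rfl, ha.le⟩ cUp aUp
  have e0m := z2.eq_of_continuousOn hb' ⟨hb'.le, le_rfl⟩ cUm aUm
  have f0p := r1.eq_of_continuousOn ha ⟨le_rfl, ha.le⟩ cVp aVp
  have f0m := s1.eq_of_continuousOn hb' ⟨hb'.le, le_rfl⟩ cVm aVm
  have ea := D.right.eq_of_continuousOn ha ⟨ha.le, le_rfl⟩ cUp aUp
  have eb := D.left.eq_of_continuousOn hb' ⟨le_rfl, hb'.le⟩ cUm aUm
  exact ⟨Up, Vp, Um, Vm, pUp, pVp, pUm, pVm, aUp, aVp, aUm, aVm, ea, eb, by rw [e0p, e0m],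
    by rw [f0p, f0m, rs]⟩

/-- Since `coef` equals `-ε₋` on the left, the flux condition is the matching at `0` of the two
one-sided values of `ε u'`. Hence both `u` and `ε u'` have absolutely continuous representatives
across the interface. -/
theorem LineDomain.exists_lineRep (ha : 0 < a) (hb : 0 < b)
    (D : LineDomain a b εp εm u u' u'') : ∃ U W, LineRep a b εp εm u u' u'' U W := by
  have hb' : -b < 0 := by linarith
  obtain ⟨Up, Vp, Um, Vm, S⟩ := D.exists_lineSides ha hb
  have mp := ae_restrict_mem (μ := (volume : Measure ℝ)) (measurableSet_Ioo (a := 0) (b := a))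
  have mm := ae_restrict_mem (μ := (volume : Measure ℝ)) (measurableSet_Ioo (a := -b) (b := 0))
  refine ⟨fun x => if 0 < x then Up x else Um x,
    fun x => if 0 < x then (εp : ℂ) * Vp x else (-εm : ℂ) * Vm x,
    isPrimitive_ite ha hb S.primUp S.primUm S.continuity, ?_, ?_, ?_, ?_, ?_⟩
  · refine isPrimitive_ite ha hb ((S.primVp.const_mul εp).congr_right ha.le ?_)
      ((S.primVm.const_mul (-εm)).congr_right hb'.le ?_) ?_
    · filter_upwards [mp] with x hx
      rw [coef_of_pos hx.1]
    · filter_upwards [mm] with x hx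
      rw [coef_of_nonpos hx.2.le]; push_cast; rfl
    · rw [S.flux]; ring
  · refine ae_restrict_Ioo_of_sides ha hb ?_ ?_
    · filter_upwards [mp, S.aeUp] with x hx h
      rw [if_pos hx.1, h]
    · filter_upwards [mm, S.aeUm] with x hx h
      rw [if_neg (not_lt.2 hx.2.le), h]
  · refine ae_restrict_Ioo_of_sides ha hb ?_ ?_
    · filter_upwards [mp, S.aeVp] with x hx h
      rw [if_pos hx.1, h, coef_of_pos hx.1]
    · filter_upwards [mm, S.aeVm] with x hx h
      rw [if_neg (not_lt.2 hx.2.le), h, coef_of_nonpos hx.2.le]; push_cast; rfl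
  · simpa [not_lt.2 hb'.le] using S.left
  · simpa [ha] using S.right

/-- Conversely, when `U` and its flux `W` are absolutely continuous across `0`, both interface
conditions hold automatically. -/
theorem lineDomain_of_isPrimitive (hεp : 0 < εp) (hεm : 0 < εm) (ha : 0 < a) (hb : 0 < b)
    {U W w : ℝ → ℂ} (hU : IsPrimitive (-b) a U (fun x => W x / coef εp εm x))
    (hW : IsPrimitive (-b) a W w) (mw : MemLp w 2 (volume.restrict (Ioo (-b) a)))
    (hl : U (-b) = 0) (hr : U a = 0) :
    LineDomain a b εp εm U (fun x => W x / coef εp εm x) (fun x => w x / coef εp εm x) := by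
  have hb' : -b < 0 := by linarith
  have hp : (εp : ℂ) ≠ 0 := Complex.ofReal_ne_zero.2 hεp.ne'
  have hm : (-εm : ℂ) ≠ 0 := neg_ne_zero.2 (Complex.ofReal_ne_zero.2 hεm.ne')
  -- On one side of the interface `ε` is a constant `z`, so division by it commutes with weak
  -- differentiation.
  have side : ∀ {α β : ℝ} {z : ℂ}, α < β → -b ≤ α → β ≤ a →
      (∀ x ∈ Ioo α β, (coef εp εm x : ℂ) = z) →
      IsH2Line (Ioo α β) U (fun x => W x / coef εp εm x) (fun x => w x / coef εp εm x) ∧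
      ContinuousOn U (Icc α β) ∧ ContinuousOn (fun x => W x / z) (Icc α β) ∧
      (fun x => W x / coef εp εm x) =ᵐ[volume.restrict (Ioo α β)] fun x => W x / z := by
    intro α β z hab h1 h2 hz
    have hz' : ∀ f : ℝ → ℂ, (fun x => z⁻¹ * f x) =ᵐ[volume.restrict (Ioo α β)]
        fun x => f x / coef εp εm x := fun f => by
      filter_upwards [ae_restrict_mem measurableSet_Ioo] with x hx
      rw [hz x hx, div_eq_inv_mul]
    have qU := hU.mono h1 hab.le h2
    have qW := (hW.mono h1 hab.le h2).const_mul z⁻¹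
    have cU := qU.continuousOn hab.le
    have cW := qW.continuousOn hab.le
    have mC : ∀ f : ℝ → ℂ, ContinuousOn f (Icc α β) → MemLp f 2 (volume.restrict (Ioo α β)) :=
      fun f hf => by
        obtain ⟨C, hC⟩ := isCompact_Icc.exists_bound_of_continuousOn hf
        refine MemLp.of_bound ((hf.mono Ioo_subset_Icc_self).aestronglyMeasurable
          measurableSet_Ioo) C ?_
        filter_upwards [ae_restrict_mem measurableSet_Ioo] with x hx
        exact hC x (Ioo_subset_Icc_self hx)
    refine ⟨⟨mC U cU, (mC _ cW).ae_eq (hz' W), ?_, qU.hasWeakDeriv hab.le, ?_⟩, cU, ?_, ?_⟩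
    · exact ((mw.mono_measure (Measure.restrict_mono (Ioo_subset_Ioo h1 h2) le_rfl)).const_mul
        z⁻¹).ae_eq (hz' w)
    · intro φ p1 p2 p3
      have := qW.hasWeakDeriv hab.le φ p1 p2 p3
      rw [integral_congr_ae (g := fun x => fderiv ℝ φ x 1 • (z⁻¹ * W x)),
        integral_congr_ae (f := fun x => φ x • (w x / coef εp εm x))
          (g := fun x => φ x • (z⁻¹ * w x)), this]
      · filter_upwards [hz' w] with x hx; rw [hx]
      · filter_upwards [hz' W] with x hx; rw [hx]
    · simpa only [div_eq_inv_mul] using cW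
    · filter_upwards [hz' W] with x hx
      rw [← hx, div_eq_inv_mul]
  obtain ⟨p1, p2, p3, p4⟩ := side (z := εp) ha hb'.le le_rfl
    (fun x hx => by rw [coef_of_pos hx.1])
  obtain ⟨m1, m2, m3, m4⟩ := side (z := -εm) hb' le_rfl ha.le
    (fun x hx => by rw [coef_of_nonpos hx.2.le]; push_cast; rfl)
  refine ⟨p1, m1, hr ▸ hasValueAt_of_continuousOn ha p2 EventuallyEq.rfl,
    hl ▸ hasValueAt_of_continuousOn hb' m2 EventuallyEq.rfl,
    ⟨U 0, hasValueAt_of_continuousOn ha p2 EventuallyEq.rfl,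
      hasValueAt_of_continuousOn hb' m2 EventuallyEq.rfl⟩,
    ⟨_, _, hasValueAt_of_continuousOn ha p3 p4, hasValueAt_of_continuousOn hb' m3 m4, ?_⟩⟩
  have hm' : (εm : ℂ) ≠ 0 := Complex.ofReal_ne_zero.2 hεm.ne'
  field_simp

/-- Integrability of `F` is not required: if `F` is not integrable, neither is the sum, and both
integrals take the default value zero. -/
theorem integral_add_eq_of_integral_eq_zero {X : Type*} [MeasurableSpace X] {μ : Measure X}
    {F D : X → ℂ} (hD : Integrable D μ) (h0 : ∫ x, D x ∂μ = 0) :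
    ∫ x, (F x + D x) ∂μ = ∫ x, F x ∂μ := by
  by_cases hF : Integrable F μ
  · rw [integral_add hF hD, h0, add_zero]
  · rw [integral_undef hF, integral_undef]
    intro h
    refine hF ((h.sub hD).congr (Eventually.of_forall fun x => ?_))
    simp

/-- The integrand of the quadratic form of the transversal operator. -/
def lineForm (K c εp εm : ℝ) (n : ℕ) (U u' V v' : ℝ → ℂ) (x : ℝ) : ℂ :=
  (coef εp εm x : ℂ) * ((jac K x : ℂ) * (starRingEnd ℂ (u' x) * v' x)
    + (((n * Real.pi / c) ^ 2 / jac K x : ℝ) : ℂ) * (starRingEnd ℂ (U x) * V x))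

/-- Multiplied by `f`, the leading part of the expression is `-(f W)'`, with `W` the continuous
flux. The product of `f` times the conjugate of `W` with `V` is thus a primitive on the whole
interval and vanishes at both ends, so no interface term arises. -/
theorem LineRep.integral_conj_mul (ad : IsAdmissible K a b) {n : ℕ} {U W V v' : ℝ → ℂ}
    (R : LineRep a b εp εm u u' u'' U W) (hV : IsPrimitive (-b) a V v') (hl : V (-b) = 0)
    (hr : V a = 0) :
    ∫ x in Ioo (-b) a, (jac K x : ℂ) *
        (starRingEnd ℂ (coef εp εm x * lineExpr K c n u u' u'' x) * V x)
      = ∫ x in Ioo (-b) a, lineForm K c εp εm n U u' V v' x := by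
  have hP := ((isPrimitive_jac K (-b) a).mul ad.lt.le R.primW).star
  have key := hP.integral_mul_add_mul ad.lt.le hV
  have hint := (hP.mul ad.lt.le hV).1
  rw [hl, hr, mul_zero, mul_zero, sub_zero, ← setIntegral_Ioo_eq_intervalIntegral ad.lt.le] at key
  rw [intervalIntegrable_iff_integrableOn_Ioo_of_le ad.lt.le] at hint
  conv_rhs => rw [← integral_add_eq_of_integral_eq_zero hint.neg
    (by simp only [Pi.neg_apply, integral_neg, key, neg_zero])]
  refine integral_congr_ae ?_
  filter_upwards [R.aeU, R.aeW, ae_restrict_mem measurableSet_Ioo] with x hU hW hx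
  have hj : (jac K x : ℂ) ≠ 0 := Complex.ofReal_ne_zero.2 (ad.jac_pos (Ioo_subset_Icc_self hx)).ne'
  simp only [lineForm, lineExpr, ← hU, ← hW, Pi.neg_apply, map_mul, map_add, map_sub, map_neg,
    Complex.conj_ofReal]
  push_cast
  field_simp
  ring

/-- Both pairings are expressed by the same sesquilinear form with exchanged arguments. The form is
indefinite, but it is Hermitian because `ε` and `f` are real, and symmetry needs nothing more. -/
theorem lineGraph_inner (ad : IsAdmissible K a b) {n : ℕ} {p q : L2Line K a b × L2Line K a b}
    (hp : p ∈ lineGraph K a b c εp εm n) (hq : q ∈ lineGraph K a b c εp εm n) :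
    ∃ U u' V v' : ℝ → ℂ, inner ℂ p.2 q.1 = ∫ x in Ioo (-b) a, lineForm K c εp εm n U u' V v' x ∧
      inner ℂ q.2 p.1 = ∫ x in Ioo (-b) a, lineForm K c εp εm n V v' U u' x := by
  obtain ⟨u, u', u'', D, hu, hu'⟩ := hp
  obtain ⟨v, v', v'', D', hv, hv'⟩ := hq
  obtain ⟨U, W, R⟩ := D.exists_lineRep ad.a_pos ad.b_pos
  obtain ⟨V, W', R'⟩ := D'.exists_lineRep ad.a_pos ad.b_pos
  have hu := ad.ae_of_ae_lineMeasure hu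
  have hu' := ad.ae_of_ae_lineMeasure hu'
  have hv := ad.ae_of_ae_lineMeasure hv
  have hv' := ad.ae_of_ae_lineMeasure hv'
  refine ⟨U, u', V, v', ?_, ?_⟩
  · rw [← R.integral_conj_mul ad R'.primU R'.left R'.right, L2.inner_def, ad.integral_lineMeasure]
    refine integral_congr_ae ?_
    filter_upwards [hu', hv, R'.aeU] with x h1 h2 h3
    rw [RCLike.inner_apply, h1, h2, h3]
    ring
  · rw [← R'.integral_conj_mul ad R.primU R.left R.right, L2.inner_def, ad.integral_lineMeasure]
    refine integral_congr_ae ?_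
    filter_upwards [hv', hu, R.aeU] with x h1 h2 h3
    rw [RCLike.inner_apply, h1, h2, h3]
    ring

theorem lineA_isFormalAdjoint (ad : IsAdmissible K a b) (n : ℕ) :
    (lineA K a b c εp εm n).IsFormalAdjoint (lineA K a b c εp εm n) := by
  intro x y
  have hg := lineA_graph (c := c) (εp := εp) (εm := εm) n ad.a_pos ad.b_pos ad.curv
  obtain ⟨U, u', V, v', e1, e2⟩ := lineGraph_inner ad
    (hg ▸ (lineA K a b c εp εm n).mem_graph x) (hg ▸ (lineA K a b c εp εm n).mem_graph y)
  simp only at e1 e2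
  rw [e1, ← inner_conj_symm, e2, ← integral_conj]
  congr 1
  funext t
  simp only [lineForm, map_mul, map_add, Complex.conj_ofReal, Complex.conj_conj]
  ring

end


/-! ### A compact parametrix for the transversal operators -/

section

variable {K a b c εp εm : ℝ}

theorem measurable_ofReal_coef : Measurable fun x => (coef εp εm x : ℂ) :=
  Complex.measurable_ofReal.comp measurable_coef

theorem abs_coef_bounds (hεp : 0 < εp) (hεm : 0 < εm) (x : ℝ) :
    min εp εm ≤ |coef εp εm x| ∧ |coef εp εm x| ≤ max εp εm := by
  unfold coef
  split_ifs
  · rw [abs_of_pos hεp]; exact ⟨min_le_left _ _, le_max_left _ _⟩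
  · rw [abs_neg, abs_of_pos hεm]; exact ⟨min_le_right _ _, le_max_right _ _⟩

/-- The reciprocal `1 / (ε f²)` of the leading coefficient. -/
def invLead (K εp εm x : ℝ) : ℝ := (coef εp εm x * jac K x ^ 2)⁻¹

theorem measurable_invLead : Measurable fun x => (invLead K εp εm x : ℂ) :=
  Complex.measurable_ofReal.comp (measurable_coef.mul ((measurable_jac K).pow_const 2)).inv

theorem IsAdmissible.exists_invLead_bound (ad : IsAdmissible K a b) (hεp : 0 < εp) (hεm : 0 < εm) :
    ∃ C, ∀ x ∈ Icc (-b) a, ‖(invLead K εp εm x : ℂ)‖ ≤ C := by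
  obtain ⟨m, M, hm, hM, hb⟩ := ad.exists_bounds
  have h0 : 0 < min εp εm := lt_min hεp hεm
  refine ⟨(min εp εm * m ^ 2)⁻¹, fun x hx => ?_⟩
  rw [Complex.norm_real, Real.norm_eq_abs, invLead, abs_inv, abs_mul,
    abs_of_nonneg (sq_nonneg (jac K x))]
  have h1 := (abs_coef_bounds hεp hεm x).1
  have h2 := (hb x hx).1
  gcongr

/-- If both `s = 0` and `s = 1` failed, the integrals of `1 / (ε f)` and `x / (ε f)` over the
interval would vanish. The second is positive, since `ε` changes sign exactly where `x` does. This
is what makes every contrast admissible. -/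
theorem exists_slope_integral_ne_zero (ad : IsAdmissible K a b) (hεp : 0 < εp) (hεm : 0 < εm) :
    ∃ s : ℝ, ∫ x, (invLead K εp εm x : ℂ) * (1 + s * (x + b)) ∂lineMeasure K a b ≠ 0 := by
  obtain ⟨C, hC⟩ := ad.exists_invLead_bound hεp hεm
  have hC' : ∀ᵐ x ∂lineMeasure K a b, ‖(invLead K εp εm x : ℂ)‖ ≤ C :=
    ae_mem_lineMeasure.mono fun x hx => hC x (Ioo_subset_Icc_self hx)
  have i1 : Integrable (fun x => invLead K εp εm x) (lineMeasure K a b) := by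
    refine Integrable.of_bound (measurable_coef.mul
      ((measurable_jac K).pow_const 2)).inv.aestronglyMeasurable C ?_
    filter_upwards [hC'] with x hx
    simpa using hx
  have i2 : Integrable (fun x => invLead K εp εm x * x) (lineMeasure K a b) := by
    refine i1.mul_bdd (c := max a b) measurable_id.aestronglyMeasurable ?_
    filter_upwards [ae_mem_lineMeasure] with x hx
    rw [Real.norm_eq_abs, abs_le]
    exact ⟨by linarith [hx.1, le_max_right a b], hx.2.le.trans (le_max_left a b)⟩
  have hpos : 0 < ∫ x, invLead K εp εm x * x ∂lineMeasure K a b := by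
    have key : ∀ x ∈ Ioo (-b) a, x ≠ 0 → 0 < invLead K εp εm x * x := fun x hx h0 => by
      have hj := ad.jac_pos (Ioo_subset_Icc_self hx)
      rcases lt_or_gt_of_ne h0 with h | h
      · refine mul_pos_of_neg_of_neg (inv_lt_zero.2 ?_) h
        rw [coef_of_nonpos h.le]
        have := mul_pos hεm (pow_pos hj 2)
        linarith
      · rw [invLead, coef_of_pos h]
        positivity
    rw [integral_pos_iff_support_of_nonneg_ae _ i2]
    · have hs : Ioo 0 a ⊆ Function.support fun x => invLead K εp εm x * x := fun x hx =>
        (key x ⟨by linarith [ad.b_pos, hx.1], hx.2⟩ hx.1.ne').ne'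
      refine lt_of_lt_of_le ?_ (measure_mono hs)
      rw [pos_iff_ne_zero]
      intro h0
      have h1 := volume_ac_lineMeasure ad.curv h0
      rw [Measure.restrict_apply measurableSet_Ioo, inter_eq_left.2
        (Ioo_subset_Ioo_left (by linarith [ad.b_pos]))] at h1
      simp [not_le.2 ad.a_pos] at h1
    · filter_upwards [ae_mem_lineMeasure] with x hx
      rcases eq_or_ne x 0 with rfl | h0
      · simp
      · exact (key x hx h0).le
  by_contra! h
  have h0 := h 0
  have h1 := h 1
  have e : ∀ s : ℝ, ∫ x, (invLead K εp εm x : ℂ) * (1 + s * (x + b)) ∂lineMeasure K a b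
      = (((1 + s * b) * ∫ x, invLead K εp εm x ∂lineMeasure K a b)
        + s * ∫ x, invLead K εp εm x * x ∂lineMeasure K a b : ℝ) := fun s => by
    rw [← integral_const_mul, ← integral_const_mul, ← integral_add (i1.const_mul _)
      (i2.const_mul _), ← integral_complex_ofReal]
    congr 1
    funext x
    push_cast
    ring
  rw [e, Complex.ofReal_eq_zero] at h0 h1
  have h2 : ∫ x, invLead K εp εm x ∂lineMeasure K a b = 0 := by linarith
  rw [h2] at h1
  linarith

/-- The function `θ(x) = 1 + s (x + b)`. -/
def affineWeight (b s x : ℝ) : ℂ := 1 + s * (x + b)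

theorem continuous_affineWeight (b s : ℝ) : Continuous (affineWeight b s) := by
  unfold affineWeight; fun_prop

theorem memLp_of_continuousOn_Icc {α β : ℝ} {p : ℝ≥0∞} {f : ℝ → ℂ}
    (hf : ContinuousOn f (Icc α β)) : MemLp f p (volume.restrict (Ioo α β)) := by
  obtain ⟨C, hC⟩ := isCompact_Icc.exists_bound_of_continuousOn hf
  refine MemLp.of_bound ((hf.mono Ioo_subset_Icc_self).aestronglyMeasurable
    measurableSet_Ioo) C ?_
  filter_upwards [ae_restrict_mem measurableSet_Ioo] with x hx
  exact hC x (Ioo_subset_Icc_self hx)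

theorem continuousOn_inv_jac (ad : IsAdmissible K a b) :
    ContinuousOn (fun x => ((jac K x : ℂ))⁻¹) (Icc (-b) a) :=
  ad.isPrimitive_inv_jac.continuousOn ad.lt.le

/-- Solution of the transversal equation without potential, up to a correction along
`(1 + s (x + b))'`. -/
theorem lineDomain_parametrix (ad : IsAdmissible K a b) (hεp : 0 < εp) (hεm : 0 < εm) (n : ℕ)
    (g : L2Line K a b) (z : ℂ) (s : ℝ) {G U : ℝ → ℂ}
    (hG : G = fun x => ∫ t in (-b)..x, (jac K t : ℂ) * g t)
    (hU : U = fun x => ∫ t in (-b)..x,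
      (affineWeight b s t * z - G t) / (jac K t) / coef εp εm t)
    (h0 : U a = 0) :
    IsPrimitive (-b) a (fun x => affineWeight b s x * z - G x)
      (fun x => s * z - (jac K x : ℂ) * g x) ∧
    MemLp (fun x => s * z - (jac K x : ℂ) * g x) 2 (volume.restrict (Ioo (-b) a)) ∧
    IsPrimitive (-b) a U (fun t => (affineWeight b s t * z - G t) / (jac K t) / coef εp εm t) ∧
    MemLp (fun t => (affineWeight b s t * z - G t) / (jac K t) / coef εp εm t) 2
      (volume.restrict (Ioo (-b) a)) ∧
    ∃ u' u'' : ℝ → ℂ, LineDomain a b εp εm U u' u'' ∧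
      ∀ x ∈ Ioo (-b) a, (coef εp εm x : ℂ) * lineExpr K c n U u' u'' x =
        g x - z * (s / jac K x)
          + (coef εp εm x * ((n * Real.pi / c) ^ 2 / jac K x ^ 2) : ℝ) * U x := by
  have hab := ad.lt.le
  have mg := ad.memLp_line_iff.1 (Lp.memLp g)
  have mjg : MemLp (fun t => (jac K t : ℂ) * g t) 2 (volume.restrict (Ioo (-b) a)) := by
    obtain ⟨m, M, _, _, hb⟩ := ad.exists_bounds
    refine memLp_bdd_mul (C := M) mg
      (Complex.continuous_ofReal.comp (continuous_jac K)).aestronglyMeasurable ?_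
    filter_upwards [ae_restrict_mem measurableSet_Ioo] with x hx
    have hx := Ioo_subset_Icc_self hx
    simpa [abs_of_pos (ad.jac_pos hx)] using (hb x hx).2
  have pG : IsPrimitive (-b) a G (fun t => (jac K t : ℂ) * g t) :=
    hG ▸ isPrimitive_integral (intervalIntegrable_of_memLp (by norm_num) hab mjg)
  have pθ : IsPrimitive (-b) a (fun x => affineWeight b s x * z) (fun _ => s * z) := by
    refine isPrimitive_of_hasDerivAt (fun x => ?_) continuous_const
    unfold affineWeight
    have h1 : HasDerivAt (fun x : ℝ => (x : ℂ)) 1 x := (hasDerivAt_id x).ofReal_comp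
    simpa using (((h1.add_const (b : ℂ)).const_mul (s : ℂ)).const_add 1).mul_const z
  have pH : IsPrimitive (-b) a (fun x => affineWeight b s x * z - G x)
      (fun x => s * z - (jac K x : ℂ) * g x) := by
    refine ⟨pθ.1.sub pG.1, fun x hx => ?_⟩
    rw [intervalIntegral.integral_sub (pθ.mono le_rfl hx.1 hx.2).1
      (pG.mono le_rfl hx.1 hx.2).1, pθ.2 x hx, pG.2 x hx]
    ring
  -- The flux is `W = (θ z - G) / f` with `θ = 1 + s (x + b)`. Then `-(f W)' = f g - s z`, which is
  -- the equation without potential up to the term `s z / f`.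
  have pW := pH.mul hab ad.isPrimitive_inv_jac
  have cW := pW.continuousOn hab
  have cH := pH.continuousOn hab
  have cI := continuousOn_inv_jac ad
  have mw : MemLp (fun t => (affineWeight b s t * z - G t) *
      (-(deriv (jac K) t : ℝ) / (jac K t : ℂ) ^ 2)
      + (s * z - (jac K t : ℂ) * g t) * ((jac K t : ℂ))⁻¹) 2 (volume.restrict (Ioo (-b) a)) := by
    refine MemLp.add (memLp_of_continuousOn_Icc ?_) ?_
    · refine cH.mul ?_
      have : ContinuousOn (fun x => -((deriv (jac K) x : ℝ) : ℂ) * (((jac K x : ℂ))⁻¹) ^ 2)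
          (Icc (-b) a) :=
        (Complex.continuous_ofReal.comp (continuous_deriv_jac K)).neg.continuousOn.mul (cI.pow 2)
      refine this.congr fun x _ => ?_
      simp [div_eq_mul_inv]
    · obtain ⟨C, hC⟩ := isCompact_Icc.exists_bound_of_continuousOn cI
      have h1 : MemLp (fun t => s * z - (jac K t : ℂ) * g t) 2 (volume.restrict (Ioo (-b) a)) :=
        (memLp_const _).sub mjg
      have h2 := memLp_bdd_mul (C := C) h1
        ((cI.mono Ioo_subset_Icc_self).aestronglyMeasurable measurableSet_Ioo)
        ((ae_restrict_mem measurableSet_Ioo).mono fun x hx => hC x (Ioo_subset_Icc_self hx))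
      simpa only [mul_comm] using h2
  have mU : MemLp (fun t => (affineWeight b s t * z - G t) / (jac K t)
      / coef εp εm t) 2 (volume.restrict (Ioo (-b) a)) := by
    have h3 := memLp_bdd_mul (q := fun t => ((coef εp εm t : ℂ))⁻¹) (C := (min εp εm)⁻¹)
      (memLp_of_continuousOn_Icc (p := 2) cW) measurable_ofReal_coef.inv.aestronglyMeasurable
      (Eventually.of_forall fun x => by
        rw [norm_inv, Complex.norm_real, Real.norm_eq_abs]
        exact inv_anti₀ (lt_min hεp hεm) (abs_coef_bounds hεp hεm x).1)
    refine h3.ae_eq (Eventually.of_forall fun x => ?_)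
    simp only [div_eq_mul_inv]
    ring
  have pU : IsPrimitive (-b) a U (fun t => (affineWeight b s t * z - G t) / (jac K t)
      / coef εp εm t) :=
    hU ▸ isPrimitive_integral (intervalIntegrable_of_memLp (by norm_num) hab mU)
  have D := lineDomain_of_isPrimitive hεp hεm ad.a_pos ad.b_pos
    (U := U) (by simpa only [div_eq_mul_inv] using pU) pW mw (by simp [hU]) h0
  refine ⟨pH, (memLp_const _).sub mjg, pU, mU, _, _, D, fun x hx => ?_⟩
  have hj : (jac K x : ℂ) ≠ 0 := Complex.ofReal_ne_zero.2 (ad.jac_pos (Ioo_subset_Icc_self hx)).ne'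
  have hc : (coef εp εm x : ℂ) ≠ 0 := Complex.ofReal_ne_zero.2 (coef_ne_zero hεp hεm x)
  simp only [lineExpr]
  push_cast
  field_simp
  ring

/-- `T` solves the equation without potential by two integrations, the scalar `z` being tuned so
that the solution vanishes at `a`. The error `S` is the bounded potential applied to the compact
`T`, minus the rank one term `z s / f`. Injectivity of `T` follows by differentiating twice. -/
theorem exists_parametrix (ad : IsAdmissible K a b) (hεp : 0 < εp) (hεm : 0 < εm) (n : ℕ) :
    ∃ T S : L2Line K a b →L[ℂ] L2Line K a b, IsCompactOperator T ∧ IsCompactOperator S ∧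
      Function.Injective T ∧ ∀ g, (T g, g + S g) ∈ lineGraph K a b c εp εm n := by
  have hab := ad.lt.le
  set μ := lineMeasure K a b with hμ
  obtain ⟨s, hs⟩ := exists_slope_integral_ne_zero ad hεp hεm
  obtain ⟨C, hC⟩ := ad.exists_invLead_bound hεp hεm
  have hC' : ∀ᵐ x ∂μ, ‖(invLead K εp εm x : ℂ)‖ ≤ C :=
    ae_mem_lineMeasure.mono fun x hx => hC x (Ioo_subset_Icc_self hx)
  have mθ : MemLp (affineWeight b s) 2 μ :=
    ad.memLp_line_iff.2 (memLp_of_continuousOn_Icc (continuous_affineWeight b s).continuousOn)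
  have mσ : MemLp (fun x => (s / jac K x : ℂ)) 2 μ := by
    refine ad.memLp_line_iff.2 (memLp_of_continuousOn_Icc ?_)
    have : ContinuousOn (fun x => (s : ℂ) * ((jac K x : ℂ))⁻¹) (Icc (-b) a) :=
      continuousOn_const.mul (continuousOn_inv_jac ad)
    simpa only [div_eq_mul_inv] using this
  obtain ⟨Cq, hCq⟩ : ∃ Cq, ∀ᵐ x ∂μ,
      ‖((coef εp εm x * ((n * Real.pi / c) ^ 2 / jac K x ^ 2) : ℝ) : ℂ)‖ ≤ Cq := by
    obtain ⟨m, M, hm, hM, hb⟩ := ad.exists_bounds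
    refine ⟨max εp εm * ((n * Real.pi / c) ^ 2 / m ^ 2), ae_mem_lineMeasure.mono fun x hx => ?_⟩
    have hx := Ioo_subset_Icc_self hx
    rw [Complex.norm_real, Real.norm_eq_abs, abs_mul, abs_of_nonneg (by positivity : 0 ≤
      (n * Real.pi / c) ^ 2 / jac K x ^ 2)]
    have h1 := (abs_coef_bounds hεp hεm x).2
    have h2 := (hb x hx).1
    gcongr
  let ρ : L2Line K a b →L[ℂ] L2Line K a b :=
    mulOp (fun x => (invLead K εp εm x : ℂ)) measurable_invLead.aestronglyMeasurable C hC'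
  let Q : L2Line K a b →L[ℂ] L2Line K a b :=
    mulOp (fun x => ((coef εp εm x * ((n * Real.pi / c) ^ 2 / jac K x ^ 2) : ℝ) : ℂ))
      (Complex.measurable_ofReal.comp (measurable_coef.mul (measurable_const.div
        ((measurable_jac K).pow_const 2)))).aestronglyMeasurable Cq hCq
  let J : L2Line K a b →L[ℂ] L2Line K a b := volterra K a b
  -- `tot` is the factor of `z` in the boundary value at `a`. It is non-zero by the choice of `s`,
  -- so `Z` can be defined by dividing by it.
  let tot : ℂ := ∫ x, (invLead K εp εm x : ℂ) * (1 + s * (x + b)) ∂μ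
  let Z : L2Line K a b →L[ℂ] ℂ := tot⁻¹ •
    ((innerSL ℂ (indicatorConstLp 2 MeasurableSet.univ (measure_ne_top μ univ) (1 : ℂ))) ∘L ρ ∘L J)
  let T : L2Line K a b →L[ℂ] L2Line K a b := J ∘L (ρ ∘L (Z.smulRight (mθ.toLp _) - J))
  let S : L2Line K a b →L[ℂ] L2Line K a b := Q ∘L T - Z.smulRight (mσ.toLp _)
  have hJ : IsCompactOperator J := isCompactOperator_volterra ad.lt
  have hT : IsCompactOperator T := hJ.comp_clm _
  have hS : IsCompactOperator S := (hT.clm_comp Q).sub (isCompactOperator_smulRight _ _)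
  have hZ : ∀ g, Z g * tot = ∫ x, (invLead K εp εm x : ℂ) * J g x ∂μ := fun g => by
    have e1 : Z g = tot⁻¹ * ∫ x, ρ (J g) x ∂μ := by
      have := L2.inner_indicatorConstLp_one (𝕜 := ℂ) MeasurableSet.univ (measure_ne_top μ univ)
        (ρ (J g))
      rw [Measure.restrict_univ] at this
      rw [← this]
      rfl
    have e2 : ∫ x, ρ (J g) x ∂μ = ∫ x, (invLead K εp εm x : ℂ) * J g x ∂μ :=
      integral_congr_ae (mulOp_coeFn (J g))
    have ht : tot ≠ 0 := hs
    rw [e1, e2]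
    field_simp
  have hinner : ∀ g, (ρ (Z.smulRight (mθ.toLp _) g - J g)) =ᵐ[μ]
      fun x => (invLead K εp εm x : ℂ) * (affineWeight b s x * Z g - J g x) := fun g => by
    filter_upwards [mulOp_coeFn (hq := measurable_invLead.aestronglyMeasurable) (hC := hC')
      (Z.smulRight (mθ.toLp _) g - J g), Lp.coeFn_sub (Z.smulRight (mθ.toLp _) g) (J g),
      Lp.coeFn_smul (Z g) (mθ.toLp _), mθ.coeFn_toLp] with x h1 h2 h3 h4
    have h5 : (Z.smulRight (mθ.toLp _) g) x = Z g * affineWeight b s x := by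
      rw [← h4]; exact h3
    rw [h1, h2, Pi.sub_apply, h5]
    ring
  have hJg : ∀ g : L2Line K a b, ∀ᵐ x ∂μ, J g x = ∫ t in (-b)..x, (jac K t : ℂ) * g t := fun g => by
    filter_upwards [volterra_coeFn g, ae_mem_lineMeasure] with x h1 hx
    rw [h1, ad.setIntegral_Iic_lineMeasure _ (Ioo_subset_Icc_self hx)]
  have main : ∀ g : L2Line K a b, ∃ G U : ℝ → ℂ,
      (G = fun x => ∫ t in (-b)..x, (jac K t : ℂ) * g t) ∧
      (U = fun x => ∫ t in (-b)..x,
        (affineWeight b s t * Z g - G t) / (jac K t) / coef εp εm t) ∧ U a = 0 ∧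
      T g =ᵐ[μ] U := fun g => by
    refine ⟨_, _, rfl, rfl, ?_⟩
    have hint : ∀ x ∈ Icc (-b) a, ∫ t in Iic x, ρ (Z.smulRight (mθ.toLp _) g - J g) t ∂μ
        = ∫ t in (-b)..x, (affineWeight b s t * Z g - ∫ r in (-b)..t, (jac K r : ℂ) * g r)
          / (jac K t) / coef εp εm t := fun x hx => by
      refine (ad.setIntegral_Iic_lineMeasure _ hx).trans ?_
      rw [← setIntegral_Ioo_eq_intervalIntegral hx.1, ← setIntegral_Ioo_eq_intervalIntegral hx.1]
      refine integral_congr_ae ?_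
      have hae := ae_restrict_of_ae_restrict_of_subset (Ioo_subset_Ioo_right hx.2)
        (ad.ae_of_ae_lineMeasure ((hinner g).and (hJg g)))
      filter_upwards [hae, ae_restrict_mem measurableSet_Ioo] with t ht htm
      have hj : (jac K t : ℂ) ≠ 0 :=
        Complex.ofReal_ne_zero.2 (ad.jac_pos ⟨htm.1.le, htm.2.le.trans hx.2⟩).ne'
      have hc : (coef εp εm t : ℂ) ≠ 0 := Complex.ofReal_ne_zero.2 (coef_ne_zero hεp hεm t)
      rw [ht.1, ht.2, invLead]
      push_cast
      field_simp
    refine ⟨?_, ?_⟩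
    · refine (hint a ⟨hab, le_rfl⟩).symm.trans ?_
      have e1 : ∫ t in Iic a, ρ (Z.smulRight (mθ.toLp _) g - J g) t ∂μ
          = ∫ t, ρ (Z.smulRight (mθ.toLp _) g - J g) t ∂μ := by
        rw [← integral_indicator measurableSet_Iic]
        refine integral_congr_ae (ae_mem_lineMeasure.mono fun x hx => ?_)
        exact indicator_of_mem (s := Iic a) hx.2.le _
      have i1 : Integrable (fun x => (invLead K εp εm x : ℂ) * affineWeight b s x) μ :=
        (memLp_bdd_mul mθ measurable_invLead.aestronglyMeasurable hC').integrable (by norm_num)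
      have i2 : Integrable (fun x => (invLead K εp εm x : ℂ) * J g x) μ :=
        (memLp_bdd_mul (Lp.memLp (J g)) measurable_invLead.aestronglyMeasurable
          hC').integrable (by norm_num)
      have e2 : ∫ x, (invLead K εp εm x : ℂ) * affineWeight b s x ∂μ = tot := rfl
      rw [e1, integral_congr_ae (hinner g)]
      have e3 : (fun x => (invLead K εp εm x : ℂ) * (affineWeight b s x * Z g - J g x))
          = fun x => (invLead K εp εm x : ℂ) * affineWeight b s x * Z g
            - (invLead K εp εm x : ℂ) * J g x := by
        funext x; ring
      rw [e3, integral_sub (i1.mul_const _) i2, integral_mul_const, e2, ← hZ]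
      ring
    · filter_upwards [volterra_coeFn (ρ (Z.smulRight (mθ.toLp _) g - J g)), ae_mem_lineMeasure]
        with x h1 hx
      rw [← hint x (Ioo_subset_Icc_self hx), ← h1]
      rfl
  refine ⟨T, S, hT, hS, ?_, fun g => ?_⟩
  · rw [injective_iff_map_eq_zero]
    intro g hg
    obtain ⟨G, U, hG, hU, h0, hTU⟩ := main g
    obtain ⟨pH, mH, pU, mU, -⟩ := lineDomain_parametrix (c := c) ad hεp hεm n g (Z g) s hG hU h0
    have hU0 : U =ᵐ[volume.restrict (Ioo (-b) a)] 0 := by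
      refine ad.ae_of_ae_lineMeasure ?_
      filter_upwards [hTU, Lp.coeFn_zero ℂ 2 μ] with x h1 h2
      rw [← h1, hg, h2]
    have hcont := pH.continuousOn hab
    have hW0 := HasWeakDeriv.ae_eq_zero isOpen_Ioo mU (pU.hasWeakDeriv hab) hU0
    have hH0 : (fun x => affineWeight b s x * Z g - G x) =ᵐ[volume.restrict (Ioo (-b) a)] 0 := by
      filter_upwards [hW0, ae_restrict_mem measurableSet_Ioo] with x h1 hx
      have hj : (jac K x : ℂ) ≠ 0 :=
        Complex.ofReal_ne_zero.2 (ad.jac_pos (Ioo_subset_Icc_self hx)).ne'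
      have hc : (coef εp εm x : ℂ) ≠ 0 := Complex.ofReal_ne_zero.2 (coef_ne_zero hεp hεm x)
      simpa [hj, hc] using h1
    have hD0 := HasWeakDeriv.ae_eq_zero isOpen_Ioo mH (pH.hasWeakDeriv hab) hH0
    -- At the left endpoint the affine weight is one and `G` is zero, so `θ z - G = 0` gives `z = 0`
    -- there.
    have hZ0 : Z g = 0 := by
      have hH0' : (fun x => affineWeight b s x * Z g - G x)
          =ᵐ[volume.restrict (Icc (-b) a)] fun _ => 0 := by
        rw [← restrict_Ioo_eq_restrict_Icc]; exact hH0
      have := Measure.eqOn_Icc_of_ae_eq volume ad.lt.ne hH0' hcont continuousOn_const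
        (left_mem_Icc.2 hab)
      simpa [affineWeight, hG] using this
    have hg0 : g =ᵐ[μ] (0 : ℝ → ℂ) := ae_lineMeasure_of_ae ?_
    · exact Lp.ext (hg0.trans (Lp.coeFn_zero ℂ 2 μ).symm)
    filter_upwards [hD0, ae_restrict_mem measurableSet_Ioo] with x h1 hx
    have hj : (jac K x : ℂ) ≠ 0 :=
      Complex.ofReal_ne_zero.2 (ad.jac_pos (Ioo_subset_Icc_self hx)).ne'
    simpa [hZ0, hj] using h1
  · obtain ⟨G, U, hG, hU, h0, hTU⟩ := main g
    obtain ⟨-, -, -, -, u', u'', D, hD⟩ :=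
      lineDomain_parametrix (c := c) ad hεp hεm n g (Z g) s hG hU h0
    refine ⟨U, u', u'', D, hTU, ?_⟩
    filter_upwards [hTU, ae_mem_lineMeasure, Lp.coeFn_add g (S g), Lp.coeFn_sub (Q (T g))
      (Z.smulRight (mσ.toLp _) g), mulOp_coeFn (hq := (Complex.measurable_ofReal.comp
        (measurable_coef.mul (measurable_const.div
        ((measurable_jac K).pow_const 2)))).aestronglyMeasurable) (hC := hCq) (T g),
      Lp.coeFn_smul (Z g) (mσ.toLp _), mσ.coeFn_toLp] with x h1 hx h2 h3 h4 h5 h6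
    have h7 : (Z.smulRight (mσ.toLp _) g) x = Z g * (s / jac K x) := by
      rw [← h6]; exact h5
    have h8 : S g x = Q (T g) x - (Z.smulRight (mσ.toLp _) g) x := h3
    have h9 : Q (T g) x =
        ((coef εp εm x * ((n * Real.pi / c) ^ 2 / jac K x ^ 2) : ℝ) : ℂ) * T g x :=
      h4
    rw [hD x hx, h2, Pi.add_apply, h8, h7, h9, h1]
    ring

theorem lineA_diagonalization (ad : IsAdmissible K a b) (hεp : 0 < εp) (hεm : 0 < εm) (n : ℕ) :
    HasCompactResolvent (lineA K a b c εp εm n) ∧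
      ∃ (ι : Type) (e : HilbertBasis ι ℂ (L2Line K a b)) (l : ι → ℝ),
        (lineA K a b c εp εm n).graph = diagGraph e l := by
  obtain ⟨T, S, hT, hS, hTi, h⟩ := exists_parametrix (c := c) ad hεp hεm n
  refine exists_diagonalization_of_parametrix (lineA_isFormalAdjoint ad n) hT hS hTi fun g => ?_
  rw [lineA_graph (c := c) (εp := εp) (εm := εm) n ad.a_pos ad.b_pos ad.curv]
  exact h g

end


/-! ### Tensor products of square integrable functions -/

section

variable {X Y : Type*} [MeasurableSpace X] [MeasurableSpace Y] {μ : Measure X} {ν : Measure Y}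

theorem ae_eq_comp_fst {f g : X → ℂ} (h : f =ᵐ[μ] g) :
    (fun p : X × Y => f p.1) =ᵐ[μ.prod ν] fun p => g p.1 :=
  Measure.quasiMeasurePreserving_fst.ae_eq_comp h

variable [SFinite ν]

theorem eLpNorm_tensor {f : X → ℂ} {g : Y → ℂ} (hf : AEStronglyMeasurable f μ)
    (hg : AEStronglyMeasurable g ν) :
    eLpNorm (fun p : X × Y => f p.1 * g p.2) 2 (μ.prod ν) = eLpNorm f 2 μ * eLpNorm g 2 ν := by
  simp only [eLpNorm_eq_lintegral_rpow_enorm_toReal (two_ne_zero) (ENNReal.ofNat_ne_top)]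
  rw [← ENNReal.mul_rpow_of_nonneg _ _ (by norm_num), ← lintegral_prod_mul]
  · congr 2
    funext p
    rw [enorm_mul, ENNReal.mul_rpow_of_nonneg _ _ (by norm_num)]
  · exact hf.enorm.pow_const _
  · exact hg.enorm.pow_const _

theorem memLp_tensor {f : X → ℂ} {g : Y → ℂ} (hf : MemLp f 2 μ) (hg : MemLp g 2 ν) :
    MemLp (fun p : X × Y => f p.1 * g p.2) 2 (μ.prod ν) :=
  ⟨hf.1.comp_fst.mul hg.1.comp_snd, by
    rw [eLpNorm_tensor hf.1 hg.1]; exact ENNReal.mul_lt_top hf.2 hg.2⟩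

/-- The operator `f ↦ f ⊗ φ` from `L²(μ)` to `L²(μ × ν)`. -/
def tensorOp (μ : Measure X) (φ : Y → ℂ) (hφ : MemLp φ 2 ν) :
    Lp ℂ 2 μ →L[ℂ] Lp ℂ 2 (μ.prod ν) :=
  LinearMap.mkContinuous
    { toFun := fun f => (memLp_tensor (Lp.memLp f) hφ).toLp (fun p => f p.1 * φ p.2)
      map_add' := fun f g => by
        rw [← MemLp.toLp_add]
        refine MemLp.toLp_congr _ _ ?_
        filter_upwards [ae_eq_comp_fst (ν := ν) (Lp.coeFn_add f g)] with p hp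
        simp only [hp, Pi.add_apply, add_mul]
      map_smul' := fun z f => by
        rw [RingHom.id_apply, ← MemLp.toLp_const_smul]
        refine MemLp.toLp_congr _ _ ?_
        filter_upwards [ae_eq_comp_fst (ν := ν) (Lp.coeFn_smul z f)] with p hp
        simp only [hp, Pi.smul_apply, smul_eq_mul, mul_assoc] }
    (eLpNorm φ 2 ν).toReal fun f => by
      simp only [LinearMap.coe_mk, AddHom.coe_mk]
      rw [Lp.norm_toLp, eLpNorm_tensor (Lp.memLp f).1 hφ.1, ENNReal.toReal_mul, mul_comm]
      rfl

theorem tensorOp_coeFn {φ : Y → ℂ} (hφ : MemLp φ 2 ν) (f : Lp ℂ 2 μ) :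
    tensorOp μ φ hφ f =ᵐ[μ.prod ν] fun p => f p.1 * φ p.2 :=
  MemLp.coeFn_toLp (memLp_tensor (Lp.memLp f) hφ)

theorem inner_tensorOp [SFinite μ] {φ χ : Y → ℂ} (hφ : MemLp φ 2 ν) (hχ : MemLp χ 2 ν)
    (f g : Lp ℂ 2 μ) :
    inner ℂ (tensorOp μ φ hφ f) (tensorOp μ χ hχ g)
      = inner ℂ f g * ∫ y, starRingEnd ℂ (φ y) * χ y ∂ν := by
  rw [L2.inner_def, L2.inner_def, ← integral_prod_mul]
  refine integral_congr_ae ?_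
  filter_upwards [tensorOp_coeFn hφ f, tensorOp_coeFn hχ g] with p h1 h2
  rw [h1, h2, RCLike.inner_apply, RCLike.inner_apply, map_mul]
  ring

theorem integrable_conj_mul {Z : Type*} [MeasurableSpace Z] {ρ : Measure Z} {f g : Z → ℂ}
    (hf : MemLp f 2 ρ) (hg : MemLp g 2 ρ) : Integrable (fun p => starRingEnd ℂ (f p) * g p) ρ :=
  memLp_one_iff_integrable.1 (hg.mul (p := 2) (q := 2) (r := 1) hf.star)

theorem inner_tensorOp_left {φ : Y → ℂ} (hφ : MemLp φ 2 ν) (f : Lp ℂ 2 μ)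
    (Ψ : Lp ℂ 2 (μ.prod ν)) :
    inner ℂ (tensorOp μ φ hφ f) Ψ
      = ∫ p, starRingEnd ℂ (f p.1 * φ p.2) * Ψ p ∂(μ.prod ν) := by
  rw [L2.inner_def]
  refine integral_congr_ae ?_
  filter_upwards [tensorOp_coeFn hφ f] with p h1
  rw [h1, RCLike.inner_apply, mul_comm]

theorem integrable_conj_snd_mul [IsFiniteMeasure μ] {φ : Y → ℂ} (hφ : MemLp φ 2 ν)
    {Ψ : X × Y → ℂ} (hΨ : MemLp Ψ 2 (μ.prod ν)) :
    Integrable (fun p => starRingEnd ℂ (φ p.2) * Ψ p) (μ.prod ν) := by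
  simpa using integrable_conj_mul (memLp_tensor (memLp_const (1 : ℂ)) hφ) hΨ

/-- Both sides are integrable, and by Fubini they have the same integral over every measurable set,
since indicators are admissible test functions for the adjoint. -/
theorem adjoint_tensorOp_coeFn [IsFiniteMeasure μ] {φ : Y → ℂ} (hφ : MemLp φ 2 ν)
    (Ψ : Lp ℂ 2 (μ.prod ν)) :
    (ContinuousLinearMap.adjoint (tensorOp μ φ hφ) Ψ) =ᵐ[μ]
      fun x => ∫ y, starRingEnd ℂ (φ y) * Ψ (x, y) ∂ν := by
  have hi := integrable_conj_snd_mul (μ := μ) hφ (Lp.memLp Ψ)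
  refine Integrable.ae_eq_of_forall_setIntegral_eq _ _ ((Lp.memLp _).integrable (by norm_num))
    hi.integral_prod_left fun s hs hfin => ?_
  rw [← L2.inner_indicatorConstLp_one (𝕜 := ℂ) hs hfin.ne, ContinuousLinearMap.adjoint_inner_right,
    inner_tensorOp_left]
  have e1 : ∫ x in s, ∫ y, starRingEnd ℂ (φ y) * Ψ (x, y) ∂ν ∂μ
      = ∫ p, (s.indicator (fun _ => (1 : ℂ)) p.1) * (starRingEnd ℂ (φ p.2) * Ψ p) ∂(μ.prod ν) := by
    rw [integral_prod]
    · rw [← integral_indicator hs]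
      refine integral_congr_ae (Eventually.of_forall fun x => ?_)
      by_cases hx : x ∈ s <;> simp [hx]
    · refine hi.bdd_mul (c := 1) ?_ (Eventually.of_forall fun p => ?_)
      · exact ((measurable_const.indicator hs).comp measurable_fst).aestronglyMeasurable
      · by_cases hx : p.1 ∈ s <;> simp [hx]
  rw [e1]
  refine integral_congr_ae ?_
  filter_upwards [ae_eq_comp_fst (ν := ν) (indicatorConstLp_coeFn (p := 2) (hs := hs)
    (hμs := hfin.ne) (c := (1 : ℂ)))] with p hp
  rw [hp]
  by_cases hx : p.1 ∈ s <;> simp [hx]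

/-- A function on a product whose slices vanish vanishes. -/
theorem ae_eq_zero_of_ae_ae {Ψ : X × Y → ℂ} (hΨ : AEStronglyMeasurable Ψ (μ.prod ν))
    (h : ∀ᵐ x ∂μ, ∀ᵐ y ∂ν, Ψ (x, y) = 0) : Ψ =ᵐ[μ.prod ν] 0 := by
  have h0 : ∫⁻ p, ‖Ψ p‖ₑ ∂(μ.prod ν) = 0 := by
    rw [lintegral_prod _ hΨ.enorm, lintegral_eq_zero_iff' hΨ.enorm.lintegral_prod_right']
    filter_upwards [h] with x hx
    have : ∫⁻ y, ‖Ψ (x, y)‖ₑ ∂ν = ∫⁻ y, 0 ∂ν :=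
      lintegral_congr_ae (by filter_upwards [hx] with y hy; simp [hy])
    simp [this]
  rw [lintegral_eq_zero_iff' hΨ.enorm] at h0
  filter_upwards [h0] with p hp
  simpa using hp

theorem memLp_slice [SFinite μ] {Ψ : X × Y → ℂ} (hΨ : MemLp Ψ 2 (μ.prod ν)) :
    ∀ᵐ x ∂μ, MemLp (fun y => Ψ (x, y)) 2 ν := by
  have h := (memLp_two_iff_integrable_sq_norm hΨ.1).1 hΨ
  filter_upwards [h.prod_right_ae, hΨ.1.prodMk_left] with x h1 h2
  exact (memLp_two_iff_integrable_sq_norm h2).2 h1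

end

/-! ### Completeness of the sine functions -/

section

variable {c : ℝ}

theorem contDiff_sineMode (c : ℝ) (n : ℕ) : ContDiff ℝ ∞ (sineMode c n) := by
  unfold sineMode; fun_prop

theorem memLp_sineMode (c : ℝ) (n : ℕ) :
    MemLp (fun y => (sineMode c n y : ℂ)) 2 (volume.restrict (Ioo 0 c)) :=
  memLp_of_continuousOn_Icc
    (Complex.continuous_ofReal.comp (contDiff_sineMode c n).continuous).continuousOn

theorem sineMode_zero (c : ℝ) (n : ℕ) : sineMode c n 0 = 0 := by simp [sineMode]

theorem sineMode_right (hc : 0 < c) (n : ℕ) : sineMode c n c = 0 := by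
  rw [sineMode, div_mul_cancel₀ _ hc.ne', Real.sin_nat_mul_pi, mul_zero]

theorem integral_cos_int_mul (hc : 0 < c) {m : ℤ} (hm : m ≠ 0) :
    ∫ y in (0 : ℝ)..c, Real.cos (m * Real.pi / c * y) = 0 := by
  have h : (m * Real.pi / c : ℝ) ≠ 0 := by
    have : (m : ℝ) ≠ 0 := by exact_mod_cast hm
    have := Real.pi_ne_zero
    positivity
  rw [intervalIntegral.integral_comp_mul_left (fun y => Real.cos y) h, integral_cos,
    div_mul_cancel₀ _ hc.ne', Real.sin_int_mul_pi]
  simp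

theorem integral_sineMode_mul (hc : 0 < c) {m n : ℕ} (hm : m ≠ 0) :
    ∫ y in Ioo 0 c, sineMode c m y * sineMode c n y = if m = n then 1 else 0 := by
  rw [setIntegral_Ioo_eq_intervalIntegral hc.le]
  have e : ∀ y, sineMode c m y * sineMode c n y = c⁻¹ *
      (Real.cos (((m - n : ℤ) : ℝ) * Real.pi / c * y)
        - Real.cos (((m + n : ℤ) : ℝ) * Real.pi / c * y)) := fun y => by
    have h1 : sineMode c m y * sineMode c n y = (√(2 / c) * √(2 / c)) *
        (Real.sin (m * Real.pi / c * y) * Real.sin (n * Real.pi / c * y)) := by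
      unfold sineMode; ring
    have e1 : (((m - n : ℤ) : ℝ) * Real.pi / c * y)
        = m * Real.pi / c * y - n * Real.pi / c * y := by push_cast; ring
    have e2 : (((m + n : ℤ) : ℝ) * Real.pi / c * y)
        = m * Real.pi / c * y + n * Real.pi / c * y := by push_cast; ring
    rw [h1, Real.mul_self_sqrt (by positivity), e1, e2, Real.cos_sub, Real.cos_add]
    ring
  have ci : ∀ m : ℤ, IntervalIntegrable (fun y => Real.cos (m * Real.pi / c * y)) volume 0 c :=
    fun m => Continuous.intervalIntegrable (by fun_prop) _ _
  simp only [e]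
  -- The frequency `m + n` is never zero because `m ≠ 0`; the frequency `m - n` vanishes exactly on
  -- the diagonal.
  rw [intervalIntegral.integral_const_mul, intervalIntegral.integral_sub (ci _) (ci _),
    integral_cos_int_mul hc (m := m + n) (by omega), sub_zero]
  split_ifs with h
  · subst h
    simp [hc.ne']
  · rw [integral_cos_int_mul hc (m := m - n) (by omega), mul_zero]

/-- The odd extension of a function on `(0, c)`. -/
def oddExt (h : ℝ → ℂ) (y : ℝ) : ℂ := if 0 < y then h y else -h (-y)

/-- Reflecting the left half onto the right one leaves only the odd part of `g`. -/
theorem intervalIntegral_oddExt_mul (hc : 0 < c) {h g : ℝ → ℂ} (hg : Continuous g)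
    (hh : IntegrableOn h (Ioo 0 c)) :
    ∫ y in (-c)..c, g y * oddExt h y = ∫ y in (0 : ℝ)..c, (g y - g (-y)) * h y := by
  have hI : IntervalIntegrable h volume 0 c :=
    (intervalIntegrable_iff_integrableOn_Ioo_of_le hc.le).2 hh
  have hp : IntervalIntegrable (fun y => g y * h y) volume 0 c :=
    hI.continuousOn_mul hg.continuousOn
  have hn : IntervalIntegrable (fun y => g (-y) * h y) volume 0 c :=
    hI.continuousOn_mul (hg.comp continuous_neg).continuousOn
  have hp' : IntervalIntegrable (fun y => g y * oddExt h y) volume 0 c := by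
    refine hp.congr fun y hy => ?_
    rw [uIoc_of_le hc.le] at hy
    simp [oddExt, hy.1]
  have ep : ∫ y in (0 : ℝ)..c, g y * oddExt h y = ∫ y in (0 : ℝ)..c, g y * h y := by
    refine intervalIntegral.integral_congr_ae (Eventually.of_forall fun y hy => ?_)
    rw [uIoc_of_le hc.le] at hy
    simp [oddExt, hy.1]
  have hn' : IntervalIntegrable (fun y => g y * -h (-y)) volume (-c) 0 := by
    have := (IntervalIntegrable.iff_comp_neg enorm_ne_top).1 hn.neg
    simpa using this.symm
  have hle : -c ≤ 0 := by linarith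
  have hn'' : IntervalIntegrable (fun y => g y * oddExt h y) volume (-c) 0 := by
    refine hn'.congr fun y hy => ?_
    rw [uIoc_of_le hle] at hy
    simp [oddExt, not_lt.2 hy.2]
  have en : ∫ y in (-c)..0, g y * oddExt h y = ∫ y in (0 : ℝ)..c, -(g (-y) * h y) := by
    have h1 := intervalIntegral.integral_comp_neg (a := -c) (b := 0)
      (fun y => -(g (-y) * h y))
    simp only [neg_neg, neg_zero] at h1
    rw [← h1]
    refine intervalIntegral.integral_congr_ae (Eventually.of_forall fun y hy => ?_)
    rw [uIoc_of_le hle] at hy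
    simp [oddExt, not_lt.2 hy.2]
  rw [← intervalIntegral.integral_add_adjacent_intervals hn'' hp', ep, en,
    ← intervalIntegral.integral_add (by exact hn.neg) hp]
  congr 1
  funext y
  ring

/-- The odd extension is the zero extension minus its reflection, except at the null points `0` and
`c`. -/
theorem memLp_oddExt {h : ℝ → ℂ} (hh : MemLp h 2 (volume.restrict (Ioo 0 c))) :
    MemLp (oddExt h) 2 (volume.restrict (Ioc (-c) c)) := by
  have h1 : MemLp ((Ioo 0 c).indicator h) 2 volume :=
    (memLp_indicator_iff_restrict measurableSet_Ioo).2 hh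
  have h2 := h1.comp_measurePreserving (Measure.measurePreserving_neg (volume : Measure ℝ))
  refine ((h1.sub h2).restrict (Ioc (-c) c)).ae_eq ?_
  filter_upwards [ae_restrict_mem measurableSet_Ioc, ae_restrict_of_ae
    (compl_mem_ae_iff.2 (measure_singleton (0 : ℝ))), ae_restrict_of_ae
    (compl_mem_ae_iff.2 (measure_singleton c))] with y hy hy0 hyc
  have hy0 : y ≠ 0 := hy0
  have hyc : y ≠ c := hyc
  rcases lt_or_gt_of_ne hy0 with h | h
  · have n1 : y ∉ Ioo 0 c := fun h' => by linarith [h'.1]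
    have n2 : -y ∈ Ioo 0 c := ⟨by linarith, by linarith [hy.1]⟩
    simp only [Pi.sub_apply, Function.comp_apply, indicator_of_notMem n1, indicator_of_mem n2,
      zero_sub, oddExt, if_neg (not_lt.2 h.le)]
  · have n1 : y ∈ Ioo 0 c := ⟨h, lt_of_le_of_ne hy.2 hyc⟩
    have n2 : -y ∉ Ioo 0 c := fun h' => by linarith [h'.1]
    simp only [Pi.sub_apply, Function.comp_apply, indicator_of_notMem n2, indicator_of_mem n1,
      sub_zero, oddExt, if_pos h]

/-- The Fourier coefficients of the odd extension to `(-c, c)` are multiples of sine coefficients,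
so all of them vanish, and Parseval's identity forces the extension to vanish. -/
theorem ae_eq_zero_of_integral_sineMode_eq_zero (hc : 0 < c) {h : ℝ → ℂ}
    (hh : MemLp h 2 (volume.restrict (Ioo 0 c)))
    (h0 : ∀ n : ℕ+, ∫ y in Ioo 0 c, (sineMode c n y : ℂ) * h y = 0) :
    h =ᵐ[volume.restrict (Ioo 0 c)] 0 := by
  have hlt : -c < c := by linarith
  have i1 : IntegrableOn h (Ioo 0 c) := hh.integrable (by norm_num)
  have hsin : ∀ n : ℕ, ∫ y in (0 : ℝ)..c, (Real.sin (n * Real.pi / c * y) : ℂ) * h y = 0 := by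
    intro n
    rcases Nat.eq_zero_or_pos n with rfl | hn
    · simp
    have := h0 ⟨n, hn⟩
    rw [setIntegral_Ioo_eq_intervalIntegral hc.le] at this
    simp only [PNat.mk_coe, sineMode, Complex.ofReal_mul, mul_assoc] at this
    rw [intervalIntegral.integral_const_mul] at this
    have hs : (√(2 / c) : ℂ) ≠ 0 := Complex.ofReal_ne_zero.2 (Real.sqrt_pos.2 (by positivity)).ne'
    exact (mul_eq_zero.1 this).resolve_left hs
  have hsinZ : ∀ n : ℤ, ∫ y in (0 : ℝ)..c, (Real.sin (n * Real.pi / c * y) : ℂ) * h y = 0 := by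
    intro n
    rcases Int.eq_nat_or_neg n with ⟨k, rfl | rfl⟩
    · exact_mod_cast hsin k
    · have e : ∀ y : ℝ, ((-k : ℤ) : ℝ) * Real.pi / c * y = -(k * Real.pi / c * y) := fun y => by
        push_cast; ring
      simp only [e, Real.sin_neg, Complex.ofReal_neg, neg_mul, intervalIntegral.integral_neg,
        hsin k, neg_zero]
  have hF : ∀ n : ℤ, fourierCoeffOn hlt (oddExt h) n = 0 := by
    intro n
    rw [fourierCoeffOn_eq_integral]
    have e1 : ∀ y : ℝ, (fourier (-n) (y : AddCircle (c - -c)) : ℂ)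
        = Complex.exp (-(n * Real.pi / c * y) * Complex.I) := fun y => by
      rw [fourier_coe_apply]
      congr 1
      have : (c : ℂ) ≠ 0 := Complex.ofReal_ne_zero.2 hc.ne'
      push_cast
      field_simp
      ring
    simp only [e1, smul_eq_mul]
    rw [intervalIntegral_oddExt_mul hc (by fun_prop) i1]
    have e2 : ∀ y : ℝ, Complex.exp (-(n * Real.pi / c * y) * Complex.I)
        - Complex.exp (-(n * Real.pi / c * (-y : ℝ)) * Complex.I)
        = (-2 * Complex.I) * (Real.sin (n * Real.pi / c * y) : ℂ) := fun y => by
      simp only [Complex.exp_mul_I]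
      push_cast
      rw [mul_neg, neg_neg, Complex.sin_neg, Complex.cos_neg]
      ring
    simp only [e2, mul_assoc]
    rw [intervalIntegral.integral_const_mul, intervalIntegral.integral_const_mul, hsinZ]
    simp
  have hs := hasSum_sq_fourierCoeffOn hlt (memLp_oddExt hh)
  simp only [hF, norm_zero, ne_eq, OfNat.ofNat_ne_zero, not_false_eq_true, zero_pow] at hs
  have hz := hs.unique hasSum_zero
  have hne : (c - -c)⁻¹ ≠ 0 := inv_ne_zero (by linarith)
  rw [smul_eq_zero, or_iff_right hne, intervalIntegral.integral_of_le hlt.le,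
    integral_eq_zero_iff_of_nonneg (fun _ => by positivity)
      ((memLp_two_iff_integrable_sq_norm (memLp_oddExt hh).1).1 (memLp_oddExt hh))] at hz
  have hz' := ae_restrict_of_ae_restrict_of_subset (s := Ioo 0 c) (t := Ioc (-c) c)
    (fun y hy => ⟨by linarith [hy.1], hy.2.le⟩) hz
  filter_upwards [hz', ae_restrict_mem measurableSet_Ioo] with y h1 hy
  simpa [oddExt, hy.1] using h1

end


/-! ### Products of functions of one variable in the domain of the operator on the rectangle -/

theorem volume_restrict_prod (I J : Set ℝ) :
    (volume.restrict (I ×ˢ J) : Measure (ℝ × ℝ))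
      = (volume.restrict I).prod (volume.restrict J) := by
  rw [Measure.prod_restrict, Measure.volume_eq_prod]

section

variable {I J : Set ℝ} {φ : ℝ × ℝ → ℝ}

theorem contDiff_slice_fst (hφ : ContDiff ℝ ∞ φ) (y : ℝ) : ContDiff ℝ ∞ fun x => φ (x, y) :=
  hφ.comp (contDiff_id.prodMk contDiff_const)

theorem contDiff_slice_snd (hφ : ContDiff ℝ ∞ φ) (x : ℝ) : ContDiff ℝ ∞ fun y => φ (x, y) :=
  hφ.comp (contDiff_const.prodMk contDiff_id)

theorem hasDerivAt_slice_fst {F : Type*} [NormedAddCommGroup F] [NormedSpace ℝ F]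
    {w : ℝ × ℝ → F} (hw : ContDiff ℝ ∞ w) (x y : ℝ) :
    HasDerivAt (fun t => w (t, y)) (fderiv ℝ w (x, y) (1, 0)) x :=
  ((hw.differentiable (by simp) (x, y)).hasFDerivAt).comp_hasDerivAt x
    ((hasDerivAt_id x).prodMk (hasDerivAt_const x y))

theorem hasDerivAt_slice_snd {F : Type*} [NormedAddCommGroup F] [NormedSpace ℝ F]
    {w : ℝ × ℝ → F} (hw : ContDiff ℝ ∞ w) (x y : ℝ) :
    HasDerivAt (fun t => w (x, t)) (fderiv ℝ w (x, y) (0, 1)) y :=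
  ((hw.differentiable (by simp) (x, y)).hasFDerivAt).comp_hasDerivAt y
    ((hasDerivAt_const y x).prodMk (hasDerivAt_id y))

theorem tsupport_comp_subset {E F : Type*} [TopologicalSpace E] [TopologicalSpace F] {φ : E → ℝ}
    {g : F → E} (hg : Continuous g) : tsupport (fun x => φ (g x)) ⊆ g ⁻¹' tsupport φ :=
  closure_minimal (fun _ hx => subset_tsupport φ hx) ((isClosed_tsupport φ).preimage hg)

theorem hasCompactSupport_slice_fst (hc : HasCompactSupport φ) (y : ℝ) :
    HasCompactSupport fun x => φ (x, y) :=
  (hc.image continuous_fst).of_isClosed_subset (isClosed_tsupport _) fun x hx =>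
    ⟨(x, y), tsupport_comp_subset (φ := φ) (g := fun x => (x, y)) (by fun_prop) hx, rfl⟩

theorem hasCompactSupport_slice_snd (hc : HasCompactSupport φ) (x : ℝ) :
    HasCompactSupport fun y => φ (x, y) :=
  (hc.image continuous_snd).of_isClosed_subset (isClosed_tsupport _) fun y hy =>
    ⟨(x, y), tsupport_comp_subset (φ := φ) (g := fun y => (x, y)) (by fun_prop) hy, rfl⟩

/-- Each horizontal slice of a test function is a test function for `u`, so Fubini reduces the claim
to one variable. -/
theorem HasWeakDeriv.tensor_fst {u v g : ℝ → ℂ} (hu : HasWeakDeriv I 1 u v)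
    (mu : MemLp u 2 (volume.restrict I)) (mv : MemLp v 2 (volume.restrict I))
    (mg : MemLp g 2 (volume.restrict J)) :
    HasWeakDeriv (I ×ˢ J) (1, 0) (fun p => u p.1 * g p.2) (fun p => v p.1 * g p.2) := by
  intro φ h1 h2 h3
  have iu := integrable_dtest_smul (U := I ×ˢ J) (u := fun p => u p.1 * g p.2)
    (by rw [volume_restrict_prod]; exact memLp_tensor mu mg) h1 h2 (1, 0)
  have iv := integrable_test_smul (U := I ×ˢ J) (u := fun p => v p.1 * g p.2)
    (by rw [volume_restrict_prod]; exact memLp_tensor mv mg) h1.continuous h2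
  rw [volume_restrict_prod] at iu iv ⊢
  rw [integral_prod_symm _ iu, integral_prod_symm _ iv, ← integral_neg]
  congr 1
  funext y
  have key := hu (fun x => φ (x, y)) (contDiff_slice_fst h1 y) (hasCompactSupport_slice_fst h2 y)
    fun x hx => (h3 (tsupport_comp_subset (φ := φ) (g := fun x => (x, y)) (by fun_prop) hx)).1
  have e : ∀ x, fderiv ℝ (fun x => φ (x, y)) x 1 = fderiv ℝ φ (x, y) (1, 0) := fun x => by
    rw [fderiv_apply_one]; exact (hasDerivAt_slice_fst h1 x y).deriv
  simp only [e] at key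
  simp only [← smul_mul_assoc]
  rw [integral_mul_const, integral_mul_const, key, neg_mul]

theorem HasWeakDeriv.tensor_snd {u g h : ℝ → ℂ} (hg : HasWeakDeriv J 1 g h)
    (mu : MemLp u 2 (volume.restrict I)) (mg : MemLp g 2 (volume.restrict J))
    (mh : MemLp h 2 (volume.restrict J)) :
    HasWeakDeriv (I ×ˢ J) (0, 1) (fun p => u p.1 * g p.2) (fun p => u p.1 * h p.2) := by
  intro φ h1 h2 h3
  have iu := integrable_dtest_smul (U := I ×ˢ J) (u := fun p => u p.1 * g p.2)
    (by rw [volume_restrict_prod]; exact memLp_tensor mu mg) h1 h2 (0, 1)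
  have iv := integrable_test_smul (U := I ×ˢ J) (u := fun p => u p.1 * h p.2)
    (by rw [volume_restrict_prod]; exact memLp_tensor mu mh) h1.continuous h2
  rw [volume_restrict_prod] at iu iv ⊢
  rw [integral_prod _ iu, integral_prod _ iv, ← integral_neg]
  congr 1
  funext x
  have key := hg (fun y => φ (x, y)) (contDiff_slice_snd h1 x) (hasCompactSupport_slice_snd h2 x)
    fun y hy => (h3 (tsupport_comp_subset (φ := φ) (g := fun y => (x, y)) (by fun_prop) hy)).2
  have e : ∀ y, fderiv ℝ (fun y => φ (x, y)) y 1 = fderiv ℝ φ (x, y) (0, 1) := fun y => by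
    rw [fderiv_apply_one]; exact (hasDerivAt_slice_snd h1 x y).deriv
  simp only [e] at key
  simp only [← mul_smul_comm]
  rw [integral_const_mul, integral_const_mul, key, mul_neg]

theorem isH1_tensor {u v g h : ℝ → ℂ} (hu : HasWeakDeriv I 1 u v) (hg : HasWeakDeriv J 1 g h)
    (mu : MemLp u 2 (volume.restrict I)) (mv : MemLp v 2 (volume.restrict I))
    (mg : MemLp g 2 (volume.restrict J)) (mh : MemLp h 2 (volume.restrict J)) :
    IsH1 (I ×ˢ J) (fun p => u p.1 * g p.2) (fun p => v p.1 * g p.2) (fun p => u p.1 * h p.2) := by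
  refine ⟨?_, ?_, ?_, hu.tensor_fst mu mv mg, hg.tensor_snd mu mg mh⟩ <;>
  · rw [volume_restrict_prod]
    apply memLp_tensor <;> assumption

theorem isH2_tensor {u u' u'' g g' g'' : ℝ → ℂ} (hu : IsH2Line I u u' u'')
    (hg : IsH2Line J g g' g'') :
    IsH2 (I ×ˢ J) (fun p => u p.1 * g p.2) (fun p => u' p.1 * g p.2) (fun p => u p.1 * g' p.2)
      (fun p => u'' p.1 * g p.2) (fun p => u' p.1 * g' p.2) (fun p => u' p.1 * g' p.2)
      (fun p => u p.1 * g'' p.2) :=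
  ⟨isH1_tensor hu.deriv' hg.deriv' hu.memLp hu.memLp' hg.memLp hg.memLp',
    isH1_tensor hu.deriv'' hg.deriv' hu.memLp' hu.memLp'' hg.memLp hg.memLp',
    isH1_tensor hu.deriv' hg.deriv'' hu.memLp hu.memLp' hg.memLp' hg.memLp''⟩

theorem tendsto_eLpNorm_tensor_sub {u g : ℝ → ℂ} {w : ℕ → ℝ → ℂ}
    (mu : AEStronglyMeasurable u (volume.restrict I)) (mw : ∀ k, Continuous (w k))
    (mg : MemLp g 2 (volume.restrict J))
    (h : Tendsto (fun k => eLpNorm (fun x => u x - w k x) 2 (volume.restrict I)) atTop (𝓝 0)) :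
    Tendsto (fun k => eLpNorm (fun p : ℝ × ℝ => u p.1 * g p.2 - w k p.1 * g p.2) 2
      (volume.restrict (I ×ˢ J))) atTop (𝓝 0) := by
  have e : ∀ k, eLpNorm (fun p : ℝ × ℝ => u p.1 * g p.2 - w k p.1 * g p.2) 2
      (volume.restrict (I ×ˢ J)) = eLpNorm (fun x => u x - w k x) 2 (volume.restrict I)
        * eLpNorm g 2 (volume.restrict J) := fun k => by
    rw [volume_restrict_prod]
    refine Eq.trans ?_ (eLpNorm_tensor (mu.sub (mw k).aestronglyMeasurable) mg.1)
    simp only [sub_mul]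
  simp only [e]
  simpa using ENNReal.Tendsto.mul_const h (Or.inr mg.2.ne)

theorem tendsto_eLpNorm_sub_mul_const {u : ℝ → ℂ} {w : ℕ → ℝ → ℂ} (z : ℂ)
    (h : Tendsto (fun k => eLpNorm (fun x => u x - w k x) 2 (volume.restrict I)) atTop (𝓝 0)) :
    Tendsto (fun k => eLpNorm (fun x => u x * z - w k x * z) 2 (volume.restrict I))
      atTop (𝓝 0) := by
  simpa [mul_comm] using tendsto_eLpNorm_sub_smul z h

/-- Traces of a product of functions of one variable. -/
theorem hasTrace_tensor {α β c : ℝ} {u U v g : ℝ → ℂ} (hU : IsPrimitive α β U v) (hab : α ≤ β)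
    (hu : u =ᵐ[volume.restrict (Ioo α β)] U) (mv : MemLp v 2 (volume.restrict (Ioo α β)))
    (hg : ContDiff ℝ ∞ g) :
    (∀ x₀ ∈ Icc α β, HasTrace (Ioo α β ×ˢ Ioo 0 c) (Ioo 0 c) (fun y => (x₀, y))
      (fun p => u p.1 * g p.2) (fun p => v p.1 * g p.2) (fun p => u p.1 * deriv g p.2)
      (fun y => U x₀ * g y)) ∧
    ∀ y₀, HasTrace (Ioo α β ×ˢ Ioo 0 c) (Ioo α β) (fun x => (x, y₀))
      (fun p => u p.1 * g p.2) (fun p => v p.1 * g p.2) (fun p => u p.1 * deriv g p.2)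
      (fun x => u x * g y₀) := by
  -- The approximants are `w k ⊗ g`. Their restrictions to vertical sides converge because `w k`
  -- converges at every point of the closed interval; on horizontal sides `L²` convergence suffices.
  obtain ⟨w, w1, w2, w3, w4⟩ := hU.exists_contDiff_approx mv
  have mU : MemLp u 2 (volume.restrict (Ioo α β)) :=
    (memLp_of_continuousOn_Icc (hU.continuousOn hab)).ae_eq hu.symm
  have mg : MemLp g 2 (volume.restrict (Ioo 0 c)) :=
    memLp_of_continuousOn_Icc hg.continuous.continuousOn
  have mg' : MemLp (deriv g) 2 (volume.restrict (Ioo 0 c)) :=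
    memLp_of_continuousOn_Icc (hg.continuous_deriv (by simp)).continuousOn
  have w2' : Tendsto (fun k => eLpNorm (fun x => u x - w k x) 2 (volume.restrict (Ioo α β)))
      atTop (𝓝 0) := by
    refine w2.congr fun k => eLpNorm_congr_ae ?_
    filter_upwards [hu] with x hx
    rw [hx]
  have sm : ∀ k, ContDiff ℝ ∞ fun p : ℝ × ℝ => w k p.1 * g p.2 := fun k =>
    ((w1 k).comp contDiff_fst).mul (hg.comp contDiff_snd)
  have e1 : ∀ k p, fderiv ℝ (fun p : ℝ × ℝ => w k p.1 * g p.2) p (1, 0)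
      = deriv (w k) p.1 * g p.2 := fun k p => by
    refine (hasDerivAt_slice_fst (sm k) p.1 p.2).unique ?_
    exact (((w1 k).differentiable (by simp) p.1).hasDerivAt).mul_const (g p.2)
  have e2 : ∀ k p, fderiv ℝ (fun p : ℝ × ℝ => w k p.1 * g p.2) p (0, 1)
      = w k p.1 * deriv g p.2 := fun k p => by
    refine (hasDerivAt_slice_snd (sm k) p.1 p.2).unique ?_
    exact ((hg.differentiable (by simp) p.2).hasDerivAt).const_mul (w k p.1)
  have t0 := tendsto_eLpNorm_tensor_sub mU.1 (fun k => (w1 k).continuous) mg w2'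
  have t1 := tendsto_eLpNorm_tensor_sub mv.1 (fun k => (w1 k).continuous_deriv (by simp)) mg w3
  have t2 := tendsto_eLpNorm_tensor_sub mU.1 (fun k => (w1 k).continuous) mg' w2'
  refine ⟨fun x₀ hx₀ => ⟨mg.const_mul _, fun k p => w k p.1 * g p.2, sm, t0, ?_, ?_, ?_⟩,
    fun y₀ => ⟨mU.mul_const _, fun k p => w k p.1 * g p.2, sm, t0, ?_, ?_, ?_⟩⟩
  · simpa only [e1] using t1
  · simpa only [e2] using t2
  · have e : ∀ k, eLpNorm (fun y => U x₀ * g y - w k x₀ * g y) 2 (volume.restrict (Ioo 0 c))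
        = ‖U x₀ - w k x₀‖ₑ * eLpNorm g 2 (volume.restrict (Ioo 0 c)) := fun k => by
      rw [← eLpNorm_const_smul]
      simp only [← sub_mul]
      rfl
    simp only [e]
    have h1 : Tendsto (fun k => ‖U x₀ - w k x₀‖ₑ) atTop (𝓝 0) := by
      have h2 := ((tendsto_const_nhds (x := U x₀)).sub (w4 x₀ hx₀)).enorm
      simpa using h2
    simpa using ENNReal.Tendsto.mul_const h1 (Or.inr mg.2.ne)
  · simpa only [e1] using t1
  · simpa only [e2] using t2
  · exact tendsto_eLpNorm_sub_mul_const _ w2'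

end

section

variable {K a b c εp εm : ℝ} {u u' u'' : ℝ → ℂ}

/-- The complexified sine mode. -/
def cSine (c : ℝ) (n : ℕ) (y : ℝ) : ℂ := sineMode c n y

theorem contDiff_cSine (c : ℝ) (n : ℕ) : ContDiff ℝ ∞ (cSine c n) :=
  Complex.ofRealCLM.contDiff.comp (contDiff_sineMode c n)

theorem deriv_deriv_cSine (c : ℝ) (n : ℕ) (y : ℝ) :
    deriv (deriv (cSine c n)) y = -((n * Real.pi / c) ^ 2 : ℝ) * cSine c n y := by
  have h1 : ∀ y, HasDerivAt (cSine c n)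
      ((√(2 / c) * (Real.cos (n * Real.pi / c * y) * (n * Real.pi / c)) : ℝ) : ℂ) y := fun y => by
    have := (((hasDerivAt_id y).const_mul (n * Real.pi / c)).sin.const_mul √(2 / c)).ofReal_comp
    simp only [mul_one, id] at this
    exact this
  have e : deriv (cSine c n) = fun y =>
      ((√(2 / c) * (Real.cos (n * Real.pi / c * y) * (n * Real.pi / c)) : ℝ) : ℂ) :=
    funext fun y => (h1 y).deriv
  have h2 := ((((hasDerivAt_id y).const_mul (n * Real.pi / c)).cos.mul_const
    (n * Real.pi / c)).const_mul √(2 / c)).ofReal_comp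
  rw [e]
  refine (HasDerivAt.deriv (by simpa only [id] using h2)).trans ?_
  simp only [cSine, sineMode]
  push_cast
  ring

theorem isH2Line_of_contDiff {α β : ℝ} (hab : α ≤ β) {g : ℝ → ℂ} (hg : ContDiff ℝ ∞ g) :
    IsH2Line (Ioo α β) g (deriv g) (deriv (deriv g)) := by
  have hg' : ContDiff ℝ ∞ (deriv g) := hg.deriv' 
  have c'' := hg'.continuous_deriv (by simp)
  exact ⟨memLp_of_continuousOn_Icc hg.continuous.continuousOn,
    memLp_of_continuousOn_Icc hg'.continuous.continuousOn,
    memLp_of_continuousOn_Icc c''.continuousOn,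
    (isPrimitive_of_hasDerivAt (fun x => (hg.differentiable (by simp) x).hasDerivAt)
      hg'.continuous).hasWeakDeriv hab,
    (isPrimitive_of_hasDerivAt (fun x => (hg'.differentiable (by simp) x).hasDerivAt)
      c'').hasWeakDeriv hab⟩

/-- The conditions on the horizontal sides come from the zeros of the sine; the remaining ones are
the one-dimensional conditions multiplied by the sine. -/
theorem dotDomain_tensor (ha : 0 < a) (hb : 0 < b) (hc : 0 < c) (n : ℕ)
    (D : LineDomain a b εp εm u u' u'') :
    DotDomain a b c εp εm (fun p => u p.1 * cSine c n p.2) (fun p => u' p.1 * cSine c n p.2)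
      (fun p => u p.1 * deriv (cSine c n) p.2) (fun p => u'' p.1 * cSine c n p.2)
      (fun p => u' p.1 * deriv (cSine c n) p.2) (fun p => u' p.1 * deriv (cSine c n) p.2)
      (fun p => u p.1 * deriv (deriv (cSine c n)) p.2) := by
  have hb' : -b < 0 := by linarith
  have hs := contDiff_cSine c n
  have s0 : cSine c n 0 = 0 := by simp [cSine, sineMode_zero]
  have sc : cSine c n c = 0 := by simp [cSine, sineMode_right hc]
  obtain ⟨Up, Vp, Um, Vm, S⟩ := D.exists_lineSides ha hb
  have tp := hasTrace_tensor (c := c) S.primUp ha.le S.aeUp D.plus.memLp' hs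
  have tm := hasTrace_tensor (c := c) S.primUm hb'.le S.aeUm D.minus.memLp' hs
  have tp' := hasTrace_tensor (c := c) S.primVp ha.le S.aeVp D.plus.memLp'' hs
  have tm' := hasTrace_tensor (c := c) S.primVm hb'.le S.aeVm D.minus.memLp'' hs
  have z0 : (fun _ : ℝ => (0 : ℂ)) = 0 := rfl
  have hJ := isH2Line_of_contDiff hc.le hs
  refine ⟨isH2_tensor D.plus hJ, isH2_tensor D.minus hJ, ?_, ?_, ?_, ?_, ?_, ?_,
    ⟨_, tp.1 0 ⟨le_rfl, ha.le⟩, ?_⟩, ⟨_, _, tp'.1 0 ⟨le_rfl, ha.le⟩, tm'.1 0 ⟨hb'.le, le_rfl⟩,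
      Eventually.of_forall fun y => ?_⟩⟩
  · simpa only [S.right, zero_mul, z0] using tp.1 a ⟨ha.le, le_rfl⟩
  · simpa only [S.left, zero_mul, z0] using tm.1 (-b) ⟨le_rfl, hb'.le⟩
  · simpa only [s0, mul_zero, z0] using tp.2 0
  · simpa only [sc, mul_zero, z0] using tp.2 c
  · simpa only [s0, mul_zero, z0] using tm.2 0
  · simpa only [sc, mul_zero, z0] using tm.2 c
  · rw [S.continuity]
    exact tm.1 0 ⟨hb'.le, le_rfl⟩
  · linear_combination cSine c n y * S.flux

end


/-! ### Integration by parts on rectangles -/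

theorem integrable_mul_of_memLp {X : Type*} [MeasurableSpace X] {μ : Measure X} {f g : X → ℂ}
    (hf : MemLp f 2 μ) (hg : MemLp g 2 μ) : Integrable (fun x => f x * g x) μ :=
  hf.integrable_mul hg

theorem tendsto_integral_mul {X : Type*} [MeasurableSpace X] {μ : Measure X} {G u : X → ℂ}
    {w : ℕ → X → ℂ} (mG : MemLp G 2 μ) (mu : MemLp u 2 μ) (mw : ∀ k, MemLp (w k) 2 μ)
    (h : Tendsto (fun k => eLpNorm (fun x => u x - w k x) 2 μ) atTop (𝓝 0)) :
    Tendsto (fun k => ∫ x, G x * w k x ∂μ) atTop (𝓝 (∫ x, G x * u x ∂μ)) := by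
  refine tendsto_integral_of_L1' _ (integrable_mul_of_memLp mG mu).1
    (Eventually.of_forall fun k => integrable_mul_of_memLp mG (mw k)) ?_
  refine tendsto_of_tendsto_of_tendsto_of_le_of_le tendsto_const_nhds
    (h := fun k => eLpNorm G 2 μ * eLpNorm (fun x => u x - w k x) 2 μ) ?_ (fun _ => zero_le)
    fun k => ?_
  · simpa using ENNReal.Tendsto.const_mul h (Or.inr mG.2.ne)
  · refine le_trans (le_of_eq ?_)
      (eLpNorm_smul_le_mul_eLpNorm (p := 2) (q := 2) (r := 1) (mu.sub (mw k)).1 mG.1)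
    rw [← eLpNorm_neg]
    congr 1
    funext x
    simp [mul_sub]

theorem memLp_of_continuous_of_isBounded {E : Type*} [PseudoMetricSpace E] [ProperSpace E]
    [MeasureSpace E] [BorelSpace E] [SecondCountableTopology E]
    [IsFiniteMeasureOnCompacts (volume : Measure E)]
    {s : Set E} (hs : Bornology.IsBounded s) (hm : MeasurableSet s) {f : E → ℂ}
    (hf : Continuous f) : MemLp f 2 (volume.restrict s) := by
  obtain ⟨C, hC⟩ := hs.isCompact_closure.exists_bound_of_continuousOn hf.continuousOn
  have : IsFiniteMeasure (volume.restrict s) := ⟨by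
    rw [Measure.restrict_apply_univ]; exact hs.measure_lt_top⟩
  refine MemLp.of_bound hf.aestronglyMeasurable C ?_
  filter_upwards [ae_restrict_mem hm] with x hx
  exact hC x (subset_closure hx)

/-- An identity for smooth functions passes to a Sobolev function and its trace. -/
theorem integral_eq_of_trace_approx {U : Set (ℝ × ℝ)} {I : Set ℝ} {γ : ℝ → ℝ × ℝ} {e : ℝ × ℝ}
    (bU : Bornology.IsBounded U) (hU : MeasurableSet U) (bI : Bornology.IsBounded I)
    (hI : MeasurableSet I) (hγ : Continuous γ) {u v G₀ G₁ : ℝ × ℝ → ℂ} {h q : ℝ → ℂ}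
    (mu : MemLp u 2 (volume.restrict U)) (mv : MemLp v 2 (volume.restrict U))
    (mh : MemLp h 2 (volume.restrict I)) (m0 : MemLp G₀ 2 (volume.restrict U))
    (m1 : MemLp G₁ 2 (volume.restrict U)) (mq : MemLp q 2 (volume.restrict I))
    {w : ℕ → ℝ × ℝ → ℂ} (sw : ∀ k, ContDiff ℝ ∞ (w k))
    (t0 : Tendsto (fun k => eLpNorm (fun p => u p - w k p) 2 (volume.restrict U)) atTop (𝓝 0))
    (t1 : Tendsto (fun k => eLpNorm (fun p => v p - fderiv ℝ (w k) p e) 2 (volume.restrict U))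
      atTop (𝓝 0))
    (t2 : Tendsto (fun k => eLpNorm (fun t => h t - w k (γ t)) 2 (volume.restrict I)) atTop (𝓝 0))
    (hs : ∀ w : ℝ × ℝ → ℂ, ContDiff ℝ ∞ w →
      ∫ p in U, (G₁ p * fderiv ℝ w p e + G₀ p * w p) = ∫ t in I, q t * w (γ t)) :
    ∫ p in U, (G₁ p * v p + G₀ p * u p) = ∫ t in I, q t * h t := by
  have mw : ∀ k, MemLp (w k) 2 (volume.restrict U) := fun k =>
    memLp_of_continuous_of_isBounded bU hU (sw k).continuous
  have mdw : ∀ k, MemLp (fun p => fderiv ℝ (w k) p e) 2 (volume.restrict U) := fun k =>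
    memLp_of_continuous_of_isBounded bU hU
      (((sw k).continuous_fderiv (by simp)).clm_apply continuous_const)
  have mtw : ∀ k, MemLp (fun t => w k (γ t)) 2 (volume.restrict I) := fun k =>
    memLp_of_continuous_of_isBounded bI hI ((sw k).continuous.comp hγ)
  have l1 := (tendsto_integral_mul m1 mv mdw t1).add (tendsto_integral_mul m0 mu mw t0)
  have l2 := tendsto_integral_mul mq mh mtw t2
  rw [integral_add (integrable_mul_of_memLp m1 mv) (integrable_mul_of_memLp m0 mu)]
  refine tendsto_nhds_unique l1 (l2.congr fun k => ?_)
  rw [← hs (w k) (sw k), integral_add (integrable_mul_of_memLp m1 (mdw k))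
    (integrable_mul_of_memLp m0 (mw k))]

section

variable {α β c : ℝ}

theorem isBounded_rect : Bornology.IsBounded (Ioo α β ×ˢ Ioo 0 c) :=
  (Metric.isBounded_Ioo _ _).prod (Metric.isBounded_Ioo _ _)

theorem measurableSet_rect : MeasurableSet (Ioo α β ×ˢ Ioo 0 c) :=
  measurableSet_Ioo.prod measurableSet_Ioo

theorem memLp_tensor_rect {m ψ : ℝ → ℂ} (hm : MemLp m 2 (volume.restrict (Ioo α β)))
    (hψ : MemLp ψ 2 (volume.restrict (Ioo 0 c))) :
    MemLp (fun p : ℝ × ℝ => m p.1 * ψ p.2) 2 (volume.restrict (Ioo α β ×ˢ Ioo 0 c)) := by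
  rw [volume_restrict_prod]; exact memLp_tensor hm hψ

theorem integrable_smooth_rect {m m' ψ ψ' : ℝ → ℂ} (hm : MemLp m 2 (volume.restrict (Ioo α β)))
    (hm' : MemLp m' 2 (volume.restrict (Ioo α β)))
    (hψ : MemLp ψ 2 (volume.restrict (Ioo 0 c))) (hψ' : MemLp ψ' 2 (volume.restrict (Ioo 0 c)))
    {w : ℝ × ℝ → ℂ} (hw : ContDiff ℝ ∞ w) (e : ℝ × ℝ) :
    Integrable (fun p : ℝ × ℝ => m p.1 * ψ p.2 * fderiv ℝ w p e + m' p.1 * ψ' p.2 * w p)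
      ((volume.restrict (Ioo α β)).prod (volume.restrict (Ioo 0 c))) := by
  rw [← volume_restrict_prod]
  exact (integrable_mul_of_memLp (memLp_tensor_rect hm hψ)
      (memLp_of_continuous_of_isBounded isBounded_rect measurableSet_rect
        ((hw.continuous_fderiv (by simp)).clm_apply continuous_const))).add
    (integrable_mul_of_memLp (memLp_tensor_rect hm' hψ')
      (memLp_of_continuous_of_isBounded isBounded_rect measurableSet_rect hw.continuous))

/-- Fubini and one-dimensional integration by parts on each horizontal line; both vertical sides
contribute. -/
theorem integral_smooth_fst (hab : α ≤ β) {g g' φ : ℝ → ℂ} (hg : IsPrimitive α β g g')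
    (mg' : MemLp g' 2 (volume.restrict (Ioo α β))) (mφ : MemLp φ 2 (volume.restrict (Ioo 0 c)))
    {w : ℝ × ℝ → ℂ} (hw : ContDiff ℝ ∞ w) :
    ∫ p in Ioo α β ×ˢ Ioo 0 c,
        (g p.1 * φ p.2 * fderiv ℝ w p (1, 0) + g' p.1 * φ p.2 * w p)
      = ∫ y in Ioo 0 c, φ y * (g β * w (β, y) - g α * w (α, y)) := by
  rw [volume_restrict_prod, integral_prod_symm _ (integrable_smooth_rect
    (memLp_of_continuousOn_Icc (hg.continuousOn hab)) mg' mφ mφ hw _)]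
  congr 1
  funext y
  have hs : IsPrimitive α β (fun x => w (x, y)) (fun x => fderiv ℝ w (x, y) (1, 0)) :=
    isPrimitive_of_hasDerivAt (fun x => hasDerivAt_slice_fst hw x y)
      (((hw.continuous_fderiv (by simp)).clm_apply continuous_const).comp (by fun_prop))
  rw [← hg.integral_mul_add_mul hab hs, ← setIntegral_Ioo_eq_intervalIntegral hab,
    ← integral_const_mul]
  congr 1
  funext x
  ring

theorem integral_smooth_snd (hc : 0 ≤ c) {m φ φ' : ℝ → ℂ} (hφ : IsPrimitive 0 c φ φ')
    (mφ' : MemLp φ' 2 (volume.restrict (Ioo 0 c))) (mm : MemLp m 2 (volume.restrict (Ioo α β)))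
    {w : ℝ × ℝ → ℂ} (hw : ContDiff ℝ ∞ w) :
    ∫ p in Ioo α β ×ˢ Ioo 0 c,
        (m p.1 * φ p.2 * fderiv ℝ w p (0, 1) + m p.1 * φ' p.2 * w p)
      = ∫ x in Ioo α β, m x * (φ c * w (x, c) - φ 0 * w (x, 0)) := by
  rw [volume_restrict_prod, integral_prod _ (integrable_smooth_rect
    mm mm (memLp_of_continuousOn_Icc (hφ.continuousOn hc)) mφ' hw _)]
  congr 1
  funext x
  have hs : IsPrimitive 0 c (fun y => w (x, y)) (fun y => fderiv ℝ w (x, y) (0, 1)) :=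
    isPrimitive_of_hasDerivAt (fun y => hasDerivAt_slice_snd hw x y)
      (((hw.continuous_fderiv (by simp)).clm_apply continuous_const).comp (by fun_prop))
  rw [← hφ.integral_mul_add_mul hc hs, ← setIntegral_Ioo_eq_intervalIntegral hc,
    ← integral_const_mul]
  congr 1
  funext y
  ring

/-! ### Integration by parts against traces -/

variable {u u₁ u₂ : ℝ × ℝ → ℂ} {h k : ℝ → ℂ}

/-- Every trace comes with its own approximating sequence, about which nothing is known on the
opposite side. A weight vanishing on that side removes its contribution, so one trace is enough. -/
theorem HasTrace.integral_right (hab : α ≤ β) (hu : IsH1 (Ioo α β ×ˢ Ioo 0 c) u u₁ u₂)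
    (hT : HasTrace (Ioo α β ×ˢ Ioo 0 c) (Ioo 0 c) (fun y => (β, y)) u u₁ u₂ h)
    {g g' φ : ℝ → ℂ} (hg : IsPrimitive α β g g')
    (mg' : MemLp g' 2 (volume.restrict (Ioo α β))) (mφ : MemLp φ 2 (volume.restrict (Ioo 0 c)))
    (h0 : g α = 0) :
    ∫ p in Ioo α β ×ˢ Ioo 0 c, (g p.1 * φ p.2 * u₁ p + g' p.1 * φ p.2 * u p)
      = ∫ y in Ioo 0 c, g β * φ y * h y := by
  obtain ⟨mh, w, sw, t0, t1, -, t3⟩ := hT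
  refine integral_eq_of_trace_approx isBounded_rect measurableSet_rect (Metric.isBounded_Ioo _ _)
    measurableSet_Ioo (by fun_prop) hu.memLp hu.memLp₁ mh (memLp_tensor_rect mg' mφ)
    (memLp_tensor_rect (memLp_of_continuousOn_Icc (hg.continuousOn hab)) mφ) (mφ.const_mul _)
    sw t0 t1 t3 fun w hw => ?_
  rw [integral_smooth_fst hab hg mg' mφ hw]
  congr 1
  funext y
  rw [h0]
  ring

theorem HasTrace.integral_left (hab : α ≤ β) (hu : IsH1 (Ioo α β ×ˢ Ioo 0 c) u u₁ u₂)
    (hT : HasTrace (Ioo α β ×ˢ Ioo 0 c) (Ioo 0 c) (fun y => (α, y)) u u₁ u₂ h)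
    {g g' φ : ℝ → ℂ} (hg : IsPrimitive α β g g')
    (mg' : MemLp g' 2 (volume.restrict (Ioo α β))) (mφ : MemLp φ 2 (volume.restrict (Ioo 0 c)))
    (h0 : g β = 0) :
    ∫ p in Ioo α β ×ˢ Ioo 0 c, (g p.1 * φ p.2 * u₁ p + g' p.1 * φ p.2 * u p)
      = ∫ y in Ioo 0 c, -g α * φ y * h y := by
  obtain ⟨mh, w, sw, t0, t1, -, t3⟩ := hT
  refine integral_eq_of_trace_approx isBounded_rect measurableSet_rect (Metric.isBounded_Ioo _ _)
    measurableSet_Ioo (by fun_prop) hu.memLp hu.memLp₁ mh (memLp_tensor_rect mg' mφ)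
    (memLp_tensor_rect (memLp_of_continuousOn_Icc (hg.continuousOn hab)) mφ) (mφ.const_mul _)
    sw t0 t1 t3 fun w hw => ?_
  rw [integral_smooth_fst hab hg mg' mφ hw]
  congr 1
  funext y
  rw [h0]
  ring

theorem HasTrace.integral_top (hc : 0 ≤ c) (hu : IsH1 (Ioo α β ×ˢ Ioo 0 c) u u₁ u₂)
    (hT : HasTrace (Ioo α β ×ˢ Ioo 0 c) (Ioo α β) (fun x => (x, c)) u u₁ u₂ h)
    {m φ φ' : ℝ → ℂ} (hφ : IsPrimitive 0 c φ φ')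
    (mφ' : MemLp φ' 2 (volume.restrict (Ioo 0 c))) (mm : MemLp m 2 (volume.restrict (Ioo α β)))
    (h0 : φ 0 = 0) :
    ∫ p in Ioo α β ×ˢ Ioo 0 c, (m p.1 * φ p.2 * u₂ p + m p.1 * φ' p.2 * u p)
      = ∫ x in Ioo α β, φ c * m x * h x := by
  obtain ⟨mh, w, sw, t0, -, t2, t3⟩ := hT
  refine integral_eq_of_trace_approx isBounded_rect measurableSet_rect (Metric.isBounded_Ioo _ _)
    measurableSet_Ioo (by fun_prop) hu.memLp hu.memLp₂ mh (memLp_tensor_rect mm mφ')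
    (memLp_tensor_rect mm (memLp_of_continuousOn_Icc (hφ.continuousOn hc))) (mm.const_mul _)
    sw t0 t2 t3 fun w hw => ?_
  rw [integral_smooth_snd hc hφ mφ' mm hw]
  congr 1
  funext x
  rw [h0]
  ring

theorem HasTrace.integral_bottom (hc : 0 ≤ c) (hu : IsH1 (Ioo α β ×ˢ Ioo 0 c) u u₁ u₂)
    (hT : HasTrace (Ioo α β ×ˢ Ioo 0 c) (Ioo α β) (fun x => (x, 0)) u u₁ u₂ h)
    {m φ φ' : ℝ → ℂ} (hφ : IsPrimitive 0 c φ φ')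
    (mφ' : MemLp φ' 2 (volume.restrict (Ioo 0 c))) (mm : MemLp m 2 (volume.restrict (Ioo α β)))
    (h0 : φ c = 0) :
    ∫ p in Ioo α β ×ˢ Ioo 0 c, (m p.1 * φ p.2 * u₂ p + m p.1 * φ' p.2 * u p)
      = ∫ x in Ioo α β, -φ 0 * m x * h x := by
  obtain ⟨mh, w, sw, t0, -, t2, t3⟩ := hT
  refine integral_eq_of_trace_approx isBounded_rect measurableSet_rect (Metric.isBounded_Ioo _ _)
    measurableSet_Ioo (by fun_prop) hu.memLp hu.memLp₂ mh (memLp_tensor_rect mm mφ')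
    (memLp_tensor_rect mm (memLp_of_continuousOn_Icc (hφ.continuousOn hc))) (mm.const_mul _)
    sw t0 t2 t3 fun w hw => ?_
  rw [integral_smooth_snd hc hφ mφ' mm hw]
  congr 1
  funext x
  rw [h0]
  ring

/-- Splitting of a function into two parts, each vanishing at one endpoint. -/
theorem IsPrimitive.exists_split (hab : α < β) {g g' : ℝ → ℂ} (hg : IsPrimitive α β g g')
    (mg' : MemLp g' 2 (volume.restrict (Ioo α β))) :
    ∃ r r' l l' : ℝ → ℂ, IsPrimitive α β r r' ∧ IsPrimitive α β l l' ∧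
      MemLp r' 2 (volume.restrict (Ioo α β)) ∧ MemLp l' 2 (volume.restrict (Ioo α β)) ∧
      (∀ x, g x = r x + l x) ∧ (∀ x, g' x = r' x + l' x) ∧
      r α = 0 ∧ l β = 0 ∧ r β = g β ∧ l α = g α := by
  have hne : (β - α : ℂ) ≠ 0 := by
    rw [← Complex.ofReal_sub]; exact Complex.ofReal_ne_zero.2 (by linarith)
  have hl : IsPrimitive α β (fun x : ℝ => g α * ((β - x) / (β - α) : ℂ))
      (fun _ => g α * (-1 / (β - α))) := by
    refine IsPrimitive.const_mul _ (isPrimitive_of_hasDerivAt (fun x => ?_) continuous_const)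
    have h1 : HasDerivAt (fun x : ℝ => (x : ℂ)) 1 x := (hasDerivAt_id x).ofReal_comp
    exact (h1.const_sub (β : ℂ)).div_const _
  refine ⟨fun x => g x - g α * ((β - x) / (β - α)), fun x => g' x - g α * (-1 / (β - α)), _, _,
    ⟨hg.1.sub hl.1, fun x hx => ?_⟩, hl, mg'.sub (memLp_const _), memLp_const _,
    fun x => by ring, fun x => by ring, ?_, ?_, ?_, ?_⟩
  · rw [intervalIntegral.integral_sub (hg.mono le_rfl hx.1 hx.2).1
      (hl.mono le_rfl hx.1 hx.2).1, hg.2 x hx]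
    have := hl.2 x hx
    rw [this]
    ring
  all_goals simp [hne]

/-- The weight is split into parts vanishing at one end each. This lets the two traces be used
separately, without a common approximating sequence. -/
theorem integral_fst_of_traces (hab : α < β) (hu : IsH1 (Ioo α β ×ˢ Ioo 0 c) u u₁ u₂)
    (hα : HasTrace (Ioo α β ×ˢ Ioo 0 c) (Ioo 0 c) (fun y => (α, y)) u u₁ u₂ h)
    (hβ : HasTrace (Ioo α β ×ˢ Ioo 0 c) (Ioo 0 c) (fun y => (β, y)) u u₁ u₂ k)
    {g g' φ : ℝ → ℂ} (hg : IsPrimitive α β g g')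
    (mg' : MemLp g' 2 (volume.restrict (Ioo α β))) (mφ : MemLp φ 2 (volume.restrict (Ioo 0 c))) :
    ∫ p in Ioo α β ×ˢ Ioo 0 c, (g p.1 * φ p.2 * u₁ p + g' p.1 * φ p.2 * u p)
      = (∫ y in Ioo 0 c, g β * φ y * k y) + ∫ y in Ioo 0 c, -g α * φ y * h y := by
  obtain ⟨r, r', l, l', pr, pl, mr, ml, e, e', r0, l0, r1, l1⟩ := hg.exists_split hab mg'
  have hr := hβ.integral_right hab.le hu pr mr mφ r0
  have hl := hα.integral_left hab.le hu pl ml mφ l0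
  rw [r1] at hr
  rw [l1] at hl
  have mC : ∀ {f f' : ℝ → ℂ}, IsPrimitive α β f f' → MemLp f 2 (volume.restrict (Ioo α β)) :=
    fun hf => memLp_of_continuousOn_Icc (hf.continuousOn hab.le)
  rw [← hr, ← hl, ← integral_add]
  · congr 1
    funext p
    rw [e, e']
    ring
  · exact (integrable_mul_of_memLp (memLp_tensor_rect (mC pr) mφ) hu.memLp₁).add
      (integrable_mul_of_memLp (memLp_tensor_rect mr mφ) hu.memLp)
  · exact (integrable_mul_of_memLp (memLp_tensor_rect (mC pl) mφ) hu.memLp₁).add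
      (integrable_mul_of_memLp (memLp_tensor_rect ml mφ) hu.memLp)

theorem integral_snd_of_traces (hc : 0 < c) (hu : IsH1 (Ioo α β ×ˢ Ioo 0 c) u u₁ u₂)
    (hb : HasTrace (Ioo α β ×ˢ Ioo 0 c) (Ioo α β) (fun x => (x, 0)) u u₁ u₂ 0)
    (ht : HasTrace (Ioo α β ×ˢ Ioo 0 c) (Ioo α β) (fun x => (x, c)) u u₁ u₂ 0)
    {m φ φ' : ℝ → ℂ} (hφ : IsPrimitive 0 c φ φ')
    (mφ' : MemLp φ' 2 (volume.restrict (Ioo 0 c))) (mm : MemLp m 2 (volume.restrict (Ioo α β))) :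
    ∫ p in Ioo α β ×ˢ Ioo 0 c, (m p.1 * φ p.2 * u₂ p + m p.1 * φ' p.2 * u p) = 0 := by
  obtain ⟨r, r', l, l', pr, pl, mr, ml, e, e', r0, l0, r1, l1⟩ := hφ.exists_split hc mφ'
  have hr := ht.integral_top hc.le hu pr mr mm r0
  have hl := hb.integral_bottom hc.le hu pl ml mm l0
  have mC : ∀ {f f' : ℝ → ℂ}, IsPrimitive 0 c f f' → MemLp f 2 (volume.restrict (Ioo 0 c)) :=
    fun hf => memLp_of_continuousOn_Icc (hf.continuousOn hc.le)
  simp only [Pi.zero_apply, mul_zero, integral_zero] at hr hl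
  rw [← add_zero (0 : ℂ)]
  nth_rewrite 1 [← hr]
  rw [← hl, ← integral_add]
  · congr 1
    funext p
    rw [e, e']
    ring
  · exact (integrable_mul_of_memLp (memLp_tensor_rect mm (mC pr)) hu.memLp₂).add
      (integrable_mul_of_memLp (memLp_tensor_rect mm mr) hu.memLp)
  · exact (integrable_mul_of_memLp (memLp_tensor_rect mm (mC pl)) hu.memLp₂).add
      (integrable_mul_of_memLp (memLp_tensor_rect mm ml) hu.memLp)

/-- The weak `y`-derivative, restricted to almost every line. -/
theorem HasWeakDeriv.ae_integral_snd_eq_zero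
    (hu : HasWeakDeriv (Ioo α β ×ˢ Ioo 0 c) (0, 1) u u₂)
    (mu : MemLp u 2 (volume.restrict (Ioo α β ×ˢ Ioo 0 c)))
    (mu₂ : MemLp u₂ 2 (volume.restrict (Ioo α β ×ˢ Ioo 0 c))) {θ : ℝ → ℝ}
    (t1 : ContDiff ℝ ∞ θ) (t2 : HasCompactSupport θ) (t3 : tsupport θ ⊆ Ioo 0 c) :
    ∀ᵐ x ∂volume.restrict (Ioo α β),
      ∫ y in Ioo 0 c, (deriv θ y • u (x, y) + θ y • u₂ (x, y)) = 0 := by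
  have mθ : ∀ {χ : ℝ → ℝ}, Continuous χ →
      MemLp (fun y => (χ y : ℂ)) 2 (volume.restrict (Ioo 0 c)) := fun hχ =>
    memLp_of_continuousOn_Icc (Complex.continuous_ofReal.comp hχ).continuousOn
  have iD : Integrable (fun p : ℝ × ℝ => deriv θ p.2 • u p + θ p.2 • u₂ p)
      ((volume.restrict (Ioo α β)).prod (volume.restrict (Ioo 0 c))) := by
    have h1 := integrable_mul_of_memLp (memLp_tensor_rect (memLp_const (1 : ℂ))
      (mθ (t1.continuous_deriv (by simp)))) mu
    have h2 := integrable_mul_of_memLp (memLp_tensor_rect (memLp_const (1 : ℂ))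
      (mθ t1.continuous)) mu₂
    have h3 := h1.add h2
    rw [volume_restrict_prod] at h3
    refine h3.congr (Eventually.of_forall fun p => ?_)
    simp
  have iF := iD.integral_prod_left
  rw [ae_restrict_iff' measurableSet_Ioo]
  refine isOpen_Ioo.ae_eq_zero_of_integral_contDiff_smul_eq_zero
    (locallyIntegrableOn_of_locallyIntegrable_restrict iF.locallyIntegrable)
    fun χ c1 c2 c3 => ?_
  -- Products `χ ⊗ θ` are test functions on the rectangle; letting `χ` vary localizes the identity
  -- in `x`.
  have hsm : ContDiff ℝ ∞ fun p : ℝ × ℝ => χ p.1 * θ p.2 :=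
    (c1.comp contDiff_fst).mul (t1.comp contDiff_snd)
  have hts : tsupport (fun p : ℝ × ℝ => χ p.1 * θ p.2) ⊆ tsupport χ ×ˢ tsupport θ := by
    refine closure_minimal (fun p hp => ?_) ((isClosed_tsupport χ).prod (isClosed_tsupport θ))
    have hp : χ p.1 * θ p.2 ≠ 0 := hp
    exact ⟨subset_tsupport χ (left_ne_zero_of_mul hp), subset_tsupport θ (right_ne_zero_of_mul hp)⟩
  have key := hu _ hsm ((c2.prod t2).of_isClosed_subset (isClosed_tsupport _) hts)
    (hts.trans (prod_mono c3 t3))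
  have e : ∀ p, fderiv ℝ (fun p : ℝ × ℝ => χ p.1 * θ p.2) p (0, 1) = χ p.1 * deriv θ p.2 :=
    fun p => (hasDerivAt_slice_snd hsm p.1 p.2).unique
      (((t1.differentiable (by simp) p.2).hasDerivAt).const_mul (χ p.1))
  simp only [e] at key
  have iu : Integrable (fun p : ℝ × ℝ => (χ p.1 * deriv θ p.2) • u p)
      (volume.restrict (Ioo α β ×ˢ Ioo 0 c)) := by
    have := integrable_dtest_smul mu hsm ((c2.prod t2).of_isClosed_subset (isClosed_tsupport _)
      hts) (0, 1)
    simpa only [e] using this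
  have iu₂ := integrable_test_smul mu₂ hsm.continuous
    ((c2.prod t2).of_isClosed_subset (isClosed_tsupport _) hts)
  rw [← setIntegral_eq_integral_of_forall_compl_eq_zero (s := Ioo α β)]
  · rw [eq_neg_iff_add_eq_zero, ← integral_add iu iu₂, volume_restrict_prod, integral_prod] at key
    · rw [← key]
      congr 1
      funext x
      rw [← integral_smul]
      congr 1
      funext y
      simp only [smul_add, smul_smul]
    · rw [← volume_restrict_prod]
      exact iu.add iu₂
  · intro x hx
    rw [image_eq_zero_of_notMem_tsupport (fun h' => hx (c3 h')), zero_smul]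

/-- Partial integration of a weak `y`-derivative against a smooth function vanishing at the
endpoints. -/
theorem HasWeakDeriv.integral_snd (hc : 0 < c)
    (hu : HasWeakDeriv (Ioo α β ×ˢ Ioo 0 c) (0, 1) u u₂)
    (mu : MemLp u 2 (volume.restrict (Ioo α β ×ˢ Ioo 0 c)))
    (mu₂ : MemLp u₂ 2 (volume.restrict (Ioo α β ×ˢ Ioo 0 c)))
    {m φ φ' : ℝ → ℂ} (hφ : IsPrimitive 0 c φ φ')
    (mφ' : MemLp φ' 2 (volume.restrict (Ioo 0 c)))
    (mm : MemLp m 2 (volume.restrict (Ioo α β)))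
    (h0 : φ 0 = 0) (h1 : φ c = 0) :
    ∫ p in Ioo α β ×ˢ Ioo 0 c, (m p.1 * φ p.2 * u₂ p + m p.1 * φ' p.2 * u p) = 0 := by
  have mφ : MemLp φ 2 (volume.restrict (Ioo 0 c)) :=
    memLp_of_continuousOn_Icc (hφ.continuousOn hc.le)
  have imu : Integrable (fun p => m p.1 * u p)
      ((volume.restrict (Ioo α β)).prod (volume.restrict (Ioo 0 c))) := by
    have := integrable_mul_of_memLp (memLp_tensor_rect mm (memLp_const (1 : ℂ))) mu
    simpa [volume_restrict_prod] using this
  have imu₂ : Integrable (fun p => m p.1 * u₂ p)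
      ((volume.restrict (Ioo α β)).prod (volume.restrict (Ioo 0 c))) := by
    have := integrable_mul_of_memLp (memLp_tensor_rect mm (memLp_const (1 : ℂ))) mu₂
    simpa [volume_restrict_prod] using this
  -- Integrating out `x` against `m` leaves a function of `y` with a weak derivative. It has an
  -- absolutely continuous representative up to the endpoints, so the zeros of `φ` remove the
  -- boundary terms and no trace is needed.
  have hG : HasWeakDeriv (Ioo 0 c) 1 (fun y => ∫ x in Ioo α β, m x * u (x, y))
      (fun y => ∫ x in Ioo α β, m x * u₂ (x, y)) := by
    intro θ t1 t2 t3
    have hF := hu.ae_integral_snd_eq_zero mu mu₂ t1 t2 t3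
    have cb : ∀ {χ : ℝ → ℝ}, Continuous χ → HasCompactSupport χ → ∀ {v : ℝ × ℝ → ℂ},
        Integrable v ((volume.restrict (Ioo α β)).prod (volume.restrict (Ioo 0 c))) →
        Integrable (fun p => χ p.2 • v p)
          ((volume.restrict (Ioo α β)).prod (volume.restrict (Ioo 0 c))) := by
      intro χ cχ hχ v iv
      obtain ⟨B, hB⟩ := hχ.exists_bound_of_continuous cχ
      exact iv.bdd_smul B (cχ.comp continuous_snd).aestronglyMeasurable
        (Eventually.of_forall fun p => hB p.2)
    have i1 := cb (t1.continuous_deriv (by simp)) t2.deriv imu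
    have i2 := cb t1.continuous t2 imu₂
    simp only [fderiv_apply_one]
    have e0 : ∫ x in Ioo α β, ∫ y in Ioo 0 c, (deriv θ y • (m x * u (x, y))
        + θ y • (m x * u₂ (x, y))) = 0 := by
      rw [integral_congr_ae (g := fun _ => (0 : ℂ)), integral_zero]
      filter_upwards [hF] with x hx
      have : ∀ y, deriv θ y • (m x * u (x, y)) + θ y • (m x * u₂ (x, y))
          = m x * (deriv θ y • u (x, y) + θ y • u₂ (x, y)) := fun y => by
        simp only [Complex.real_smul]; ring
      simp only [this]
      rw [integral_const_mul, hx, mul_zero]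
    rw [eq_neg_iff_add_eq_zero, ← e0]
    simp only [← integral_smul]
    rw [← integral_prod_symm _ i1, ← integral_prod_symm _ i2, ← integral_add i1 i2]
    exact integral_prod _ (i1.add i2)
  obtain ⟨V, pV, aV⟩ := exists_isPrimitive_of_hasWeakDeriv hc imu.integral_prod_right
    imu₂.integral_prod_right hG
  have key := hφ.integral_mul_add_mul hc.le pV
  rw [h0, h1, zero_mul, zero_mul, sub_zero, ← setIntegral_Ioo_eq_intervalIntegral hc.le] at key
  rw [← key, volume_restrict_prod, integral_prod_symm]
  · refine integral_congr_ae ?_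
    filter_upwards [aV, imu.prod_left_ae, imu₂.prod_left_ae] with y hy i1 i2
    rw [← hy, ← integral_const_mul, ← integral_const_mul, ← integral_add (i2.const_mul _)
      (i1.const_mul _)]
    congr 1
    funext x
    ring
  · rw [← volume_restrict_prod]
    exact (integrable_mul_of_memLp (memLp_tensor_rect mm mφ) mu₂).add
      (integrable_mul_of_memLp (memLp_tensor_rect mm mφ') mu)

end


/-! ### Green's formula -/

theorem memLp_continuousOn_mul {α β : ℝ} {q h : ℝ → ℂ} (hq : ContinuousOn q (Icc α β))
    (hh : MemLp h 2 (volume.restrict (Ioo α β))) :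
    MemLp (fun x => q x * h x) 2 (volume.restrict (Ioo α β)) := by
  obtain ⟨C, hC⟩ := isCompact_Icc.exists_bound_of_continuousOn hq
  exact memLp_bdd_mul hh ((hq.mono Ioo_subset_Icc_self).aestronglyMeasurable measurableSet_Ioo)
    ((ae_restrict_mem measurableSet_Ioo).mono fun x hx => hC x (Ioo_subset_Icc_self hx))

theorem memLp_conj {X : Type*} [MeasurableSpace X] {μ : Measure X} {f : X → ℂ} (hf : MemLp f 2 μ) :
    MemLp (fun x => starRingEnd ℂ (f x)) 2 μ := hf.star

section

variable {K a b c εp εm : ℝ}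

/-- The integrand of the difference of the two sides of Green's formula on one side of the
interface. -/
def greenIntegrand (K c : ℝ) (n : ℕ) (v v' v'' : ℝ → ℂ) (u u₁ u₁₁ u₂₂ : ℝ × ℝ → ℂ) (p : ℝ × ℝ) :
    ℂ :=
  starRingEnd ℂ (v p.1 * cSine c n p.2) * laplaceBeltrami K u₁ u₁₁ u₂₂ p
    + starRingEnd ℂ (lineExpr K c n v v' v'' p.1 * cSine c n p.2) * u p

theorem conj_cSine (c : ℝ) (n : ℕ) (y : ℝ) : starRingEnd ℂ (cSine c n y) = cSine c n y :=
  Complex.conj_ofReal _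

theorem continuousOn_jac_ofReal (K : ℝ) (s : Set ℝ) : ContinuousOn (fun x => (jac K x : ℂ)) s :=
  (Complex.continuous_ofReal.comp (continuous_jac K)).continuousOn

/-- The flux `f ū'` or the weighted function `f ū` as a primitive. -/
theorem isPrimitive_jac_mul_conj {α β : ℝ} (hab : α ≤ β) {V v : ℝ → ℂ} (pV : IsPrimitive α β V v)
    (mv : MemLp v 2 (volume.restrict (Ioo α β))) :
    IsPrimitive α β (fun x => (jac K x : ℂ) * starRingEnd ℂ (V x))
      (fun x => (jac K x : ℂ) * starRingEnd ℂ (v x)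
        + ((deriv (jac K) x : ℝ) : ℂ) * starRingEnd ℂ (V x)) ∧
    MemLp (fun x => (jac K x : ℂ) * starRingEnd ℂ (v x)
        + ((deriv (jac K) x : ℝ) : ℂ) * starRingEnd ℂ (V x)) 2 (volume.restrict (Ioo α β)) :=
  ⟨(isPrimitive_jac K α β).mul hab pV.star,
    (memLp_continuousOn_mul (continuousOn_jac_ofReal K _) (memLp_conj mv)).add
      (memLp_continuousOn_mul
        (Complex.continuous_ofReal.comp (continuous_deriv_jac K)).continuousOn
        (memLp_of_continuousOn_Icc (pV.star.continuousOn hab)))⟩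

/-- Up to rewriting, the integrand combines two integrations by parts in `x`, kept for the
interface, with two in `y` that give zero. The latter carry the weight `V̄ / f`, which is the
density `f` times the factor `1 / f²` of the second derivative in `y`. -/
theorem integral_greenIntegrand {α β : ℝ} (hj : ∀ x ∈ Icc α β, 0 < jac K x) (hab : α < β)
    (hc : 0 < c) (n : ℕ) {v v' v'' V Y : ℝ → ℂ} (mv' : MemLp v' 2 (volume.restrict (Ioo α β)))
    (mv'' : MemLp v'' 2 (volume.restrict (Ioo α β)))
    (pV : IsPrimitive α β V v') (pY : IsPrimitive α β Y v'')
    (aV : v =ᵐ[volume.restrict (Ioo α β)] V) (aY : v' =ᵐ[volume.restrict (Ioo α β)] Y)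
    {u u₁ u₂ u₁₁ u₁₂ u₂₁ u₂₂ : ℝ × ℝ → ℂ}
    (h2 : IsH2 (Ioo α β ×ˢ Ioo 0 c) u u₁ u₂ u₁₁ u₁₂ u₂₁ u₂₂)
    (hb : HasTrace (Ioo α β ×ˢ Ioo 0 c) (Ioo α β) (fun x => (x, 0)) u u₁ u₂ 0)
    (ht : HasTrace (Ioo α β ×ˢ Ioo 0 c) (Ioo α β) (fun x => (x, c)) u u₁ u₂ 0) :
    ∫ p in Ioo α β ×ˢ Ioo 0 c, (jac K p.1 : ℂ) * greenIntegrand K c n v v' v'' u u₁ u₁₁ u₂₂ p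
      = (∫ p in Ioo α β ×ˢ Ioo 0 c, ((jac K p.1 : ℂ) * starRingEnd ℂ (V p.1) * cSine c n p.2 * u₁₁ p
          + ((jac K p.1 : ℂ) * starRingEnd ℂ (v' p.1)
            + ((deriv (jac K) p.1 : ℝ) : ℂ) * starRingEnd ℂ (V p.1)) * cSine c n p.2 * u₁ p))
        - ∫ p in Ioo α β ×ˢ Ioo 0 c, ((jac K p.1 : ℂ) * starRingEnd ℂ (Y p.1) * cSine c n p.2 * u₁ p
          + ((jac K p.1 : ℂ) * starRingEnd ℂ (v'' p.1)
            + ((deriv (jac K) p.1 : ℝ) : ℂ) * starRingEnd ℂ (Y p.1)) * cSine c n p.2 * u p) := by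
  obtain ⟨pg, mg'⟩ := isPrimitive_jac_mul_conj (K := K) hab.le pV mv'
  obtain ⟨pk, mk'⟩ := isPrimitive_jac_mul_conj (K := K) hab.le pY mv''
  have hs := isH2Line_of_contDiff (α := 0) hc.le (contDiff_cSine c n)
  have cs := contDiff_cSine c n
  have cs' : ContDiff ℝ ∞ (deriv (cSine c n)) := cs.deriv'
  have ps : IsPrimitive 0 c (cSine c n) (deriv (cSine c n)) :=
    isPrimitive_of_hasDerivAt (fun x => (cs.differentiable (by simp) x).hasDerivAt) cs'.continuous
  have ps' : IsPrimitive 0 c (deriv (cSine c n)) (deriv (deriv (cSine c n))) :=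
    isPrimitive_of_hasDerivAt (fun x => (cs'.differentiable (by simp) x).hasDerivAt)
      (cs'.continuous_deriv (by simp))
  have cm : ContinuousOn (fun x => ((jac K x : ℂ))⁻¹ * starRingEnd ℂ (V x)) (Icc α β) :=
    ((continuousOn_jac_ofReal K _).inv₀ fun x hx => Complex.ofReal_ne_zero.2 (hj x hx).ne').mul
      (pV.star.continuousOn hab.le)
  have mm := memLp_of_continuousOn_Icc (p := 2) cm
  have mg := memLp_of_continuousOn_Icc (p := 2) (pg.continuousOn hab.le)
  have mk := memLp_of_continuousOn_Icc (p := 2) (pk.continuousOn hab.le)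
  -- Here the sine itself vanishes at both ends, so no trace of `u₂` is used. In `E4` the derivative
  -- of the sine does not vanish there, but `u` has zero trace.
  have E3 := h2.snd.deriv₂.integral_snd hc h2.snd.memLp h2.snd.memLp₂ ps hs.memLp' mm
    (by simp [cSine, sineMode_zero]) (by simp [cSine, sineMode_right hc])
  have E4 := integral_snd_of_traces hc h2.base hb ht ps' hs.memLp'' mm
  have T : ∀ {m ψ : ℝ → ℂ} {w : ℝ × ℝ → ℂ}, MemLp m 2 (volume.restrict (Ioo α β)) →
      MemLp ψ 2 (volume.restrict (Ioo 0 c)) → MemLp w 2 (volume.restrict (Ioo α β ×ˢ Ioo 0 c)) →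
      Integrable (fun p : ℝ × ℝ => m p.1 * ψ p.2 * w p) (volume.restrict (Ioo α β ×ˢ Ioo 0 c)) :=
    fun hm hψ hw => integrable_mul_of_memLp (memLp_tensor_rect hm hψ) hw
  have i1 := (T mg hs.memLp h2.fst.memLp₁).add (T mg' hs.memLp h2.fst.memLp)
  have i2 := (T mk hs.memLp h2.fst.memLp).add (T mk' hs.memLp h2.base.memLp)
  have i3 := (T mm hs.memLp h2.snd.memLp₂).add (T mm hs.memLp' h2.snd.memLp)
  have i4 := (T mm hs.memLp' h2.base.memLp₂).add (T mm hs.memLp'' h2.base.memLp)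
  rw [← sub_zero (_ - _), ← E4, ← add_zero (_ - _), ← E3]
  rw [← integral_sub (by exact i1) (by exact i2), ← integral_sub (by exact i1.sub i2) (by exact i4),
    ← integral_add (by exact (i1.sub i2).sub i4) (by exact i3)]
  refine integral_congr_ae ?_
  have aV' := ae_eq_comp_fst (ν := volume.restrict (Ioo 0 c)) aV
  have aY' := ae_eq_comp_fst (ν := volume.restrict (Ioo 0 c)) aY
  rw [← volume_restrict_prod] at aV' aY'
  filter_upwards [aV', aY', ae_restrict_mem measurableSet_rect] with p hV hY hp
  have hne : (jac K p.1 : ℂ) ≠ 0 :=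
    Complex.ofReal_ne_zero.2 (hj p.1 (Ioo_subset_Icc_self hp.1)).ne'
  simp only [greenIntegrand, laplaceBeltrami, lineExpr, map_mul, map_add, map_sub, map_neg,
    Complex.conj_ofReal, conj_cSine, deriv_deriv_cSine, hV, hY]
  push_cast
  field_simp
  ring

theorem rectMeasure_eq (K a b c : ℝ) : rectMeasure K a b c =
    (volume.restrict (Ioo (-b) a ×ˢ Ioo 0 c)).withDensity fun p => ENNReal.ofReal (jac K p.1) := by
  rw [rectMeasure, lineMeasure, prod_withDensity_left (measurable_jac K).ennreal_ofReal,
    volume_restrict_prod]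

theorem IsAdmissible.integral_rectMeasure (ad : IsAdmissible K a b) {g : ℝ × ℝ → ℂ}
    (hg : Integrable g (rectMeasure K a b c)) :
    ∫ p, g p ∂rectMeasure K a b c = (∫ p in Ioo 0 a ×ˢ Ioo 0 c, (jac K p.1 : ℂ) * g p)
      + ∫ p in Ioo (-b) 0 ×ˢ Ioo 0 c, (jac K p.1 : ℂ) * g p := by
  have hmeas : Measurable fun p : ℝ × ℝ => ENNReal.ofReal (jac K p.1) :=
    (measurable_jac K).ennreal_ofReal.comp measurable_fst
  have e : ∀ᵐ p : ℝ × ℝ ∂volume.restrict (Ioo (-b) a ×ˢ Ioo 0 c),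
      (ENNReal.ofReal (jac K p.1)).toReal • g p = (jac K p.1 : ℂ) * g p := by
    filter_upwards [ae_restrict_mem (measurableSet_Ioo.prod measurableSet_Ioo)] with p hp
    rw [ENNReal.toReal_ofReal (ad.jac_pos (Ioo_subset_Icc_self hp.1)).le, Complex.real_smul]
  rw [rectMeasure_eq] at hg ⊢
  rw [integrable_withDensity_iff_integrable_smul' hmeas (by simp)] at hg
  rw [integral_withDensity_eq_integral_toReal_smul hmeas (by simp), integral_congr_ae e]
  have hg' := hg.congr e
  have hsplit : (volume.restrict (Ioo (-b) a ×ˢ Ioo 0 c) : Measure (ℝ × ℝ))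
      = volume.restrict (Ioo 0 a ×ˢ Ioo 0 c ∪ Ioo (-b) 0 ×ˢ Ioo 0 c) := by
    rw [← union_prod, volume_restrict_prod, volume_restrict_prod, restrict_split ad.a_pos ad.b_pos]
  rw [hsplit] at hg' ⊢
  refine setIntegral_union ?_ measurableSet_rect (hg'.mono_measure
    (Measure.restrict_mono subset_union_left le_rfl)) (hg'.mono_measure
    (Measure.restrict_mono subset_union_right le_rfl))
  rw [Set.disjoint_left]
  rintro p ⟨h1, _⟩ ⟨h2, _⟩
  exact lt_asymm h1.1 h2.2

theorem memLp_cSine (c : ℝ) (n : ℕ) : MemLp (cSine c n) 2 (volume.restrict (Ioo 0 c)) :=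
  memLp_sineMode c n

/-- The operator `ψ ↦ ψ ⊗ φ_n`. -/
def modeOp (K a b c : ℝ) (n : ℕ) : L2Line K a b →L[ℂ] L2Rect K a b c :=
  tensorOp (lineMeasure K a b) (cSine c n) (memLp_cSine c n)

theorem modeOp_coeFn (n : ℕ) (ψ : L2Line K a b) :
    modeOp K a b c n ψ =ᵐ[rectMeasure K a b c] fun p => ψ p.1 * cSine c n p.2 :=
  tensorOp_coeFn (memLp_cSine c n) ψ

/-- Green's formula against a separated function. Terms on the outer vertical sides vanish by the
Dirichlet conditions on `v` and `u`. At the interface, continuity of one function pairs with the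
flux condition of the other, and the two sides cancel. -/
theorem inner_modeOp_dot (ad : IsAdmissible K a b) (hc : 0 < c) (n : ℕ)
    {p : L2Line K a b × L2Line K a b} (hp : p ∈ lineGraph K a b c εp εm n)
    {q : L2Rect K a b c × L2Rect K a b c} (hq : q ∈ dotGraph K a b c εp εm) :
    inner ℂ (modeOp K a b c n p.1) q.2 = inner ℂ (modeOp K a b c n p.2) q.1 := by
  obtain ⟨v, v', v'', D, hv, hv'⟩ := hp
  obtain ⟨u, u₁, u₂, u₁₁, u₁₂, u₂₁, u₂₂, E, hu, hu'⟩ := hq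
  obtain ⟨Up, Vp, Um, Vm, S⟩ := D.exists_lineSides ad.a_pos ad.b_pos
  have ha := ad.a_pos
  have hb' : -b < 0 := by linarith [ad.b_pos]
  rw [← sub_eq_zero, L2.inner_def, L2.inner_def, ← integral_sub (L2.integrable_inner _ _)
    (L2.integrable_inner _ _)]
  have hae : (fun r => inner ℂ (modeOp K a b c n p.1 r) (q.2 r)
      - inner ℂ (modeOp K a b c n p.2 r) (q.1 r)) =ᵐ[rectMeasure K a b c]
      fun r => -((coef εp εm r.1 : ℂ) * greenIntegrand K c n v v' v'' u u₁ u₁₁ u₂₂ r) := by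
    filter_upwards [modeOp_coeFn n p.1, modeOp_coeFn n p.2, hu, hu',
      ae_eq_comp_fst (ν := volume.restrict (Ioo 0 c)) hv,
      ae_eq_comp_fst (ν := volume.restrict (Ioo 0 c)) hv'] with r h1 h2 h3 h4 h5 h6
    rw [RCLike.inner_apply, RCLike.inner_apply, h1, h2, h3, h4, h5, h6]
    simp only [greenIntegrand, map_mul, Complex.conj_ofReal]
    ring
  have hint := ((L2.integrable_inner (𝕜 := ℂ) (modeOp K a b c n p.1) q.2).sub
    (L2.integrable_inner (𝕜 := ℂ) (modeOp K a b c n p.2) q.1)).congr hae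
  rw [integral_congr_ae hae, ad.integral_rectMeasure hint]
  have side : ∀ {α β : ℝ} {ε : ℝ}, (∀ x ∈ Ioo α β, coef εp εm x = ε) →
      ∫ r in Ioo α β ×ˢ Ioo 0 c, (jac K r.1 : ℂ) *
        -((coef εp εm r.1 : ℂ) * greenIntegrand K c n v v' v'' u u₁ u₁₁ u₂₂ r)
      = -ε * ∫ r in Ioo α β ×ˢ Ioo 0 c,
        (jac K r.1 : ℂ) * greenIntegrand K c n v v' v'' u u₁ u₁₁ u₂₂ r := by
    intro α β ε hε
    rw [← integral_const_mul]
    refine setIntegral_congr_fun measurableSet_rect fun r hr => ?_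
    simp only [hε r.1 hr.1]
    ring
  obtain ⟨h, hp0, hm0⟩ := E.continuity
  obtain ⟨k, l, kp, lm, kl⟩ := E.flux
  have mh := hp0.1
  have mk := kp.1
  have ml := lm.1
  have ms := memLp_cSine c n
  rw [side (ε := εp) fun x hx => coef_of_pos hx.1,
    side (ε := -εm) fun x hx => coef_of_nonpos hx.2.le,
    integral_greenIntegrand (fun x hx => ad.jac_pos ⟨by linarith [hx.1], hx.2⟩) ha hc n
      D.plus.memLp' D.plus.memLp'' S.primUp S.primVp S.aeUp S.aeVp E.plus E.bottom_plus E.top_plus,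
    integral_greenIntegrand (fun x hx => ad.jac_pos ⟨hx.1, by linarith [hx.2]⟩) hb' hc n
      D.minus.memLp' D.minus.memLp'' S.primUm S.primVm S.aeUm S.aeVm E.minus E.bottom_minus
      E.top_minus]
  obtain ⟨p1, m1⟩ := isPrimitive_jac_mul_conj (K := K) ha.le S.primUp D.plus.memLp'
  obtain ⟨p2, m2⟩ := isPrimitive_jac_mul_conj (K := K) ha.le S.primVp D.plus.memLp''
  obtain ⟨p3, m3⟩ := isPrimitive_jac_mul_conj (K := K) hb'.le S.primUm D.minus.memLp'
  obtain ⟨p4, m4⟩ := isPrimitive_jac_mul_conj (K := K) hb'.le S.primVm D.minus.memLp''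
  rw [kp.integral_left ha.le E.plus.fst p1 m1 ms (by simp [S.right]),
    lm.integral_right hb'.le E.minus.fst p3 m3 ms (by simp [S.left]),
    integral_fst_of_traces ha E.plus.base hp0 E.right p2 m2 ms,
    integral_fst_of_traces hb' E.minus.base E.left hm0 p4 m4 ms]
  have ek : ∫ y in Ioo 0 c, cSine c n y * (εp * k y + εm * l y) = 0 := by
    rw [integral_congr_ae (g := fun _ => (0 : ℂ)), integral_zero]
    filter_upwards [kl] with y hy
    rw [hy]; ring
  have e1 : ∀ (z : ℂ) (f : ℝ → ℂ), ∫ y in Ioo 0 c, z * cSine c n y * f y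
      = z * ∫ y in Ioo 0 c, cSine c n y * f y := fun z f => by
    rw [← integral_const_mul]; simp only [mul_assoc]
  have e2 : (εp : ℂ) * (∫ y in Ioo 0 c, cSine c n y * k y)
      + εm * (∫ y in Ioo 0 c, cSine c n y * l y) = 0 := by
    rw [← ek, ← integral_const_mul, ← integral_const_mul, ← integral_add]
    · congr 1
      funext y
      ring
    · exact (integrable_mul_of_memLp ms mk).const_mul _
    · exact (integrable_mul_of_memLp ms ml).const_mul _
  have e3 : (εp : ℂ) * starRingEnd ℂ (Vp 0) = -(εm * starRingEnd ℂ (Vm 0)) := by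
    have := congrArg (starRingEnd ℂ) S.flux
    simpa using this
  simp only [e1, Pi.zero_apply, mul_zero, integral_zero, S.continuity]
  push_cast
  -- The term with `e2` pairs the flux of `u` with the common value of `v`; the term with `e3` pairs
  -- the flux of `v` with the common trace of `u`.
  linear_combination (jac K 0 : ℂ) * starRingEnd ℂ (Um 0) * e2
    - (jac K 0 : ℂ) * (∫ y in Ioo 0 c, cSine c n y * h y) * e3

end


/-! ### The decomposition over the sine modes -/

section

variable {K a b c εp εm : ℝ}

theorem integral_conj_cSine_mul (hc : 0 < c) {m n : ℕ} (hm : m ≠ 0) :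
    ∫ y in Ioo 0 c, starRingEnd ℂ (cSine c m y) * cSine c n y = if m = n then 1 else 0 := by
  have := congrArg (fun r : ℝ => (r : ℂ)) (integral_sineMode_mul hc (m := m) (n := n) hm)
  simp only [← integral_complex_ofReal, Complex.ofReal_mul] at this
  simp only [conj_cSine]
  refine this.trans ?_
  split_ifs <;> simp

theorem inner_modeOp (hc : 0 < c) (m n : ℕ+) (ψ χ : L2Line K a b) :
    inner ℂ (modeOp K a b c m ψ) (modeOp K a b c n χ) = if m = n then inner ℂ ψ χ else 0 := by
  refine (inner_tensorOp (memLp_cSine c m) (memLp_cSine c n) ψ χ).trans ?_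
  rw [integral_conj_cSine_mul hc m.ne_zero]
  by_cases h : m = n
  · simp [h]
  · have : (m : ℕ) ≠ n := fun h' => h (PNat.eq h')
    simp [h, this]

/-- The operator `Ψ ↦ (φ_n, Ψ(x, ·))`. -/
def modeCoeff (K a b c : ℝ) (n : ℕ) : L2Rect K a b c →L[ℂ] L2Line K a b :=
  ContinuousLinearMap.adjoint (modeOp K a b c n)

theorem inner_modeCoeff (n : ℕ) (ψ : L2Line K a b) (Ψ : L2Rect K a b c) :
    inner ℂ ψ (modeCoeff K a b c n Ψ) = inner ℂ (modeOp K a b c n ψ) Ψ :=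
  ContinuousLinearMap.adjoint_inner_right _ _ _

theorem modeCoeff_coeFn (n : ℕ) (Ψ : L2Rect K a b c) :
    modeCoeff K a b c n Ψ =ᵐ[lineMeasure K a b]
      fun x => ∫ y in Ioo 0 c, (sineMode c n y : ℂ) * Ψ (x, y) := by
  refine (adjoint_tensorOp_coeFn (memLp_cSine c n) Ψ).trans (Eventually.of_forall fun x => ?_)
  simp only [conj_cSine]
  rfl

theorem modeCoeff_modeOp (hc : 0 < c) (n : ℕ+) (ψ : L2Line K a b) :
    modeCoeff K a b c n (modeOp K a b c n ψ) = ψ :=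
  ext_inner_left ℂ fun χ => by rw [inner_modeCoeff, inner_modeOp hc, if_pos rfl]

theorem modeCoeff_modeOp_of_ne (hc : 0 < c) {m n : ℕ+} (h : m ≠ n) (ψ : L2Line K a b) :
    modeCoeff K a b c m (modeOp K a b c n ψ) = 0 :=
  ext_inner_left ℂ fun χ => by rw [inner_modeCoeff, inner_modeOp hc, if_neg h, inner_zero_right]

/-- There are countably many modes, so outside one null set of `x` all sine coefficients of the
slice vanish, and completeness of the sines applies to it. -/
theorem eq_zero_of_modeCoeff_eq_zero (hc : 0 < c) {Ψ : L2Rect K a b c}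
    (h : ∀ n : ℕ+, modeCoeff K a b c n Ψ = 0) : Ψ = 0 := by
  have h1 : ∀ᵐ x ∂lineMeasure K a b, ∀ n : ℕ+,
      ∫ y in Ioo 0 c, (sineMode c n y : ℂ) * Ψ (x, y) = 0 := by
    refine ae_all_iff.2 fun n => ?_
    have h2 := modeCoeff_coeFn (n : ℕ) Ψ
    rw [h n] at h2
    filter_upwards [h2, Lp.coeFn_zero ℂ 2 (lineMeasure K a b)] with x e1 e2
    rw [← e1, e2, Pi.zero_apply]
  have hΨ : MemLp Ψ 2 ((lineMeasure K a b).prod (volume.restrict (Ioo 0 c))) := Lp.memLp Ψ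
  refine Lp.ext (EventuallyEq.trans (ae_eq_zero_of_ae_ae hΨ.1 ?_) (Lp.coeFn_zero _ _ _).symm)
  filter_upwards [h1, memLp_slice hΨ] with x e1 e2
  exact ae_eq_zero_of_integral_sineMode_eq_zero hc e2 e1

/-- The projection `P_n`. -/
def modeProj (K a b c : ℝ) (n : ℕ) : L2Rect K a b c →L[ℂ] L2Rect K a b c :=
  modeOp K a b c n ∘L modeCoeff K a b c n

theorem isModeProjection_modeProj (n : ℕ) : IsModeProjection K a b c n (modeProj K a b c n) := by
  intro Ψ
  have h := ae_eq_comp_fst (ν := volume.restrict (Ioo 0 c)) (modeCoeff_coeFn n Ψ)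
  filter_upwards [modeOp_coeFn n (modeCoeff K a b c n Ψ), h] with p h1 h2
  rw [h2] at h1
  exact h1

theorem isStarProjection_modeProj (hc : 0 < c) (n : ℕ+) :
    IsStarProjection (modeProj K a b c n) := by
  refine ⟨?_, ?_⟩
  · refine ContinuousLinearMap.ext fun Ψ => ?_
    change modeOp K a b c n (modeCoeff K a b c n (modeOp K a b c n (modeCoeff K a b c n Ψ)))
      = modeOp K a b c n (modeCoeff K a b c n Ψ)
    rw [modeCoeff_modeOp hc]
  · rw [ContinuousLinearMap.isSelfAdjoint_iff', modeProj, ContinuousLinearMap.adjoint_comp,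
      modeCoeff, ContinuousLinearMap.adjoint_adjoint]

theorem modeProj_mul_modeProj (hc : 0 < c) {m n : ℕ+} (h : m ≠ n) :
    modeProj K a b c m * modeProj K a b c n = 0 := by
  refine ContinuousLinearMap.ext fun Ψ => ?_
  change modeOp K a b c m (modeCoeff K a b c m (modeOp K a b c n (modeCoeff K a b c n Ψ))) = 0
  rw [modeCoeff_modeOp_of_ne hc h, map_zero]

section Basis

variable {ι : ℕ+ → Type} (e : ∀ n, HilbertBasis (ι n) ℂ (L2Line K a b))

theorem orthonormal_modeOp (hc : 0 < c) :
    Orthonormal ℂ fun i : Σ n, ι n => modeOp K a b c i.1 (e i.1 i.2) := by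
  classical
  rw [orthonormal_iff_ite]
  rintro ⟨m, i⟩ ⟨n, j⟩
  rw [inner_modeOp hc]
  by_cases h : m = n
  · subst h
    simp [orthonormal_iff_ite.1 (e m).orthonormal i j]
  · simp [h]

/-- The Hilbert basis of `L²(Ω₀, g)` assembled from Hilbert bases in the single modes. -/
def modeBasis (hc : 0 < c) : HilbertBasis (Σ n, ι n) ℂ (L2Rect K a b c) :=
  HilbertBasis.mkOfOrthogonalEqBot (orthonormal_modeOp e hc) (by
    rw [Submodule.eq_bot_iff]
    intro Ψ hΨ
    refine eq_zero_of_modeCoeff_eq_zero hc fun n => HilbertBasis.ext_inner (e n) fun i => ?_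
    rw [inner_modeCoeff, inner_zero_right]
    exact (Submodule.mem_orthogonal _ _).1 hΨ _ (Submodule.subset_span ⟨⟨n, i⟩, rfl⟩))

theorem modeBasis_apply (hc : 0 < c) (i : Σ n, ι n) :
    modeBasis e hc i = modeOp K a b c i.1 (e i.1 i.2) := by
  rw [modeBasis, HilbertBasis.coe_mkOfOrthogonalEqBot]

/-- An arbitrary Hilbert basis of the line space, used in every mode, gives a basis on the
rectangle; grouping the expansion by mode yields the projections. -/
theorem hasSum_modeProj (hc : 0 < c) (Ψ : L2Rect K a b c) :
    HasSum (fun n : ℕ+ => modeProj K a b c n Ψ) Ψ := by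
  obtain ⟨w, e, -⟩ := exists_hilbertBasis ℂ (L2Line K a b)
  have h := (modeBasis (c := c) (fun _ => e) hc).hasSum_repr Ψ
  refine h.sigma fun n => ?_
  have h1 := (e.hasSum_repr (modeCoeff K a b c n Ψ)).mapL (modeOp K a b c n)
  change HasSum _ (modeOp K a b c n (modeCoeff K a b c n Ψ))
  convert h1 using 2 with i
  rw [map_smul, modeBasis_apply, HilbertBasis.repr_apply_apply, HilbertBasis.repr_apply_apply,
    modeBasis_apply, inner_modeCoeff]

/-- Membership in the graph of the direct sum of diagonal operators. -/
theorem mem_diagGraph_modeBasis (hc : 0 < c) {l : ∀ n, ι n → ℝ}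
    {q : L2Rect K a b c × L2Rect K a b c} :
    q ∈ diagGraph (modeBasis e hc) (fun i => l i.1 i.2) ↔
      ∀ n : ℕ+, (modeCoeff K a b c n q.1, modeCoeff K a b c n q.2) ∈ diagGraph (e n) (l n) := by
  simp only [mem_diagGraph, modeBasis_apply, Sigma.forall, inner_modeCoeff]

end Basis

theorem mem_fiberGraph_iff {n : ℕ} {q : L2Rect K a b c × L2Rect K a b c} :
    q ∈ fiberGraph K a b c εp εm n ↔ ∃ p ∈ (lineA K a b c εp εm n).graph,
      q.1 = modeOp K a b c n p.1 ∧ q.2 = modeOp K a b c n p.2 := by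
  constructor
  · rintro ⟨ψ, h1, h2⟩
    exact ⟨(ψ, lineA K a b c εp εm n ψ), LinearPMap.mem_graph _ ψ,
      Lp.ext (h1.trans (modeOp_coeFn n _).symm), Lp.ext (h2.trans (modeOp_coeFn n _).symm)⟩
  · rintro ⟨p, hp, h1, h2⟩
    obtain ⟨ψ, e1, e2⟩ := LinearPMap.mem_graph_iff _ |>.1 hp
    refine ⟨ψ, ?_, ?_⟩
    · rw [h1, ← e1]; exact modeOp_coeFn n _
    · rw [h2, ← e2]; exact modeOp_coeFn n _

/-- Taking the coefficient in mode `n` of the convergent series isolates its `n`-th term. Conversely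
the required series is the mode expansion of `q.2`, which always converges. -/
theorem mem_directSumGraph_iff (hc : 0 < c) {q : L2Rect K a b c × L2Rect K a b c} :
    q ∈ directSumGraph K a b c εp εm (fun n => modeProj K a b c n) ↔
      ∀ n : ℕ+, (modeCoeff K a b c n q.1, modeCoeff K a b c n q.2) ∈
        (lineA K a b c εp εm n).graph := by
  constructor
  · rintro ⟨s, hs, hsum⟩ n
    choose p hp h1 h2 using fun n => mem_fiberGraph_iff.1 (hs n)
    have e1 : modeCoeff K a b c n q.1 = (p n).1 := by
      have := congrArg (modeCoeff K a b c n) (h1 n)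
      change modeCoeff K a b c n (modeOp K a b c n (modeCoeff K a b c n q.1)) = _ at this
      rwa [modeCoeff_modeOp hc, modeCoeff_modeOp hc] at this
    have e2 : modeCoeff K a b c n q.2 = (p n).2 := by
      have h3 := hsum.mapL (modeCoeff K a b c n)
      have h4 : HasSum (fun m => modeCoeff K a b c n (s m)) (modeCoeff K a b c n (s n)) :=
        hasSum_single n fun m hm => by
          have h5 : s m = modeOp K a b c m (p m).2 := h2 m
          rw [h5, modeCoeff_modeOp_of_ne hc hm.symm]
      have h5 : s n = modeOp K a b c n (p n).2 := h2 n
      rw [h3.unique h4, h5, modeCoeff_modeOp hc]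
    rw [e1, e2]
    exact hp n
  · intro h
    exact ⟨fun n => modeProj K a b c n q.2, fun n => mem_fiberGraph_iff.2 ⟨_, h n, rfl, rfl⟩,
      hasSum_modeProj hc q.2⟩

/-! ### Assembly -/

/-- Two derivatives of the sine produce `-(n π / c)²`, which turns the Laplace–Beltrami expression
into `lineExpr`. -/
theorem modeOp_mem_dotGraph (ad : IsAdmissible K a b) (hc : 0 < c) (n : ℕ)
    {p : L2Line K a b × L2Line K a b} (hp : p ∈ lineGraph K a b c εp εm n) :
    (modeOp K a b c n p.1, modeOp K a b c n p.2) ∈ dotGraph K a b c εp εm := by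
  obtain ⟨v, v', v'', D, hv, hv'⟩ := hp
  refine ⟨_, _, _, _, _, _, _, dotDomain_tensor ad.a_pos ad.b_pos hc n D, ?_, ?_⟩
  · filter_upwards [modeOp_coeFn n p.1, ae_eq_comp_fst (ν := volume.restrict (Ioo 0 c)) hv]
      with r h1 h2
    rw [h1, h2]
  · filter_upwards [modeOp_coeFn n p.2, ae_eq_comp_fst (ν := volume.restrict (Ioo 0 c)) hv']
      with r h1 h2
    rw [h1, h2]
    simp only [laplaceBeltrami, lineExpr, deriv_deriv_cSine]
    push_cast
    ring

theorem nontrivial_L2Line (ad : IsAdmissible K a b) : Nontrivial (L2Line K a b) := by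
  refine ⟨indicatorConstLp 2 MeasurableSet.univ (measure_ne_top _ univ) (1 : ℂ), 0, fun h => ?_⟩
  have h1 := congrArg norm h
  rw [norm_indicatorConstLp (by norm_num) (by norm_num), norm_zero] at h1
  have h2 : (lineMeasure K a b).real univ = 0 := by
    simpa [Real.rpow_eq_zero_iff_of_nonneg measureReal_nonneg] using h1
  rw [measureReal_eq_zero_iff] at h2
  have h3 := volume_ac_lineMeasure ad.curv h2
  simp at h3
  linarith [ad.lt]

theorem HilbertBasis.nonempty {H ι : Type*} [NormedAddCommGroup H] [InnerProductSpace ℂ H]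
    [Nontrivial H] (e : HilbertBasis ι ℂ H) : Nonempty ι := by
  by_contra h
  rw [not_nonempty_iff] at h
  obtain ⟨x, hx⟩ := exists_ne (0 : H)
  exact hx (HilbertBasis.ext_inner e fun i => h.elim i)

theorem HilbertBasis.exists_reindex {H ι κ : Type*} [NormedAddCommGroup H] [InnerProductSpace ℂ H]
    [CompleteSpace H] (e : HilbertBasis ι ℂ H) (f : κ ≃ ι) :
    ∃ e' : HilbertBasis κ ℂ H, ∀ k, e' k = e (f k) := by
  have ho : Orthonormal ℂ (e ∘ f) := e.orthonormal.comp f f.injective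
  refine ⟨HilbertBasis.mk ho ?_, fun k => ?_⟩
  · rw [f.surjective.range_comp, e.dense_span]
  · rw [HilbertBasis.coe_mk]; rfl

theorem closure_iUnion_closure {X κ : Type*} [TopologicalSpace X] (s : κ → Set X) :
    closure (⋃ i, closure (s i)) = closure (⋃ i, s i) :=
  subset_antisymm (closure_minimal (iUnion_subset fun i => closure_mono (subset_iUnion s i))
    isClosed_closure) (closure_mono (iUnion_mono fun _ => subset_closure))

end

end IndefLap
end

theorem mainTheorem1 (K a b c εp εm : ℝ) (ha : 0 < a) (hb : 0 < b) (hc : 0 < c)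
    (hεp : 0 < εp) (hεm : 0 < εm)
    (hK : 0 < K → √K * a < Real.pi / 2 ∧ √K * b < Real.pi / 2) :
    -- the eigenfunctions form a complete orthonormal set
    (∃ (e : HilbertBasis ℕ ℂ (L2Rect K a b c)) (l : ℕ → ℝ), ∀ i,
      ∃ h : e i ∈ (dotA K a b c εp εm).domain,
        dotA K a b c εp εm ⟨e i, h⟩ = (l i : ℂ) • e i) ∧
    -- essential self-adjointness, and uniqueness of the self-adjoint extension
    IsEssentiallySelfAdjoint (dotA K a b c εp εm) ∧
    (∀ B : L2Rect K a b c →ₗ.[ℂ] L2Rect K a b c, IsSelfAdjoint B →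
      dotA K a b c εp εm ≤ B → B = (dotA K a b c εp εm).closure) ∧
    -- the transversal operators are self-adjoint with compact resolvent
    (∀ n : ℕ+, IsSelfAdjoint (lineA K a b c εp εm n) ∧
      HasCompactResolvent (lineA K a b c εp εm n)) ∧
    -- the spectra
    pointSpectrum (dotA K a b c εp εm) = ⋃ n : ℕ+, pointSpectrum (lineA K a b c εp εm n) ∧
    opSpectrum (dotA K a b c εp εm).closure = closure (pointSpectrum (dotA K a b c εp εm)) ∧
    opSpectrum (dotA K a b c εp εm).closure =
      closure (⋃ n : ℕ+, opSpectrum (lineA K a b c εp εm n)) ∧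
    -- the orthogonal decomposition over the sine modes
    ∃ P : ℕ+ → L2Rect K a b c →L[ℂ] L2Rect K a b c,
      (∀ n : ℕ+, IsModeProjection K a b c n (P n) ∧ IsStarProjection (P n)) ∧
      (∀ m n : ℕ+, m ≠ n → P m * P n = 0) ∧
      (∀ Ψ, HasSum (fun n => P n Ψ) Ψ) ∧
      ((dotA K a b c εp εm).closure.graph : Set (L2Rect K a b c × L2Rect K a b c)) =
        directSumGraph K a b c εp εm P := by
  have ad : IsAdmissible K a b := ⟨ha, hb, hK⟩
  choose hres ι e l hgraph using fun n : ℕ+ =>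
    lineA_diagonalization (c := c) ad hεp hεm (n : ℕ)
  have hline : ∀ n : ℕ+, (lineA K a b c εp εm n).graph = lineGraph K a b c εp εm n := fun n =>
    lineA_graph n ha hb hK
  have hdot := dotA_graph (c := c) (εp := εp) (εm := εm) ha hb hK
  have hself : ∀ (n : ℕ+) (i : ι n), (e n i, (l n i : ℂ) • e n i) ∈ lineGraph K a b c εp εm n :=
    fun n i => by
    rw [← hline, hgraph]; exact self_mem_diagGraph (e n) (l n) i
  let E := modeBasis (c := c) e hc
  let L : (Σ n, ι n) → ℝ := fun i => l i.1 i.2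
  -- `h1` and `h2` are the two inclusions of the diagonal principle: the product eigenpairs belong
  -- to `dotA`, and Green's formula bounds `dotA` by the diagonal operator.
  have h1 : ∀ i, (E i, (L i : ℂ) • E i) ∈ (dotA K a b c εp εm).graph := fun i => by
    have := modeOp_mem_dotGraph ad hc i.1 (hself i.1 i.2)
    rw [hdot, modeBasis_apply]
    simpa only [map_smul] using this
  have h2 : (dotA K a b c εp εm).graph ≤ diagGraph E L := fun q hq i => by
    rw [hdot] at hq
    have := inner_modeOp_dot ad hc i.1 (hself i.1 i.2) hq
    rw [modeBasis_apply, this]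
    simp only [map_smul, inner_smul_left, Complex.conj_ofReal]
    rfl
  have hclosure := closure_graph_eq_diagGraph h1 h2
  have hpoint := pointSpectrum_eq_range_of_diagonal h1 h2
  have hspec := opSpectrum_eq_closure_range_of_diagonal hclosure
  have hpoint' : ∀ n : ℕ+, pointSpectrum (lineA K a b c εp εm n) = range fun i => (l n i : ℂ) :=
    fun n => pointSpectrum_eq_range_of_diagonal (fun i => hgraph n ▸ self_mem_diagGraph _ _ i)
      (hgraph n).le
  have hrange : (range fun i => (L i : ℂ)) = ⋃ n, range fun i => (l n i : ℂ) := by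
    ext z
    simp [L]
  refine ⟨?_, isEssentiallySelfAdjoint_of_diagonal h1 h2,
    fun B hB hle => eq_closure_of_isSelfAdjoint_of_le h1 h2 hB hle,
    fun n => ⟨isSelfAdjoint_of_graph_eq_diagGraph (hgraph n), hres n⟩, ?_, ?_, ?_,
    fun n => modeProj K a b c n, fun n => ⟨isModeProjection_modeProj _,
      isStarProjection_modeProj hc n⟩, fun m n h => modeProj_mul_modeProj hc h,
    hasSum_modeProj hc, ?_⟩
  · have := nontrivial_L2Line ad
    have : ∀ n, Nonempty (ι n) := fun n => HilbertBasis.nonempty (e n)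
    have : ∀ n, Countable (ι n) := fun n => Orthonormal.countable_of_separable (e n).orthonormal
    -- Every mode contributes at least one eigenfunction, since the line space is non-trivial, so
    -- the countable index set is infinite and can be relabelled by `ℕ`.
    have : Infinite (Σ n, ι n) := Infinite.of_surjective Sigma.fst Sigma.fst_surjective
    obtain ⟨f⟩ := nonempty_equiv_of_countable (α := ℕ) (β := Σ n, ι n)
    obtain ⟨e', he'⟩ := HilbertBasis.exists_reindex E f
    refine ⟨e', fun k => L (f k), fun k => ?_⟩
    obtain ⟨x, hx, hx'⟩ := (LinearPMap.mem_graph_iff _).1 (h1 (f k))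
    have hx : (x : L2Rect K a b c) = e' k := hx.trans (he' k).symm
    refine ⟨hx ▸ x.2, ?_⟩
    have hx2 : (⟨e' k, hx ▸ x.2⟩ : (dotA K a b c εp εm).domain) = x := Subtype.ext hx.symm
    rw [hx2, hx', he' k]
  · rw [hpoint, hrange]
    simp only [hpoint']
  · rw [hspec, hpoint]
  · rw [hspec, hrange, ← closure_iUnion_closure]
    congr 1
    refine iUnion_congr fun n => ?_
    rw [opSpectrum_eq_closure_range_of_diagonal (hgraph n)]
  · ext q
    rw [SetLike.mem_coe, hclosure, mem_diagGraph_modeBasis, mem_directSumGraph_iff hc]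
    simp only [hgraph]
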